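/- Let $k$ be a field with algebraic closure $\bar k$, let $r\ge 0$, and let $\Gamma\subset\mathbf P^r_k$ be a closed subscheme that is finite over $k$; its degree is $\deg\Gamma=\dim_k H^0(\mathcal O_\Gamma)$. Assume that $\Gamma$ is geometrically in linearly general position: for every $d<r$, every closed subscheme of $\bar k\otimes_k\Gamma\subset\mathbf P^r_{\bar k}$ that lies on a $d$-dimensional linear subspace of $\mathbf P^r_{\bar k}$ has degree at most $d+1$. (a) If $\deg\Gamma=r+3$, then $\Gamma$ lies on a rational normal curve if and only if $\Gamma$ is Gorenstein (that is, every local ring of $\Gamma$ is Gorenstein). Here a rational normal curve in $\mathbf P^r_k$ is the image of $\mathbf P^1_k$ under a morphism $(l_0:\dots:l_r)$ where $l_0,\dots,l_r$ is a $k$-basis of the space of binary forms of degree $r$ over $k$, and "lies on" is meant scheme-theoretically. (b) If $\deg\Gamma\ge r+3$ and $\Gamma$ is Gorenstein, then $\Gamma$ is curvilinear and unramified, in the following sense. Curvilinear: each local ring $\mathcal O_{\Gamma,p}$ is isomorphic, as a ring, to $F[x]/(x^n)$ for some $n$ and some field extension $F$ of $k$. Unramified: for each point $p$ of $\bar k\otimes_k\Gamma$,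 the image of the natural map from the space of linear forms on $\mathbf P^r_{\bar k}$ to $\mathcal O_{\bar k\otimes\Gamma,p}$ (defined by choosing a local generator of $\mathcal O(1)$ at $p$) is a vector space complement of an ideal; likewise, over $k$, for each $k$-rational point $p$ of $\Gamma$ and the map from the space of linear forms on $\mathbf P^r_k$ to $\mathcal O_{\Gamma,p}$. -/

import Mathlib

open CategoryTheory AlgebraicGeometry

universe u

attribute [local instance] MvPolynomial.gradedAlgebra

noncomputable section

namespace FiniteInProj

/-! ### Projective space over a field -/

/-- The standard grading of the polynomial ring `k[x₀, …, x_r]` by degree. -/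
abbrev forms (k : Type u) [Field k] (r : ℕ) : ℕ → Submodule k (MvPolynomial (Fin (r + 1)) k) :=
  MvPolynomial.homogeneousSubmodule (Fin (r + 1)) k

/-- Projective `r`-space over the field `k`, `Proj k[x₀, …, x_r]`. -/
abbrev PSpace (k : Type u) [Field k] (r : ℕ) : Scheme.{u} := Proj (forms k r)

/-- The structure morphism `ℙ^r_k ⟶ Spec k`. -/
def PSpace.str (k : Type u) [Field k] (r : ℕ) : PSpace k r ⟶ Spec (.of k) :=
  Proj.toSpecZero (forms k r) ≫ Spec.map (CommRingCat.ofHom (algebraMap k (forms k r 0)))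

/-- The graded ring homomorphism `k[x₀, …, x_r] → K[x₀, …, x_r]` for a field extension `K / k`. -/
def extendScalars (k K : Type u) [Field k] [Field K] [Algebra k K] (r : ℕ) :
    forms k r →+*ᵍ forms K r where
  toRingHom := MvPolynomial.map (algebraMap k K)
  map_mem h := MvPolynomial.IsHomogeneous.map h _

theorem irrelevant_le_map (k K : Type u) [Field k] [Field K] [Algebra k K] (r : ℕ) :
    HomogeneousIdeal.irrelevant (forms K r) ≤
      (HomogeneousIdeal.irrelevant (forms k r)).map (extendScalars k K r) := by
  suffices h : (HomogeneousIdeal.irrelevant (forms K r)).toIdeal ≤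
      ((HomogeneousIdeal.irrelevant (forms k r)).map (extendScalars k K r)).toIdeal from h
  intro F hF
  have hX : ∀ i : Fin (r + 1), (MvPolynomial.X i : MvPolynomial (Fin (r + 1)) K) ∈
      ((HomogeneousIdeal.irrelevant (forms k r)).map (extendScalars k K r)).toIdeal := by
    intro i
    have h1 : (MvPolynomial.X i : MvPolynomial (Fin (r + 1)) k) ∈
        (HomogeneousIdeal.irrelevant (forms k r)).toIdeal :=
      HomogeneousIdeal.mem_irrelevant_of_mem _ one_pos (MvPolynomial.isHomogeneous_X k i)
    have h2 : extendScalars k K r (MvPolynomial.X i) = MvPolynomial.X i :=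
      MvPolynomial.map_X _ _
    exact h2 ▸ Ideal.mem_map_of_mem _ h1
  rw [HomogeneousIdeal.mem_iff, HomogeneousIdeal.mem_irrelevant_iff] at hF
  have h0 : MvPolynomial.coeff 0 F = 0 := by
    have h3 : MvPolynomial.homogeneousComponent 0 F = 0 := by
      rw [← hF]
      exact (MvPolynomial.decomposition.decompose'_apply F 0).symm
    rw [MvPolynomial.homogeneousComponent_zero] at h3
    exact MvPolynomial.C_eq_zero.mp h3
  rw [MvPolynomial.as_sum F]
  refine Ideal.sum_mem _ fun m hm => ?_
  have hm0 : m ≠ 0 := by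
    rintro rfl
    exact (MvPolynomial.mem_support_iff.mp hm) h0
  obtain ⟨i, hi⟩ := Finsupp.ne_iff.mp hm0
  have hd : (MvPolynomial.X i : MvPolynomial (Fin (r + 1)) K) ∣
      MvPolynomial.monomial m (MvPolynomial.coeff m F) := by
    rw [MvPolynomial.X_dvd_monomial]
    exact Or.inr hi
  exact Ideal.mem_of_dvd _ hd (hX i)

/-- The projection `ℙ^r_K ⟶ ℙ^r_k` for a field extension `K / k`. -/
def PSpace.proj (k K : Type u) [Field k] [Field K] [Algebra k K] (r : ℕ) :
    PSpace K r ⟶ PSpace k r :=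
  Proj.map (extendScalars k K r) (irrelevant_le_map k K r)

section

variable {k : Type u} [Field k] {r : ℕ}

/-- The open subset `x_i ≠ 0` of `ℙ^r_k`. -/
def chart (k : Type u) [Field k] {r : ℕ} (i : Fin (r + 1)) : (PSpace k r).Opens :=
  Proj.basicOpen (forms k r) (MvPolynomial.X i)

theorem X_mem_forms (i : Fin (r + 1)) :
    (MvPolynomial.X i : MvPolynomial (Fin (r + 1)) k) ∈ forms k r 1 :=
  MvPolynomial.isHomogeneous_X k i

theorem forms_mem_smul_one {d : ℕ} (F : forms k r d) :
    (F : MvPolynomial (Fin (r + 1)) k) ∈ forms k r (d • 1) := by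
  rw [smul_eq_mul, mul_one]
  exact F.2

/-- For a form `F` of degree `d`, the element `F / x_i ^ d` of the degree zero part of the
localization `k[x₀, …, x_r][1 / x_i]`; additive in `F`. -/
def awayFrac (d : ℕ) (i : Fin (r + 1)) :
    forms k r d →+ HomogeneousLocalization.Away (forms k r) (MvPolynomial.X i) where
  toFun F := HomogeneousLocalization.Away.mk (forms k r) (X_mem_forms i) d F (forms_mem_smul_one F)
  map_zero' := by
    apply HomogeneousLocalization.val_injective
    rw [HomogeneousLocalization.Away.val_mk, HomogeneousLocalization.val_zero]
    exact Localization.mk_zero _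
  map_add' F G := by
    apply HomogeneousLocalization.val_injective
    rw [HomogeneousLocalization.val_add]
    simp only [HomogeneousLocalization.Away.val_mk]
    rw [Localization.add_mk_self]
    rfl

/-- For a form `F` of degree `d`, the regular function `F / x_i ^ d` on `x_i ≠ 0`. -/
def frac (d : ℕ) (i : Fin (r + 1)) : forms k r d →+ Γ(PSpace k r, chart k i) :=
  (Proj.awayToSection (forms k r) (MvPolynomial.X i)).hom.toAddMonoidHom.comp (awayFrac d i)

/-- For a form `F` of degree `d` on `ℙ^r_k` and a morphism `g : T ⟶ ℙ^r_k`, the pull-back of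
`F / x_i ^ d` to the open subscheme of `T` where `x_i ≠ 0`. It represents the restriction of the
section `F` of `𝒪(d)` to `T`, in the trivialization of `𝒪(d)` given by `x_i ^ d`. -/
def restrictForm {T : Scheme.{u}} (g : T ⟶ PSpace k r) (d : ℕ) (i : Fin (r + 1)) :
    forms k r d →+ Γ(T, g ⁻¹ᵁ chart k i) :=
  (g.app (chart k i)).hom.toAddMonoidHom.comp (frac d i)

/-- The form `F` of degree `d` vanishes on `T` (scheme-theoretically): it restricts to the zero
section of `𝒪(d)` on `T`. -/
def Vanishes {T : Scheme.{u}} (g : T ⟶ PSpace k r) {d : ℕ} (F : forms k r d) : Prop :=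
  ∀ i : Fin (r + 1), restrictForm g d i F = 0

/-- The degree of a `k`-scheme that is finite over `k`: the `k`-dimension of its ring of
global functions. -/
def degree {T : Scheme.{u}} (s : T ⟶ Spec (.of k)) : ℕ :=
  letI : Algebra k Γ(T, ⊤) := ((Scheme.ΓSpecIso (.of k)).inv ≫ s.appTop).hom.toAlgebra
  Module.finrank k Γ(T, ⊤)

/-! ### Position with respect to linear subspaces -/

/-- `T`, with its morphism to `ℙ^r_k` (in practice a closed immersion), is in linearly general
position: every closed subscheme `Z` of `T` lying on a linear subspace of dimension `d < r` has
degree at most `d + 1`. A linear subspace of dimension `d` is the scheme of zeros of an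
`(r - d)`-dimensional space `U` of linear forms. -/
def LinearlyGeneralPosition {T : Scheme.{u}} (g : T ⟶ PSpace k r) : Prop :=
  ∀ (d : ℕ), d < r → ∀ U : Submodule k (forms k r 1), Module.finrank k U + d = r →
    ∀ (Z : Scheme.{u}) (j : Z ⟶ T) [IsClosedImmersion j],
      (∀ l ∈ U, Vanishes (j ≫ g) l) → degree (j ≫ g ≫ PSpace.str k r) ≤ d + 1

/-- The base change of `g : T ⟶ ℙ^r_k` to the algebraic closure `k̄` of `k`, a morphism
`T ×_{ℙ^r_k} ℙ^r_k̄ ⟶ ℙ^r_k̄`; its source is `k̄ ⊗_k T`. -/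
abbrev geomFiber {T : Scheme.{u}} (g : T ⟶ PSpace k r) :
    Limits.pullback g (PSpace.proj k (AlgebraicClosure k) r) ⟶ PSpace (AlgebraicClosure k) r :=
  Limits.pullback.snd g (PSpace.proj k (AlgebraicClosure k) r)

/-- `k̄ ⊗_k T` is in linearly general position in `ℙ^r_k̄`. -/
def GeometricallyLGP {T : Scheme.{u}} (g : T ⟶ PSpace k r) : Prop :=
  LinearlyGeneralPosition (geomFiber g)

/-! ### Rational normal curves -/

/-- `T` lies (scheme-theoretically) on a rational normal curve, i.e. on the image of `ℙ^1_k` in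
`ℙ^r_k` under a morphism `(l 0 : … : l r)` given by a basis `l` of the space of all forms of
degree `r` in two variables. The homogeneous ideal of that curve consists of the forms `F` with
`F(l 0, …, l r) = 0`. -/
def LiesOnRationalNormalCurve {T : Scheme.{u}} (g : T ⟶ PSpace k r) : Prop :=
  ∃ l : Module.Basis (Fin (r + 1)) k (MvPolynomial.homogeneousSubmodule (Fin 2) k r),
    ∀ (d : ℕ) (F : forms k r d),
      MvPolynomial.aeval (fun j => (l j : MvPolynomial (Fin 2) k)) F.1 = 0 → Vanishes g F

/-! ### Local conditions -/

/-- A zero-dimensional scheme is Gorenstein if all its local rings are; a zero-dimensional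
Noetherian local ring is Gorenstein if it is injective as a module over itself. -/
def IsGorensteinScheme (T : Scheme.{u}) : Prop :=
  ∀ p : T, Module.Injective (T.presheaf.stalk p) (T.presheaf.stalk p)

/-- `T` is curvilinear: each local ring is isomorphic, as a ring, to `F[x]/(x^n)` for some `n` and
some field extension `F` of `k`. -/
def IsCurvilinear (k : Type u) [Field k] (T : Scheme.{u}) : Prop :=
  ∀ p : T, ∃ (F : Type u) (_ : Field F) (_ : Algebra k F) (n : ℕ),
    Nonempty (T.presheaf.stalk p ≃+*
      Polynomial F ⧸ Ideal.span {(Polynomial.X : Polynomial F) ^ n})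

/-- The natural map from the space of linear forms on `ℙ^r_k` to the local ring of `T` at `p`,
where `𝒪(1)` is trivialized near the image of `p` by a coordinate `x_i` not vanishing there. -/
def linearFormsToStalk {T : Scheme.{u}} (g : T ⟶ PSpace k r) (p : T) (i : Fin (r + 1))
    (hp : p ∈ g ⁻¹ᵁ chart k i) : forms k r 1 →+ T.presheaf.stalk p :=
  (T.presheaf.germ (g ⁻¹ᵁ chart k i) p hp).hom.toAddMonoidHom.comp (restrictForm g 1 i)

/-- `T` is unramified at `p`: the image of the space of linear forms in the local ring at `p` is
a (vector space) complement of an ideal. -/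
def IsUnramifiedAt {T : Scheme.{u}} (g : T ⟶ PSpace k r) (p : T) : Prop :=
  ∀ (i : Fin (r + 1)) (hp : p ∈ g ⁻¹ᵁ chart k i), ∃ J : Ideal (T.presheaf.stalk p),
    IsCompl (linearFormsToStalk g p i hp).range J.toAddSubgroup

/-- `p` is a `k`-rational point: `k` maps onto the residue field of `p`. -/
def IsRationalPoint {T : Scheme.{u}} (s : T ⟶ Spec (.of k)) (p : T) : Prop :=
  Function.Surjective
    ((Scheme.ΓSpecIso (.of k)).inv ≫ s.appTop ≫ T.evaluation ⊤ p trivial).hom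

end

end FiniteInProj

end

open FiniteInProj

/-!
A finite scheme `Γ ⊂ ℙ^r` is affine and its line bundles are trivial, so `Γ` has homogeneous
coordinates `a 0, …, a r` in `A = Γ(Γ, ⊤)`, with span `W` (`exists_isCoordinates`). A form vanishes
on `Γ` if and only if it vanishes at `a`, closed subschemes of `Γ` are ideals of `A`, and base
change to the algebraic closure `K` replaces `A` by `K ⊗ A`. Linearly general position then says
that `W` maps injectively or surjectively to each quotient ring of `K ⊗ A` (`InGeneralPosition`),
and the Gorenstein property says that `A` has a functional `lam` that is nonzero on every nonzero
ideal (`exists_isNondegenerate`). For the form `(a, b) ↦ lam (a * b)` the orthogonal space of an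
ideal is its annihilator, so the orthogonal space of `W` is also in general position; this is the
algebraic form of Gale duality.

*Gorenstein implies that `Γ` lies on a rational normal curve.* If `dim A = r + 3`, then `W` has a
two-dimensional orthogonal space, with basis `s`, `t`. General position makes binary forms of degree
less than `dim A` in `s`, `t` nonzero (`aeval_ne_zero_of_isHomogeneous`), so that the forms of degree
`r + 1` fill a hyperplane, orthogonal to some `mu ≠ 0`. Then `mu` times the forms of degree `r` is
orthogonal to `s` and `t`, hence equals `W` for dimension reasons, since `mu` is not a zero divisor
(`eq_zero_of_mul_eq_zero_of_orthogonal`). Now `a j = mu * l j (s, t)` for a basis `l` of the binary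
forms of degree `r` over the ground field (`exists_basis_binary_forms`).

*A subscheme of a rational normal curve is Gorenstein.* The local rings are generated by the
quotients of coordinates, hence by the value of one of the two quotients of the parameters of the
curve. They are proper quotients of a polynomial ring in one variable, hence self-injective
(`injective_of_rationalNormalCurve`).

*Curvilinear.* If `dim A ≥ r + 3` and `r ≥ 1`, the duality shows that every ideal of `K ⊗ A` of
dimension `r + 2` is principal (`InGeneralPosition.exists_eq_span_singleton`). A pencil argument
deduces that each maximal ideal `m` of `K ⊗ A` has `dim m / m² ≤ 1`
(`exists_le_span_sup_sq_of_principal`), that is, the ideals of each local ring form a chain. This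
descends from `K ⊗ A` to `A` (`IsUniserialAt.of_baseChange`), even if residue fields of `A` are
inseparable over the ground field. Since an Artinian local ring that contains a field has a
coefficient field (`exists_coefficientField`), one with principal maximal ideal is `F[x] / (x ^ n)`.

*Unramified.* The image of `W` in a local ring is in general position; if the residue field is the
ground field, the local ring has ideals of each dimension up to its own, and one whose dimension is
complementary to that of the image of `W` is a complement of it
(`InGeneralPosition.exists_isCompl`).
-/

namespace FiniteInProj

open scoped TensorProduct

/-! ### Finite-dimensional algebras with a nondegenerate functional -/

section Functional

variable {K A : Type*} [Field K] [CommRing A] [Algebra K A]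

/-- The symmetric bilinear form `(a, b) ↦ lam (a * b)` attached to a linear functional `lam`. -/
noncomputable def mulForm (lam : A →ₗ[K] K) : LinearMap.BilinForm K A :=
  (LinearMap.mul K A).compr₂ lam

@[simp] theorem mulForm_apply (lam : A →ₗ[K] K) (a b : A) : mulForm lam a b = lam (a * b) := rfl

/-- `lam` is nonzero on every nonzero ideal; for a finite-dimensional algebra, the existence of
such a functional is the Gorenstein property. -/
def IsNondegenerate (lam : A →ₗ[K] K) : Prop :=
  ∀ a, (∀ b, lam (a * b) = 0) → a = 0

theorem IsNondegenerate.mulForm {lam : A →ₗ[K] K} (h : IsNondegenerate lam) :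
    (mulForm lam).Nondegenerate :=
  ⟨fun a ha => h a fun b => ha b, fun a ha => h a fun b => by rw [mul_comm]; exact ha b⟩

theorem mulForm_isRefl (lam : A →ₗ[K] K) : (mulForm lam).IsRefl := fun a b h => by
  rw [mulForm_apply, mul_comm]; exact h

/-- The orthogonal space of an ideal is its annihilator. -/
theorem IsNondegenerate.orthogonal_ideal {lam : A →ₗ[K] K} (h : IsNondegenerate lam)
    (I : Ideal A) :
    (FiniteInProj.mulForm lam).orthogonal (I.restrictScalars K) =
      Submodule.restrictScalars K (Submodule.annihilator I : Ideal A) := by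
  ext a
  simp only [LinearMap.BilinForm.mem_orthogonal_iff, Submodule.restrictScalars_mem,
    Submodule.mem_annihilator, mulForm_apply, smul_eq_mul]
  constructor
  · intro H n hn
    refine h _ fun b => ?_
    rw [mul_assoc, mul_comm]
    exact H _ (I.mul_mem_right b hn)
  · intro H n hn
    rw [mul_comm, H n hn, map_zero]

variable [Module.Finite K A]

theorem IsNondegenerate.finrank_annihilator {lam : A →ₗ[K] K} (h : IsNondegenerate lam)
    (I : Ideal A) :
    Module.finrank K (Submodule.restrictScalars K (Submodule.annihilator I : Ideal A)) +
      Module.finrank K (I.restrictScalars K) = Module.finrank K A := by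
  rw [← h.orthogonal_ideal, LinearMap.BilinForm.finrank_orthogonal h.mulForm]
  exact Nat.sub_add_cancel (Submodule.finrank_le _)

theorem IsNondegenerate.annihilator_annihilator {lam : A →ₗ[K] K} (h : IsNondegenerate lam)
    (I : Ideal A) : Submodule.annihilator (Submodule.annihilator I : Ideal A) = I := by
  apply Submodule.restrictScalars_injective K
  rw [← h.orthogonal_ideal, ← h.orthogonal_ideal,
    LinearMap.BilinForm.orthogonal_orthogonal h.mulForm (mulForm_isRefl lam)]

end Functional

/-! ### Subspaces in general position with respect to ideals -/

section GeneralPosition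

variable {K A : Type*} [Field K] [CommRing A] [Algebra K A]

/-- The subspace `W` has maximal rank in every quotient ring `A ⧸ I`: it maps injectively or
surjectively. For the span of the linear forms in the coordinate ring of a finite subscheme of
projective space, this is linearly general position. -/
def InGeneralPosition (W : Submodule K A) : Prop :=
  ∀ I : Ideal A, W ⊓ I.restrictScalars K = ⊥ ∨ W ⊔ I.restrictScalars K = ⊤

variable [Module.Finite K A]

/-- The orthogonal space of a subspace in general position is in general position. In geometric
terms: Gale duality preserves linearly general position. -/
theorem InGeneralPosition.orthogonal {W : Submodule K A} (hW : InGeneralPosition W)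
    {lam : A →ₗ[K] K} (h : IsNondegenerate lam) :
    InGeneralPosition ((mulForm lam).orthogonal W) := by
  intro J
  have hn := h.mulForm
  have hr := mulForm_isRefl lam
  have hsup : ∀ U V : Submodule K A, (mulForm lam).orthogonal (U ⊔ V) =
      (mulForm lam).orthogonal U ⊓ (mulForm lam).orthogonal V := fun U V =>
    le_antisymm (le_inf (LinearMap.BilinForm.orthogonal_le le_sup_left)
      (LinearMap.BilinForm.orthogonal_le le_sup_right)) (by
        rintro a ⟨ha, hb⟩ w hw
        obtain ⟨u, hu, v, hv, rfl⟩ := Submodule.mem_sup.1 hw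
        have h1 : mulForm lam u a = 0 := ha u hu
        have h2 : mulForm lam v a = 0 := hb v hv
        change mulForm lam (u + v) a = 0
        rw [map_add, LinearMap.add_apply, h1, h2, add_zero])
  set I : Ideal A := Submodule.annihilator J
  have hI : (mulForm lam).orthogonal (I.restrictScalars K) = J.restrictScalars K := by
    rw [h.orthogonal_ideal, h.annihilator_annihilator]
  have hbot : (mulForm lam).orthogonal ⊤ = ⊥ := by
    have := LinearMap.BilinForm.finrank_orthogonal hn ⊤
    rw [finrank_top, Nat.sub_self] at this
    exact Submodule.finrank_eq_zero.1 this
  rcases hW I with h1 | h1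
  · right
    have h2 := LinearMap.BilinForm.orthogonal_orthogonal hn hr
      ((mulForm lam).orthogonal W ⊔ J.restrictScalars K)
    rw [hsup, LinearMap.BilinForm.orthogonal_orthogonal hn hr, ← hI,
      LinearMap.BilinForm.orthogonal_orthogonal hn hr, h1] at h2
    rw [hI] at h2
    rw [← h2, eq_top_iff]
    intro a _ w hw
    rw [(Submodule.mem_bot K).1 hw]
    change mulForm lam 0 a = 0
    simp
  · left
    rw [← hI, ← hsup, h1, hbot]

/-- If `W` is in general position then so is its orthogonal space `U`; an ideal `J` of dimension
`dim W + 1` meets `U` for dimension reasons, and a nonzero `x` in `U ∩ J` generates an ideal that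
meets `U`, hence is at least as large as `J`. -/
theorem InGeneralPosition.exists_eq_span_singleton {W : Submodule K A} (hW : InGeneralPosition W)
    {lam : A →ₗ[K] K} (h : IsNondegenerate lam) {J : Ideal A}
    (hJ : Module.finrank K (J.restrictScalars K) = Module.finrank K W + 1) :
    ∃ x, J = Ideal.span {x} := by
  have hU := hW.orthogonal h
  set U := (mulForm lam).orthogonal W with hUdef
  have hUd : Module.finrank K U + Module.finrank K W = Module.finrank K A := by
    rw [hUdef, LinearMap.BilinForm.finrank_orthogonal h.mulForm]
    exact Nat.sub_add_cancel (Submodule.finrank_le _)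
  have hpos : 0 < Module.finrank K (U ⊓ J.restrictScalars K : Submodule K A) := by
    have := Submodule.finrank_sup_add_finrank_inf_eq U (J.restrictScalars K)
    have h2 := Submodule.finrank_le (U ⊔ J.restrictScalars K)
    omega
  obtain ⟨x, hx, hx0⟩ := (Submodule.ne_bot_iff _).1
    (fun hb => hpos.ne' (Submodule.finrank_eq_zero.2 hb))
  have hxU : x ∈ U := hx.1
  have hxJ : x ∈ J := hx.2
  refine ⟨x, ?_⟩
  have hle : (Ideal.span {x}).restrictScalars K ≤ J.restrictScalars K := by
    intro a ha
    exact ((Ideal.span_singleton_le_iff_mem J).2 hxJ) ha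
  have hxs : x ∈ (Ideal.span {x}).restrictScalars K := Ideal.mem_span_singleton_self x
  have htop : U ⊔ (Ideal.span {x}).restrictScalars K = ⊤ := by
    refine (hU (Ideal.span {x})).resolve_left fun hb => hx0 ?_
    have : x ∈ U ⊓ (Ideal.span {x}).restrictScalars K := ⟨hxU, hxs⟩
    rwa [hb, Submodule.mem_bot] at this
  have hinf : 0 < Module.finrank K (U ⊓ (Ideal.span {x}).restrictScalars K : Submodule K A) := by
    rw [Nat.pos_iff_ne_zero]
    intro hz
    have : x ∈ U ⊓ (Ideal.span {x}).restrictScalars K := ⟨hxU, hxs⟩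
    rw [Submodule.finrank_eq_zero.1 hz, Submodule.mem_bot] at this
    exact hx0 this
  have hd := Submodule.finrank_sup_add_finrank_inf_eq U ((Ideal.span {x}).restrictScalars K)
  rw [htop, finrank_top] at hd
  have := Submodule.eq_of_le_of_finrank_le hle (by omega)
  exact (Submodule.restrictScalars_injective K A A this).symm

end GeneralPosition

/-! ### Ideals of prescribed dimension -/

section Interpolation

variable {K A : Type*} [Field K] [CommRing A] [Algebra K A] [Module.Finite K A]

theorem finrank_of_covBy
    (hres : ∀ m : Ideal A, m.IsMaximal → Function.Surjective (algebraMap K (A ⧸ m)))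
    {I J : Ideal A} (h : I ⋖ J) :
    Module.finrank K (J.restrictScalars K) = Module.finrank K (I.restrictScalars K) + 1 := by
  obtain ⟨m, hm, ⟨e⟩⟩ := isSimpleModule_iff_quot_maximal.1 ((covBy_iff_quot_is_simple h.le).1 h)
  have h1 : Module.finrank K (A ⧸ m) = 1 := by
    have hb : Function.Bijective (algebraMap K (A ⧸ m)) :=
      ⟨(algebraMap K (A ⧸ m)).injective, hres m hm⟩
    have := (LinearEquiv.ofBijective (Algebra.linearMap K (A ⧸ m)) hb).finrank_eq
    rw [← this, Module.finrank_self]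
  have h2 := (e.restrictScalars K).finrank_eq
  rw [h1] at h2
  have h3 := Submodule.finrank_quotient_add_finrank
    ((Submodule.comap J.subtype I).restrictScalars K)
  have h4 : Module.finrank K ((Submodule.comap J.subtype I).restrictScalars K) =
      Module.finrank K (I.restrictScalars K) :=
    ((Submodule.comapSubtypeEquivOfLe h.le).restrictScalars K).finrank_eq
  have h5 : Module.finrank K (J ⧸ (Submodule.comap J.subtype I).restrictScalars K) =
    Module.finrank K (J ⧸ (Submodule.comap J.subtype I)) := rfl
  rw [h4, h5, h2, add_comm] at h3
  exact h3.symm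

/-- If all residue fields equal `K`, a maximal chain of ideals rises in steps of dimension one. -/
theorem exists_ideal_between
    (hres : ∀ m : Ideal A, m.IsMaximal → Function.Surjective (algebraMap K (A ⧸ m)))
    {S M : Ideal A} (hSM : S ≤ M) {d : ℕ} (h1 : Module.finrank K (S.restrictScalars K) ≤ d)
    (h2 : d ≤ Module.finrank K (M.restrictScalars K)) :
    ∃ J : Ideal A, S ≤ J ∧ J ≤ M ∧ Module.finrank K (J.restrictScalars K) = d := by
  have : IsArtinianRing A := IsArtinianRing.of_finite K A
  induction d, h1 using Nat.le_induction with
  | base => exact ⟨S, le_rfl, hSM, rfl⟩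
  | succ d hd ih =>
    obtain ⟨J, hJ1, hJ2, hJ3⟩ := ih (Nat.le_of_succ_le h2)
    have hlt : J < M := lt_of_le_of_ne hJ2 (by rintro rfl; omega)
    obtain ⟨J', hc, hle⟩ := exists_covBy_le_of_lt hlt
    exact ⟨J', hJ1.trans hc.le, hle, by rw [finrank_of_covBy hres hc, hJ3]⟩

theorem surjective_algebraMap_quotient [IsAlgClosed K] (m : Ideal A) (hm : m.IsMaximal) :
    Function.Surjective (algebraMap K (A ⧸ m)) :=
  IsAlgClosed.algebraMap_bijective_of_isIntegral.2

end Interpolation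

/-! ### Principal ideals force small embedding dimension -/

section Curvilinear

/-- Over an algebraically closed field, two linear maps `X`, `Y` with `X` injective and
`range Y ≤ range X` have a member `Y - c X` of their pencil that is not injective. -/
theorem exists_pencil_eigenvector {K Q R : Type*} [Field K] [IsAlgClosed K] [AddCommGroup Q]
    [Module K Q] [Module.Finite K Q] [Nontrivial Q] [AddCommGroup R] [Module K R]
    {X Y : Q →ₗ[K] R} (hX : Function.Injective X) (hYX : LinearMap.range Y ≤ LinearMap.range X) :
    ∃ (q : Q) (c : K), q ≠ 0 ∧ Y q = c • X q := by
  let e := LinearEquiv.ofInjective X hX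
  let f : Module.End K Q :=
    e.symm.toLinearMap ∘ₗ Y.codRestrict (LinearMap.range X) fun q => hYX ⟨q, rfl⟩
  obtain ⟨c, hc⟩ := Module.End.exists_eigenvalue f
  obtain ⟨q, hq⟩ := hc.exists_hasEigenvector
  refine ⟨q, c, hq.2, ?_⟩
  have h1 : e (f q) = c • e q := by rw [hq.apply_eq_smul, map_smul]
  have h2 : e (f q) = ⟨Y q, hYX ⟨q, rfl⟩⟩ := e.apply_symm_apply _
  rw [h2] at h1
  exact congrArg Subtype.val h1

variable {K A : Type*} [Field K] [CommRing A] [Algebra K A]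

theorem mem_sq_of_mul_mem {m : Ideal A} [hm : m.IsMaximal] {z w : A} (hw : w ∉ m)
    (h : z * w ∈ m ^ 2) : z ∈ m ^ 2 := by
  obtain ⟨v, c, hc, hv⟩ := hm.exists_inv hw
  have hz : z ∈ m :=
    (hm.isPrime.mem_or_mem (Ideal.pow_le_self two_ne_zero h)).resolve_right hw
  have : z = v * (z * w) + z * c := by linear_combination -z * hv
  rw [this]
  exact add_mem (Ideal.mul_mem_left _ _ h) (by rw [pow_two]; exact Ideal.mul_mem_mul hz hc)

/-- The form in which `dim m / m² ≤ 1` is established. -/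
theorem exists_le_span_sup_sq {m : Ideal A}
    (h : ∀ a ∈ m, ∀ b ∈ m, ∃ α β : K, (α ≠ 0 ∨ β ≠ 0) ∧ α • a + β • b ∈ m ^ 2) :
    ∃ t ∈ m, m ≤ Ideal.span {t} ⊔ m ^ 2 := by
  by_cases hm : m ≤ m ^ 2
  · exact ⟨0, zero_mem _, hm.trans le_sup_right⟩
  obtain ⟨t, ht, ht2⟩ := Set.not_subset.1 hm
  refine ⟨t, ht, fun b hb => ?_⟩
  obtain ⟨α, β, hne, hab⟩ := h b hb t ht
  have hα : α ≠ 0 := by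
    rintro rfl
    rw [zero_smul, zero_add] at hab
    refine ht2 ?_
    have := Submodule.smul_of_tower_mem (m ^ 2) β⁻¹ hab
    rwa [smul_smul, inv_mul_cancel₀ (hne.resolve_left (by simp)), one_smul] at this
  have h1 := Submodule.smul_of_tower_mem (m ^ 2) α⁻¹ hab
  rw [smul_add, smul_smul, inv_mul_cancel₀ hα, one_smul] at h1
  have h2 : b = (-α⁻¹ * β) • t + (b + α⁻¹ • β • t) := by
    rw [smul_smul, neg_mul, neg_smul]; abel
  rw [h2]
  exact Submodule.add_mem_sup
    (Submodule.smul_of_tower_mem _ _ (Ideal.mem_span_singleton_self t)) h1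

theorem exists_sub_mem (m : Ideal A) (hm : Function.Surjective (algebraMap K (A ⧸ m))) (a : A) :
    ∃ c : K, a - algebraMap K A c ∈ m := by
  obtain ⟨c, hc⟩ := hm (Ideal.Quotient.mk m a)
  exact ⟨c, Ideal.Quotient.eq.1 hc.symm⟩

variable [Module.Finite K A]

/-- Suppose that `A` is Gorenstein and that every ideal of dimension `N` is principal, where
`3 ≤ N < dim A`. Then `dim m / m² ≤ 1` for every maximal ideal `m`.

The proof picks an ideal `J = (x)` of dimension `N` between `Ann (m²)` and `m`, so that
`Ann x ≤ m²`, and `y ∉ J` with `m y ≤ J`. If `m y` is not contained in `m x`, then the pairing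
`m → J / m x`, `a ↦ a y` has kernel in `m²`. Otherwise multiplication by each member of the pencil
`y - c x` maps `m / m²` onto `m x / m² x`, because `K (y - c x) + m x` is also principal, while an
eigenvector shows that it is not injective for some `c`. -/
theorem exists_le_span_sup_sq_of_principal [IsAlgClosed K] {lam : A →ₗ[K] K}
    (h : IsNondegenerate lam) {N : ℕ} (hN3 : 3 ≤ N) (hNA : N < Module.finrank K A)
    (hP : ∀ J : Ideal A, Module.finrank K (J.restrictScalars K) = N → ∃ x, J = Ideal.span {x})
    (m : Ideal A) [hm : m.IsMaximal] : ∃ t ∈ m, m ≤ Ideal.span {t} ⊔ m ^ 2 := by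
  have hres := surjective_algebraMap_quotient (K := K) (A := A)
  have hnoeth : IsNoetherianRing A := IsNoetherianRing.of_finite K A
  -- Every element is a scalar modulo `m`, so `span {x} = K x + m x`.
  have hspan : ∀ x b : A, b ∈ Ideal.span {x} → ∃ (c : K) (e : A), e ∈ m ∧ b = c • x + e * x := by
    intro x b hb
    obtain ⟨a, rfl⟩ := Ideal.mem_span_singleton'.1 hb
    obtain ⟨c, hc⟩ := exists_sub_mem m (hres m hm) a
    exact ⟨c, _, hc, by rw [Algebra.smul_def]; ring⟩
  have hmdim : Module.finrank K (m.restrictScalars K) + 1 = Module.finrank K A := by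
    have := finrank_of_covBy hres (Ideal.isMaximal_def.1 hm).covBy_top
    rw [← this]
    exact finrank_top K A
  have hann1 : Module.finrank K (Submodule.restrictScalars K (Submodule.annihilator m : Ideal A))
      = 1 := by
    have := h.finrank_annihilator m
    omega
  -- Two elements of the one-dimensional space `Ann m` are dependent.
  have hdep : ∀ u v : A, u ∈ (Submodule.annihilator m : Ideal A) →
      v ∈ (Submodule.annihilator m : Ideal A) →
      ∃ α β : K, (α ≠ 0 ∨ β ≠ 0) ∧ α • u + β • v = 0 := by
    intro u v hu hv
    by_cases hu0 : u = 0
    · exact ⟨1, 0, Or.inl one_ne_zero, by simp [hu0]⟩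
    obtain ⟨c, hc⟩ := (finrank_eq_one_iff_of_nonzero'
      (⟨u, hu⟩ : Submodule.restrictScalars K (Submodule.annihilator m : Ideal A))
      (fun h0 => hu0 (congrArg Subtype.val h0))).1 hann1 ⟨v, hv⟩
    have hc' : c • u = v := congrArg Subtype.val hc
    exact ⟨c, -1, Or.inr (by simp), by rw [hc']; simp⟩
  set S : Ideal A := Submodule.annihilator (m ^ 2)
  have hSmul : ∀ s ∈ S, ∀ b ∈ m, b * s ∈ (Submodule.annihilator m : Ideal A) := by
    intro s hs b hb
    rw [Submodule.mem_annihilator] at hs ⊢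
    intro n hn
    have := hs (b * n) (by rw [pow_two]; exact Ideal.mul_mem_mul hb hn)
    simp only [smul_eq_mul] at this ⊢
    linear_combination this
  by_cases hSm : S ≤ m
  swap
  · obtain ⟨s, hs, hsm⟩ := Set.not_subset.1 hSm
    refine exists_le_span_sup_sq (K := K) fun a ha b hb => ?_
    obtain ⟨α, β, hne, hab⟩ := hdep _ _ (hSmul s hs a ha) (hSmul s hs b hb)
    refine ⟨α, β, hne, mem_sq_of_mul_mem hsm ?_⟩
    rw [add_mul, smul_mul_assoc, smul_mul_assoc, hab]
    exact zero_mem _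
  have hSN : Module.finrank K (S.restrictScalars K) ≤ N := by
    by_contra! hlt
    obtain ⟨J, -, hJS, hJN⟩ := exists_ideal_between hres (bot_le : ⊥ ≤ S) (d := N)
      (by rw [Submodule.restrictScalars_bot, finrank_bot]; exact Nat.zero_le _) hlt.le
    obtain ⟨x, rfl⟩ := hP J hJN
    have hle : (Ideal.span {x}).restrictScalars K ≤ Submodule.span K {x} ⊔
        Submodule.restrictScalars K (Submodule.annihilator m : Ideal A) := by
      intro b hb
      obtain ⟨c, e, he, rfl⟩ := hspan x b hb
      exact Submodule.add_mem_sup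
        (Submodule.smul_mem _ _ (Submodule.mem_span_singleton_self x))
        (hSmul x (hJS (Ideal.mem_span_singleton_self x)) e he)
    have h1 := Submodule.finrank_mono hle
    have h2 := Submodule.finrank_add_le_finrank_add_finrank (Submodule.span K {x})
      (Submodule.restrictScalars K (Submodule.annihilator m : Ideal A))
    have h3 := finrank_span_le_card (R := K) ({x} : Set A)
    simp only [Set.toFinset_singleton, Finset.card_singleton] at h3
    omega
  obtain ⟨J, hSJ, hJm, hJN⟩ := exists_ideal_between hres hSm hSN (by omega)
  obtain ⟨x, hJx⟩ := hP J hJN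
  have hxJ : x ∈ J := hJx ▸ Ideal.mem_span_singleton_self x
  have hannx : ∀ a, a * x = 0 → a ∈ m ^ 2 := by
    intro a ha
    rw [← h.annihilator_annihilator (m ^ 2), Submodule.mem_annihilator]
    intro s hs
    obtain ⟨b, rfl⟩ := Ideal.mem_span_singleton'.1 (hJx ▸ hSJ hs)
    rw [smul_eq_mul]
    linear_combination b * ha
  have hxmx : ∀ c ∈ m, x ≠ c * x := by
    intro c hc hx
    have : (1 - c) ∈ m := Ideal.pow_le_self two_ne_zero (hannx _ (by linear_combination hx))
    exact hm.ne_top ((Ideal.eq_top_iff_one m).2 (by simpa using add_mem this hc))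
  -- `y` is an element outside `J` with `m y ≤ J`; by duality, it exists since `m Ann J ≠ Ann J`.
  obtain ⟨y, hyJ, hmy⟩ : ∃ y, y ∉ J ∧ ∀ a ∈ m, a * y ∈ J := by
    set I : Ideal A := Submodule.annihilator J
    have hnle : ¬ (Submodule.annihilator (m * I) : Ideal A) ≤ J := by
      intro hle
      have h1 : I ≤ m • I := by
        have := Submodule.annihilator_mono hle
        rwa [h.annihilator_annihilator] at this
      obtain ⟨r, hr, hrI⟩ := Submodule.exists_sub_one_mem_and_smul_eq_zero_of_fg_of_le_smul m I
        (IsNoetherian.noetherian I) h1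
      have h2 : r ∈ J := by
        rw [← h.annihilator_annihilator J]
        exact Submodule.mem_annihilator.2 hrI
      exact hm.ne_top ((Ideal.eq_top_iff_one m).2 (by simpa using sub_mem (hJm h2) hr))
    obtain ⟨y, hy, hyJ⟩ := Set.not_subset.1 hnle
    refine ⟨y, hyJ, fun a ha => ?_⟩
    rw [← h.annihilator_annihilator J, Submodule.mem_annihilator]
    intro n hn
    have := Submodule.mem_annihilator.1 hy (a * n) (Ideal.mul_mem_mul ha hn)
    simp only [smul_eq_mul] at this ⊢
    linear_combination this
  by_cases hcase : ∃ a ∈ m, ∀ c ∈ m, a * y ≠ c * x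
  · -- The map `m → J / m x`, `b ↦ b y` has kernel contained in `m²`.
    obtain ⟨a, ha, hay⟩ := hcase
    obtain ⟨α₀, e₀, he₀, hay₀⟩ := hspan x (a * y) (hJx ▸ hmy a ha)
    have hα₀ : α₀ ≠ 0 := by
      rintro rfl
      exact hay e₀ he₀ (by rw [hay₀, zero_smul, zero_add])
    have hker : ∀ d ∈ m, (∃ c ∈ m, d * y = c * x) → d ∈ m ^ 2 := by
      rintro d - ⟨c, hc, hdc⟩
      set w : A := algebraMap K A α₀ + e₀
      have hw : w ∉ m := by
        intro hw
        have h1 : algebraMap K A α₀ ∈ m := by simpa [w] using sub_mem hw he₀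
        have h2 := (IsUnit.mk0 α₀ hα₀).map (algebraMap K A)
        exact hm.ne_top (Ideal.eq_top_of_isUnit_mem _ h1 h2)
      have hayw : a * y = w * x := by rw [hay₀, Algebra.smul_def]; ring
      have h0 : (w * d - c * a) * y = 0 := by linear_combination w * hdc - c * hayw
      have h1 : (w * d - c * a) * w ∈ m ^ 2 := by
        apply hannx
        linear_combination a * h0 - (w * d - c * a) * hayw
      have h2 := mem_sq_of_mul_mem hw h1
      have h3 : d * w ∈ m ^ 2 := by
        have : d * w = (w * d - c * a) + c * a := by ring
        rw [this]
        exact add_mem h2 (by rw [pow_two]; exact Ideal.mul_mem_mul hc ha)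
      exact mem_sq_of_mul_mem hw h3
    refine exists_le_span_sup_sq (K := K) fun b hb b' hb' => ?_
    obtain ⟨β, e, he, hbe⟩ := hspan x (b * y) (hJx ▸ hmy b hb)
    obtain ⟨β', e', he', hbe'⟩ := hspan x (b' * y) (hJx ▸ hmy b' hb')
    by_cases hβ : β = 0
    · refine ⟨1, 0, Or.inl one_ne_zero, ?_⟩
      rw [one_smul, zero_smul, add_zero]
      exact hker b hb ⟨e, he, by rw [hbe, hβ, zero_smul, zero_add]⟩
    · refine ⟨β', -β, Or.inr (neg_ne_zero.2 hβ), hker _ ?_ ⟨β' • e + (-β) • e', ?_, ?_⟩⟩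
      · exact add_mem (Submodule.smul_of_tower_mem _ _ hb) (Submodule.smul_of_tower_mem _ _ hb')
      · exact add_mem (Submodule.smul_of_tower_mem _ _ he) (Submodule.smul_of_tower_mem _ _ he')
      · rw [add_mul, smul_mul_assoc, smul_mul_assoc, hbe, hbe']
        simp only [Algebra.smul_def, map_neg]
        ring
  · push Not at hcase
    by_cases hm2 : m ≤ m ^ 2
    · exact ⟨0, zero_mem _, hm2.trans le_sup_right⟩
    exfalso
    let P : Submodule K A := m.restrictScalars K
    let P2 : Submodule K P := ((m ^ 2).restrictScalars K).comap P.subtype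
    let R2 : Submodule K A := (m ^ 2 * Ideal.span {x}).restrictScalars K
    have hR2 : ∀ a, a ∈ R2 ↔ ∃ z ∈ m ^ 2, z * x = a := fun a => Ideal.mem_mul_span_singleton
    -- Multiplication by `z`, as a map `m / m² → A / m² x`.
    have hwd : ∀ z : A, (∀ a ∈ m, ∃ c ∈ m, a * z = c * x) →
        P2 ≤ LinearMap.ker (R2.mkQ ∘ₗ (LinearMap.mulRight K z) ∘ₗ P.subtype) := by
      intro z hz a ha
      have ha' : (a : A) ∈ m ^ 2 := ha
      rw [LinearMap.mem_ker, LinearMap.comp_apply, Submodule.mkQ_apply,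
        Submodule.Quotient.mk_eq_zero, hR2]
      change ∃ w ∈ m ^ 2, w * x = (a : A) * z
      rw [pow_two] at ha'
      refine Submodule.mul_induction_on ha' ?_ ?_
      · intro b hb b' hb'
        obtain ⟨c, hc, hbc⟩ := hz b' hb'
        exact ⟨b * c, by rw [pow_two]; exact Ideal.mul_mem_mul hb hc,
          by rw [mul_assoc, ← hbc, mul_assoc]⟩
      · rintro b b' ⟨w, hw, hwb⟩ ⟨w', hw', hwb'⟩
        exact ⟨w + w', add_mem hw hw', by rw [add_mul, add_mul, hwb, hwb']⟩
    have hx' : ∀ a ∈ m, ∃ c ∈ m, a * x = c * x := fun a ha => ⟨a, ha, rfl⟩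
    let X := P2.liftQ _ (hwd x hx')
    let Y := P2.liftQ _ (hwd y hcase)
    have hXinj : Function.Injective X := by
      rw [← LinearMap.ker_eq_bot, Submodule.ker_liftQ_eq_bot]
      intro a ha
      rw [LinearMap.mem_ker, LinearMap.comp_apply, Submodule.mkQ_apply,
        Submodule.Quotient.mk_eq_zero, hR2] at ha
      obtain ⟨w, hw, hwa⟩ := ha
      change w * x = (a : A) * x at hwa
      have := add_mem (hannx ((a : A) - w) (by rw [sub_mul, hwa, sub_self])) hw
      rw [sub_add_cancel] at this
      exact this
    have hYX : LinearMap.range Y ≤ LinearMap.range X := by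
      rintro _ ⟨q, rfl⟩
      obtain ⟨a, rfl⟩ := P2.mkQ_surjective q
      obtain ⟨c, hc, hac⟩ := hcase a a.2
      refine ⟨P2.mkQ ⟨c, hc⟩, ?_⟩
      change R2.mkQ (c * x) = R2.mkQ ((a : A) * y)
      rw [hac]
    have hnt : Nontrivial (P ⧸ P2) := by
      obtain ⟨t, ht, ht2⟩ := Set.not_subset.1 hm2
      refine ⟨P2.mkQ ⟨t, ht⟩, 0, fun h0 => ht2 ?_⟩
      rw [Submodule.mkQ_apply, Submodule.Quotient.mk_eq_zero] at h0
      exact h0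
    obtain ⟨q, c, hq0, hqc⟩ := exists_pencil_eigenvector hXinj hYX
    set z : A := y - c • x with hz
    have hzm : ∀ a ∈ m, ∃ c ∈ m, a * z = c * x := by
      intro a ha
      obtain ⟨e, he, hae⟩ := hcase a ha
      exact ⟨e - c • a, sub_mem he (Submodule.smul_of_tower_mem _ _ ha), by
        rw [hz, mul_sub, hae, sub_mul, mul_smul_comm, smul_mul_assoc]⟩
    let Z := P2.liftQ _ (hwd z hzm)
    have hZq : Z q = 0 := by
      obtain ⟨a, rfl⟩ := P2.mkQ_surjective q
      have h1 : Z (P2.mkQ a) = Y (P2.mkQ a) - c • X (P2.mkQ a) := by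
        change R2.mkQ ((a : A) * z) = R2.mkQ ((a : A) * y) - c • R2.mkQ ((a : A) * x)
        rw [← map_smul, ← map_sub, hz, mul_sub, mul_smul_comm]
      rw [h1, hqc, sub_self]
    -- The ideal `H = K z + m x` has dimension `N`, hence is principal.
    let H : Ideal A := Ideal.span {z} ⊔ m * Ideal.span {x}
    have hmx : ∀ a, a ∈ m * Ideal.span {x} ↔ ∃ e ∈ m, e * x = a :=
      fun a => Ideal.mem_mul_span_singleton
    have hzJ : z ∉ J := fun hzJ => hyJ (by
      have : y = z + c • x := by rw [hz]; abel
      rw [this]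
      exact add_mem hzJ (Submodule.smul_of_tower_mem _ _ hxJ))
    have hmxJ : m * Ideal.span {x} ≤ J := by
      rw [hJx]
      exact Ideal.mul_le_right
    have hdim : ∀ (L : Ideal A) (w : A), w ∉ L → (∀ a ∈ m, a * w ∈ L) →
        Module.finrank K ((Ideal.span {w} ⊔ L : Ideal A).restrictScalars K) =
          Module.finrank K (L.restrictScalars K) + 1 := by
      intro L w hwL hmw
      refine finrank_of_covBy hres ?_
      refine ⟨lt_of_le_of_ne le_sup_right fun heq => hwL (heq ▸
        Ideal.mem_sup_left (Ideal.mem_span_singleton_self w)), fun L' hL hL' => ?_⟩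
      obtain ⟨v, hv, hvL⟩ := Set.not_subset.1 hL.not_ge
      obtain ⟨v', hv', v'', hv'', rfl⟩ := Submodule.mem_sup.1 (hL'.le hv)
      obtain ⟨γ, e, he, rfl⟩ := hspan w v' hv'
      have hγ : γ ≠ 0 := by
        rintro rfl
        rw [zero_smul, zero_add] at hvL
        exact hvL (add_mem (hmw e he) hv'')
      have h1 : γ • w ∈ L' := by
        have : γ • w = (γ • w + e * w + v'') - (e * w + v'') := by abel
        rw [this]
        exact sub_mem hv (hL.le (add_mem (hmw e he) hv''))
      have h2 := Submodule.smul_of_tower_mem L' γ⁻¹ h1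
      rw [smul_smul, inv_mul_cancel₀ hγ, one_smul] at h2
      exact hL'.not_ge (sup_le ((Ideal.span_singleton_le_iff_mem _).2 h2) hL.le)
    have hJdim := hdim (m * Ideal.span {x}) x
      (fun hx => by
        obtain ⟨e, he, hex⟩ := (hmx x).1 hx
        exact hxmx e he hex.symm)
      (fun a ha => (hmx _).2 ⟨a, ha, rfl⟩)
    rw [sup_eq_left.2 Ideal.mul_le_right] at hJdim
    replace hJdim : N = Module.finrank K ((m * Ideal.span {x}).restrictScalars K) + 1 := by
      rw [← hJN, ← hJdim, ← hJx]
    have hHdim : Module.finrank K (H.restrictScalars K) = N := by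
      rw [hJdim]
      refine hdim _ z (fun hz => hzJ (hmxJ hz)) fun a ha => ?_
      obtain ⟨e, he, hae⟩ := hzm a ha
      exact (hmx _).2 ⟨e, he, hae.symm⟩
    obtain ⟨w, hHw⟩ := hP H hHdim
    have hwH : w ∈ H := hHw ▸ Ideal.mem_span_singleton_self w
    obtain ⟨w', hw', w'', hw'', hww⟩ := Submodule.mem_sup.1 hwH
    obtain ⟨γ, e, he, rfl⟩ := hspan z w' hw'
    obtain ⟨b, hb, rfl⟩ := (hmx _).1 hw''
    -- Comparing dimensions, `m w = m x`.
    have hmw : m * Ideal.span {w} = m * Ideal.span {x} := by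
      have hle : m * Ideal.span {w} ≤ m * Ideal.span {x} := by
        rw [Ideal.mul_le]
        intro a ha v hv
        obtain ⟨v', rfl⟩ := Ideal.mem_span_singleton'.1 hv
        obtain ⟨c', hc', hac'⟩ := hzm a ha
        refine (hmx _).2 ⟨v' * (γ • c' + e * c' + a * b), Ideal.mul_mem_left _ _ (add_mem (add_mem
          (Submodule.smul_of_tower_mem _ _ hc') (Ideal.mul_mem_left _ _ hc'))
          (Ideal.mul_mem_left _ _ hb)), ?_⟩
        rw [← hww]
        simp only [Algebra.smul_def]
        linear_combination (-v' * (algebraMap K A γ + e)) * hac'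
      apply Submodule.restrictScalars_injective K
      apply Submodule.eq_of_le_of_finrank_le ((Submodule.restrictScalars_le (S := K)).2 hle)
      have hle2 : (Ideal.span {w}).restrictScalars K ≤
          Submodule.span K {w} ⊔ (m * Ideal.span {w}).restrictScalars K := by
        intro v hv
        obtain ⟨c', e', he', rfl⟩ := hspan w v hv
        exact Submodule.add_mem_sup
          (Submodule.smul_mem _ _ (Submodule.mem_span_singleton_self w))
          (Ideal.mem_mul_span_singleton.2 ⟨e', he', rfl⟩)
      have h1 := Submodule.finrank_mono hle2
      have h2 := Submodule.finrank_add_le_finrank_add_finrank (Submodule.span K {w})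
        ((m * Ideal.span {w}).restrictScalars K)
      have h3 := finrank_span_le_card (R := K) ({w} : Set A)
      simp only [Set.toFinset_singleton, Finset.card_singleton] at h3
      have h4 : Module.finrank K ((Ideal.span {w}).restrictScalars K) = N := by
        rw [← hHw, hHdim]
      omega
    have hXZ : LinearMap.range X ≤ LinearMap.range Z := by
      rintro _ ⟨q', rfl⟩
      obtain ⟨d, rfl⟩ := P2.mkQ_surjective q'
      have hd : (d : A) * x ∈ m * Ideal.span {w} := hmw ▸ (hmx _).2 ⟨d, d.2, rfl⟩
      obtain ⟨v, hv, hvd⟩ := Ideal.mem_mul_span_singleton.1 hd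
      refine ⟨γ • P2.mkQ ⟨v, hv⟩, ?_⟩
      rw [map_smul]
      change γ • R2.mkQ (v * z) = R2.mkQ ((d : A) * x)
      rw [← map_smul, ← sub_eq_zero, ← map_sub, Submodule.mkQ_apply,
        Submodule.Quotient.mk_eq_zero, hR2]
      obtain ⟨c', hc', hvc'⟩ := hzm v hv
      refine ⟨-(e * c' + v * b), neg_mem (add_mem ?_ ?_), ?_⟩
      · rw [pow_two]; exact Ideal.mul_mem_mul he hc'
      · rw [pow_two]; exact Ideal.mul_mem_mul hv hb
      · rw [← hvd, ← hww]
        simp only [Algebra.smul_def]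
        linear_combination e * hvc'
    have h1 := Submodule.finrank_mono hXZ
    rw [LinearMap.finrank_range_of_inj hXinj] at h1
    have h2 := LinearMap.finrank_range_add_finrank_ker Z
    have h3 : Module.finrank K (LinearMap.ker Z) = 0 := by omega
    rw [Submodule.finrank_eq_zero] at h3
    have : q ∈ LinearMap.ker Z := hZq
    rw [h3, Submodule.mem_bot] at this
    exact hq0 this

end Curvilinear

/-! ### Binary forms on a two-dimensional space in general position -/

section BinaryForms

variable {K A : Type*} [Field K] [CommRing A] [Algebra K A]

section

variable {s t : A}

theorem aeval_homogenize_succ (p : Polynomial K) {d : ℕ} (hp : p.natDegree ≤ d) :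
    MvPolynomial.aeval ![s, t] (p.homogenize (d + 1)) =
      t * MvPolynomial.aeval ![s, t] (p.homogenize d) := by
  have := Polynomial.homogenize_mul p 1 hp (n := 1) (by simp)
  rw [mul_one] at this
  rw [this, map_mul, Polynomial.homogenize_one]
  simp [mul_comm]

theorem aeval_homogenize_linear_mul (α : K) (p : Polynomial K) {d : ℕ} (hp : p.natDegree ≤ d) :
    MvPolynomial.aeval ![s, t] (((Polynomial.X - Polynomial.C α) * p).homogenize (d + 1)) =
      (s - α • t) * MvPolynomial.aeval ![s, t] (p.homogenize d) := by
  have := Polynomial.homogenize_mul (Polynomial.X - Polynomial.C α) p (m := 1)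
    (by rw [Polynomial.natDegree_X_sub_C]) hp
  rw [add_comm 1 d] at this
  rw [this, map_mul, Polynomial.homogenize_sub, Polynomial.homogenize_C,
    Polynomial.homogenize_X one_ne_zero]
  simp [Algebra.smul_def]

theorem natDegree_aeval_X_one_le {q : MvPolynomial (Fin 2) K} {d : ℕ} (hq : q.IsHomogeneous d) :
    (MvPolynomial.aeval ![Polynomial.X, 1] q : Polynomial K).natDegree ≤ d := by
  rw [q.as_sum, map_sum]
  refine Polynomial.natDegree_sum_le_of_forall_le _ _ fun m hm => ?_
  have hmd : m.degree = d := by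
    have := hq (MvPolynomial.mem_support_iff.1 hm)
    rw [← this, Finsupp.degree_eq_weight_one]
    rfl
  have h0 : m 0 ≤ d := hmd ▸ Finsupp.le_degree 0 m
  rw [MvPolynomial.aeval_monomial, Finsupp.prod_fintype _ _ (fun i => pow_zero _),
    Fin.prod_univ_two, ← Polynomial.C_eq_algebraMap]
  simp only [Matrix.cons_val_zero, Matrix.cons_val_one, one_pow, mul_one]
  exact (Polynomial.natDegree_C_mul_X_pow_le _ _).trans h0

end

variable [Module.Finite K A]

theorem finrank_ker_comp_le (f g : A →ₗ[K] A) :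
    Module.finrank K (LinearMap.ker (f ∘ₗ g)) ≤
      Module.finrank K (LinearMap.ker f) + Module.finrank K (LinearMap.ker g) := by
  let h : LinearMap.ker (f ∘ₗ g) →ₗ[K] LinearMap.ker f :=
    (g ∘ₗ (LinearMap.ker (f ∘ₗ g)).subtype).codRestrict _ fun x => x.2
  have h1 := LinearMap.finrank_range_add_finrank_ker h
  have h2 := Submodule.finrank_le (LinearMap.range h)
  have h3 : Module.finrank K (LinearMap.ker h) ≤ Module.finrank K (LinearMap.ker g) := by
    let i : LinearMap.ker h →ₗ[K] LinearMap.ker g :=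
      ((LinearMap.ker (f ∘ₗ g)).subtype ∘ₗ (LinearMap.ker h).subtype).codRestrict _ fun x => by
        have := x.2
        rw [LinearMap.mem_ker] at this ⊢
        exact congrArg Subtype.val this
    refine LinearMap.finrank_le_finrank_of_injective (f := i) fun x y hxy => ?_
    have : ((x : LinearMap.ker (f ∘ₗ g)) : A) = (y : LinearMap.ker (f ∘ₗ g)) :=
      congrArg (fun z : LinearMap.ker g => (z : A)) hxy
    exact Subtype.ext (Subtype.ext this)
  omega

/-- A nonzero element of a two-dimensional subspace in general position generates an ideal of
codimension at most one. -/
theorem InGeneralPosition.finrank_ker_mulLeft_le {U : Submodule K A} (hU : InGeneralPosition U)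
    (h2 : Module.finrank K U = 2) {w : A} (hw : w ∈ U) (hw0 : w ≠ 0) :
    Module.finrank K (LinearMap.ker (LinearMap.mulLeft K w)) ≤ 1 := by
  have hws : w ∈ (Ideal.span {w}).restrictScalars K := Ideal.mem_span_singleton_self w
  have hinf : U ⊓ (Ideal.span {w}).restrictScalars K ≠ ⊥ := fun hb => hw0 <| by
    have : w ∈ U ⊓ (Ideal.span {w}).restrictScalars K := ⟨hw, hws⟩
    rwa [hb, Submodule.mem_bot] at this
  have htop := (hU (Ideal.span {w})).resolve_left hinf
  have hd := Submodule.finrank_sup_add_finrank_inf_eq U ((Ideal.span {w}).restrictScalars K)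
  rw [htop, finrank_top] at hd
  have h1 : 0 < Module.finrank K (U ⊓ (Ideal.span {w}).restrictScalars K : Submodule K A) :=
    Nat.pos_of_ne_zero fun h0 => hinf (Submodule.finrank_eq_zero.1 h0)
  have h3 := LinearMap.finrank_range_add_finrank_ker (LinearMap.mulLeft K w)
  have h4 : LinearMap.range (LinearMap.mulLeft K w) = (Ideal.span {w}).restrictScalars K := by
    ext a
    rw [LinearMap.mem_range, Submodule.restrictScalars_mem, Ideal.mem_span_singleton']
    exact exists_congr fun b => by rw [LinearMap.mulLeft_apply, mul_comm]
  rw [h4] at h3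
  omega

variable {U : Submodule K A} {s t : A}

theorem finrank_ker_mulLeft_aeval_homogenize_le [IsAlgClosed K] (hU : InGeneralPosition U)
    (h2 : Module.finrank K U = 2) (hs : s ∈ U) (ht : t ∈ U)
    (hst : LinearIndependent K ![s, t]) (d : ℕ) (p : Polynomial K) (hp0 : p ≠ 0)
    (hp : p.natDegree ≤ d) :
    Module.finrank K (LinearMap.ker
      (LinearMap.mulLeft K (MvPolynomial.aeval ![s, t] (p.homogenize d)))) ≤ d := by
  rw [LinearIndependent.pair_iff] at hst
  have hcomp : ∀ (w f : A) (e : ℕ), w ∈ U → w ≠ 0 →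
      Module.finrank K (LinearMap.ker (LinearMap.mulLeft K f)) ≤ e →
      Module.finrank K (LinearMap.ker (LinearMap.mulLeft K (w * f))) ≤ e + 1 := by
    intro w f e hw hw0 hf
    rw [LinearMap.mulLeft_mul]
    have h1 := finrank_ker_comp_le (LinearMap.mulLeft K w) (LinearMap.mulLeft K f)
    have h2 := hU.finrank_ker_mulLeft_le h2 hw hw0
    omega
  induction d generalizing p with
  | zero =>
    rw [Polynomial.eq_C_of_natDegree_le_zero hp] at hp0 ⊢
    rw [Polynomial.homogenize_C, pow_zero, mul_one, MvPolynomial.algHom_C, Nat.le_zero,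
      Submodule.finrank_eq_zero, LinearMap.ker_eq_bot]
    exact ((IsUnit.mk0 _ (by simpa using hp0)).map (algebraMap K A)).mul_right_injective
  | succ d ih =>
    rcases Nat.lt_or_ge p.natDegree (d + 1) with hlt | hge
    · rw [aeval_homogenize_succ p (Nat.le_of_lt_succ hlt)]
      refine hcomp _ _ _ ht (fun h0 => ?_) (ih p hp0 (Nat.le_of_lt_succ hlt))
      have := (hst 0 1 (by simp [h0])).2
      exact one_ne_zero this
    · obtain ⟨α, hα⟩ := IsAlgClosed.exists_root p
        (fun h => by rw [Polynomial.degree_eq_natDegree hp0] at h; norm_cast at h; omega)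
      obtain ⟨q, rfl⟩ := Polynomial.dvd_iff_isRoot.2 hα
      have hq0 : q ≠ 0 := right_ne_zero_of_mul hp0
      have hqd : q.natDegree ≤ d := by
        rw [Polynomial.natDegree_mul (Polynomial.X_sub_C_ne_zero α) hq0,
          Polynomial.natDegree_X_sub_C] at hp
        omega
      rw [aeval_homogenize_linear_mul α q hqd]
      refine hcomp _ _ _ (sub_mem hs (U.smul_mem _ ht)) (fun h0 => ?_) (ih q hq0 hqd)
      have := (hst 1 (-α) (by rw [one_smul, neg_smul, ← sub_eq_add_neg, h0])).1
      exact one_ne_zero this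

/-- Over an algebraically closed field, a binary form is a product of linear forms, each of which
lowers the dimension by at most one; so a nonzero form of degree `d < dim A` does not vanish. -/
theorem aeval_ne_zero_of_isHomogeneous [IsAlgClosed K] (hU : InGeneralPosition U)
    (h2 : Module.finrank K U = 2) (hs : s ∈ U) (ht : t ∈ U)
    (hst : LinearIndependent K ![s, t]) {d : ℕ} (hd : d < Module.finrank K A)
    {q : MvPolynomial (Fin 2) K} (hq : q.IsHomogeneous d) (hq0 : q ≠ 0) :
    MvPolynomial.aeval ![s, t] q ≠ 0 := by
  intro h0
  have hpq := Polynomial.homogenize_eq_of_isHomogeneous hq rfl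
  have hp0 : (MvPolynomial.aeval ![Polynomial.X, 1] q : Polynomial K) ≠ 0 := fun h =>
    hq0 (by rw [← hpq, h, Polynomial.homogenize_zero])
  have := finrank_ker_mulLeft_aeval_homogenize_le hU h2 hs ht hst d _ hp0
    (natDegree_aeval_X_one_le hq)
  rw [hpq, h0, LinearMap.mulLeft_zero_eq_zero, LinearMap.ker_zero, finrank_top] at this
  omega

/-- The forms of degree `d`, as a subspace of `A` under substitution of `s`, `t`. -/
noncomputable def formValues (K : Type*) {A : Type*} [Field K] [CommRing A] [Algebra K A] (s t : A)
    (d : ℕ) : Submodule K A :=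
  (MvPolynomial.homogeneousSubmodule (Fin 2) K d).map (MvPolynomial.aeval ![s, t]).toLinearMap

/-- The isomorphism of the space of polynomials of degree at most `d` with the space of binary
forms of degree `d`. -/
noncomputable def homogenizeEquiv (K : Type*) [Field K] (d : ℕ) :
    Polynomial.degreeLT K (d + 1) ≃ₗ[K] MvPolynomial.homogeneousSubmodule (Fin 2) K d :=
  LinearEquiv.ofBijective
    (((Polynomial.homogenizeLM d) ∘ₗ (Polynomial.degreeLT K (d + 1)).subtype).codRestrict _
      fun p => Polynomial.isHomogeneous_homogenize (p : Polynomial K)) <| by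
    constructor
    · rw [injective_iff_map_eq_zero]
      intro p hp
      refine Subtype.ext ((Polynomial.homogenize_eq_zero_iff ?_).1 (congrArg Subtype.val hp))
      rcases eq_or_ne (p : Polynomial K) 0 with h0 | h0
      · rw [h0, Polynomial.natDegree_zero]; exact Nat.zero_le _
      · exact Nat.le_of_lt_succ ((Polynomial.natDegree_lt_iff_degree_lt h0).2
          (Polynomial.mem_degreeLT.1 p.2))
    · intro q
      have hq : (q : MvPolynomial (Fin 2) K).IsHomogeneous d := q.2
      refine ⟨⟨MvPolynomial.aeval ![Polynomial.X, 1] (q : MvPolynomial (Fin 2) K), ?_⟩, ?_⟩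
      · rw [Polynomial.mem_degreeLT]
        refine lt_of_le_of_lt (Polynomial.natDegree_le_iff_degree_le.1
          (natDegree_aeval_X_one_le hq)) ?_
        exact_mod_cast Nat.lt_succ_self d
      · exact Subtype.ext (Polynomial.homogenize_eq_of_isHomogeneous hq rfl)

theorem finrank_homogeneousSubmodule_two (K : Type*) [Field K] (d : ℕ) :
    Module.finrank K (MvPolynomial.homogeneousSubmodule (Fin 2) K d) = d + 1 := by
  rw [← (homogenizeEquiv K d).finrank_eq, (Polynomial.degreeLTEquiv K (d + 1)).finrank_eq,
    Module.finrank_fin_fun]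

instance (K : Type*) [Field K] (d : ℕ) :
    Module.Finite K (MvPolynomial.homogeneousSubmodule (Fin 2) K d) :=
  Module.Finite.of_surjective
    ((homogenizeEquiv K d).toLinearMap ∘ₗ (Polynomial.degreeLTEquiv K (d + 1)).symm.toLinearMap)
    ((homogenizeEquiv K d).surjective.comp (Polynomial.degreeLTEquiv K (d + 1)).symm.surjective)

/-- With `dim A = n`, an element `mu ≠ 0` that is orthogonal to all forms of degree `n - 2` in `s`
and `t` is not a zero divisor. For otherwise this hyperplane of forms contains a one-dimensional
ideal `I`, and some `w` in the span of `s` and `t` kills `I`, against the nonvanishing of forms of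
degree `n - 1`. -/
theorem eq_zero_of_mul_eq_zero_of_orthogonal [IsAlgClosed K] (hU : InGeneralPosition U)
    (h2 : Module.finrank K U = 2) (hs : s ∈ U) (ht : t ∈ U)
    (hst : LinearIndependent K ![s, t]) {lam : A →ₗ[K] K} (h : IsNondegenerate lam) {d : ℕ}
    (hd : d + 2 = Module.finrank K A) {mu : A} (hmu0 : mu ≠ 0)
    (hmu : ∀ f ∈ formValues K s t d, lam (mu * f) = 0) {b : A} (hb : mu * b = 0) : b = 0 := by
  by_contra hb0
  have hres := surjective_algebraMap_quotient (K := K) (A := A)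
  have : IsArtinianRing A := IsArtinianRing.of_finite K A
  have hinj : Function.Injective ((MvPolynomial.aeval ![s, t]).toLinearMap ∘ₗ
      (MvPolynomial.homogeneousSubmodule (Fin 2) K d).subtype) := by
    rw [injective_iff_map_eq_zero]
    intro q hq
    by_contra hq0
    exact aeval_ne_zero_of_isHomogeneous hU h2 hs ht hst (by omega) q.2
      (fun h0 => hq0 (Subtype.ext h0)) hq
  have hFdim : Module.finrank K (formValues K s t d) = d + 1 := by
    rw [← finrank_homogeneousSubmodule_two K d, ← LinearMap.finrank_range_of_inj hinj,
      LinearMap.range_comp, Submodule.range_subtype, formValues]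
  have hF : formValues K s t d = (mulForm lam).orthogonal (Submodule.span K {mu}) := by
    apply Submodule.eq_of_le_of_finrank_le
    · intro f hf w hw
      obtain ⟨c, rfl⟩ := Submodule.mem_span_singleton.1 hw
      change mulForm lam (c • mu) f = 0
      rw [map_smul, LinearMap.smul_apply, mulForm_apply, hmu f hf, smul_zero]
    · rw [LinearMap.BilinForm.finrank_orthogonal h.mulForm, finrank_span_singleton hmu0, hFdim]
      omega
  have hbF : (Ideal.span {b}).restrictScalars K ≤ formValues K s t d := by
    intro a ha
    obtain ⟨c, rfl⟩ := Ideal.mem_span_singleton'.1 ha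
    rw [hF]
    intro w hw
    obtain ⟨γ, rfl⟩ := Submodule.mem_span_singleton.1 hw
    change lam (γ • mu * (c * b)) = 0
    rw [smul_mul_assoc, show mu * (c * b) = c * (mu * b) by ring, hb, mul_zero, smul_zero, map_zero]
  obtain ⟨I, hI, hIb⟩ := exists_covBy_le_of_lt
    (bot_lt_iff_ne_bot.2 (mt Ideal.span_singleton_eq_bot.1 hb0) : ⊥ < Ideal.span {b})
  have hI1 : Module.finrank K (I.restrictScalars K) = 1 := by
    rw [finrank_of_covBy hres hI, Submodule.restrictScalars_bot, finrank_bot]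
  obtain ⟨σ, hσI, hσ0⟩ := (Submodule.ne_bot_iff I).1 hI.lt.ne'
  let f : U →ₗ[K] I.restrictScalars K :=
    ((LinearMap.mulRight K σ) ∘ₗ U.subtype).codRestrict _ fun w => I.mul_mem_left _ hσI
  obtain ⟨w, hw, hw0⟩ : ∃ w ∈ LinearMap.ker f, w ≠ 0 := by
    rw [← Submodule.ne_bot_iff]
    intro hbot
    have := LinearMap.finrank_range_add_finrank_ker f
    rw [hbot, finrank_bot, h2] at this
    have := Submodule.finrank_le (LinearMap.range f)
    omega
  have hwσ : (w : A) * σ = 0 := congrArg Subtype.val hw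
  obtain ⟨q, hq, hqσ⟩ := hbF (hIb hσI)
  have hUspan : (w : A) ∈ Submodule.span K (Set.range ![s, t]) := by
    have : Submodule.span K (Set.range ![s, t]) = U := by
      apply Submodule.eq_of_le_of_finrank_le
      · rw [Submodule.span_le]
        rintro _ ⟨i, rfl⟩
        fin_cases i
        · exact hs
        · exact ht
      · rw [h2, finrank_span_eq_card hst, Fintype.card_fin]
    rw [this]
    exact w.2
  rw [Submodule.mem_span_range_iff_exists_fun] at hUspan
  obtain ⟨c, hc⟩ := hUspan
  let L : MvPolynomial (Fin 2) K := ∑ i, MvPolynomial.C (c i) * MvPolynomial.X i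
  have hL : L.IsHomogeneous 1 := MvPolynomial.IsHomogeneous.sum _ _ _ fun i _ => by
    simpa using (MvPolynomial.isHomogeneous_C (Fin 2) (c i)).mul (MvPolynomial.isHomogeneous_X K i)
  have hLw : MvPolynomial.aeval ![s, t] L = (w : A) := by
    rw [← hc, map_sum]
    refine Finset.sum_congr rfl fun i _ => ?_
    rw [map_mul, MvPolynomial.algHom_C, MvPolynomial.aeval_X, Algebra.smul_def]
  have hL0 : L ≠ 0 := fun h0 => hw0 (Subtype.ext (by rw [← hLw, h0, map_zero]; rfl))
  have hqσ' : MvPolynomial.aeval ![s, t] q = σ := hqσ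
  have hq0 : q ≠ 0 := fun h0 => hσ0 (by rw [← hqσ', h0, map_zero])
  refine aeval_ne_zero_of_isHomogeneous hU h2 hs ht hst (d := 1 + d) (by omega) (hL.mul hq)
    (mul_ne_zero hL0 hq0) ?_
  rw [map_mul, hLw, hqσ', hwσ]

end BinaryForms

/-! ### From a nondegenerate functional to a rational normal curve -/

section BaseChange

variable {k A : Type*} (K : Type*) [Field k] [Field K] [Algebra k K] [CommRing A] [Algebra k A]

/-- The base change of a linear functional along a field extension. -/
noncomputable def functionalBaseChange (lam : A →ₗ[k] k) : K ⊗[k] A →ₗ[K] K :=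
  (TensorProduct.AlgebraTensorModule.rid k K K).toLinearMap ∘ₗ lam.baseChange K

@[simp] theorem functionalBaseChange_tmul (lam : A →ₗ[k] k) (c : K) (a : A) :
    functionalBaseChange K lam (c ⊗ₜ a) = lam a • c := by
  simp [functionalBaseChange]

theorem IsNondegenerate.baseChange {lam : A →ₗ[k] k} (h : IsNondegenerate lam) :
    IsNondegenerate (functionalBaseChange K lam) := by
  classical
  intro z hz
  let 𝓑 := Module.Basis.ofVectorSpace k K
  obtain ⟨f, rfl⟩ := (TensorProduct.equivFinsuppOfBasisLeft (N := A) 𝓑).symm.surjective z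
  suffices f = 0 by rw [this, map_zero]
  ext i
  refine h _ fun b => ?_
  have hb := hz (1 ⊗ₜ b)
  rw [TensorProduct.equivFinsuppOfBasisLeft_symm_apply, Finsupp.sum, Finset.sum_mul, map_sum] at hb
  simp only [Algebra.TensorProduct.tmul_mul_tmul, mul_one, functionalBaseChange_tmul] at hb
  have hli := linearIndependent_iff'.1 𝓑.linearIndependent f.support
    (fun i => lam (f i * b)) hb i
  by_cases hi : i ∈ f.support
  · exact hli hi
  · rw [Finsupp.notMem_support_iff.1 hi, zero_mul, map_zero]

theorem LinearIndependent.of_one_tmul {ι : Type*} {a : ι → A}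
    (h : LinearIndependent K fun i => (1 : K) ⊗ₜ[k] a i) : LinearIndependent k a := by
  have h1 : LinearIndependent k fun i => (1 : K) ⊗ₜ[k] a i :=
    h.restrict_scalars (by
      intro x y hxy
      exact (algebraMap k K).injective (by simpa [Algebra.smul_def] using hxy))
  exact LinearIndependent.of_comp
    (Algebra.TensorProduct.includeRight : A →ₐ[k] K ⊗[k] A).toLinearMap h1

theorem aeval_one_tmul {σ : Type*} (x : σ → A) (F : MvPolynomial σ k) :
    MvPolynomial.aeval (fun i => (1 : K) ⊗ₜ[k] x i) (MvPolynomial.map (algebraMap k K) F) =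
      (1 : K) ⊗ₜ[k] MvPolynomial.aeval x F := by
  rw [MvPolynomial.aeval_map_algebraMap]
  exact (MvPolynomial.comp_aeval_apply x
    (Algebra.TensorProduct.includeRight : A →ₐ[k] K ⊗[k] A) F).symm

theorem aeval_smul_of_isHomogeneous {σ : Type*} (mu : A) (x : σ → A) {d : ℕ}
    {F : MvPolynomial σ k} (hF : F.IsHomogeneous d) :
    MvPolynomial.aeval (fun i => mu * x i) F = mu ^ d * MvPolynomial.aeval x F := by
  rw [F.as_sum, map_sum, map_sum, Finset.mul_sum]
  refine Finset.sum_congr rfl fun m hm => ?_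
  have hmd : m.degree = d := by
    have := hF (MvPolynomial.mem_support_iff.1 hm)
    rw [← this, Finsupp.degree_eq_weight_one]
    rfl
  rw [MvPolynomial.aeval_monomial, MvPolynomial.aeval_monomial, Finsupp.prod, Finsupp.prod]
  simp only [mul_pow]
  rw [Finset.prod_mul_distrib, Finset.prod_pow_eq_pow_sum, ← hmd, Finsupp.degree_apply]
  ring

variable [Module.Finite k A] [IsAlgClosed K]

/-- Let `a 0, …, a r` span a subspace `W` in general position (geometrically) of a Gorenstein
algebra of dimension `r + 3`. The orthogonal space of `W` has a basis `s`, `t`, and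
`W = mu * (forms of degree r in s, t)`, where `mu` is orthogonal to the forms of degree `r + 1`.
This exhibits the `a j` as values of a basis of the space of binary forms of degree `r`. -/
theorem exists_basis_binary_forms {r : ℕ} {lam : A →ₗ[k] k} (h : IsNondegenerate lam)
    (hA : Module.finrank k A = r + 3) {a : Fin (r + 1) → A}
    (hind : LinearIndependent K fun i => (1 : K) ⊗ₜ[k] a i)
    (hGP : InGeneralPosition (Submodule.span K (Set.range fun i => (1 : K) ⊗ₜ[k] a i))) :
    ∃ l : Module.Basis (Fin (r + 1)) k (MvPolynomial.homogeneousSubmodule (Fin 2) k r),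
      ∀ (d : ℕ) (F : MvPolynomial (Fin (r + 1)) k), F.IsHomogeneous d →
        MvPolynomial.aeval (fun j => (l j : MvPolynomial (Fin 2) k)) F = 0 →
        MvPolynomial.aeval a F = 0 := by
  have hinda := LinearIndependent.of_one_tmul K hind
  set W := Submodule.span k (Set.range a)
  have hWdim : Module.finrank k W = r + 1 := by
    rw [finrank_span_eq_card hinda, Fintype.card_fin]
  set W' := (mulForm lam).orthogonal W with hW'
  have hW'dim : Module.finrank k W' = 2 := by
    rw [hW', LinearMap.BilinForm.finrank_orthogonal h.mulForm, hWdim, hA]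
    omega
  let bs := Module.finBasisOfFinrankEq k W' hW'dim
  let s : A := (bs 0 : W')
  let t : A := (bs 1 : W')
  have hst : LinearIndependent k ![s, t] := by
    have := bs.linearIndependent.map' W'.subtype W'.ker_subtype
    have h2 : ![s, t] = W'.subtype ∘ bs := by
      ext i
      fin_cases i <;> rfl
    rw [h2]
    exact this
  have hspan : ∀ w ∈ W', ∃ α β : k, w = α • s + β • t := by
    intro w hw
    have := bs.sum_repr ⟨w, hw⟩
    rw [Fin.sum_univ_two] at this
    exact ⟨_, _, (congrArg Subtype.val this).symm⟩
  -- The same data after base change to `K`.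
  have hK := h.baseChange K
  set lamK := functionalBaseChange K lam
  set WK := Submodule.span K (Set.range fun i => (1 : K) ⊗ₜ[k] a i)
  set U := (mulForm lamK).orthogonal WK with hUdef
  have hUGP : InGeneralPosition U := hGP.orthogonal hK
  have hAK : Module.finrank K (K ⊗[k] A) = r + 3 := by rw [Module.finrank_baseChange, hA]
  have hU2 : Module.finrank K U = 2 := by
    rw [hUdef, LinearMap.BilinForm.finrank_orthogonal hK.mulForm, hAK,
      finrank_span_eq_card hind, Fintype.card_fin]
    omega
  have hmemU : ∀ w ∈ W', (1 : K) ⊗ₜ[k] w ∈ U := by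
    intro w hw v hv
    have hv0 : v ∈ LinearMap.ker (mulForm lamK (1 ⊗ₜ w)) := by
      refine (Submodule.span_le.2 ?_) hv
      rintro _ ⟨i, rfl⟩
      have : mulForm lam (a i) w = 0 := hw (a i) (Submodule.subset_span ⟨i, rfl⟩)
      rw [mulForm_apply] at this
      change functionalBaseChange K lam ((1 ⊗ₜ w) * (1 ⊗ₜ a i)) = 0
      rw [Algebra.TensorProduct.tmul_mul_tmul, functionalBaseChange_tmul, mul_comm w, this,
        zero_smul]
    exact mulForm_isRefl lamK _ _ hv0
  have hsU := hmemU s (bs 0).2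
  have htU := hmemU t (bs 1).2
  have hcons : ![(1 : K) ⊗ₜ[k] s, (1 : K) ⊗ₜ[k] t] = fun i => (1 : K) ⊗ₜ[k] (![s, t] i) := by
    ext i
    fin_cases i <;> rfl
  have hstK : LinearIndependent K ![(1 : K) ⊗ₜ[k] s, (1 : K) ⊗ₜ[k] t] := by
    rw [hcons]
    exact Module.Flat.linearIndependent_one_tmul hst
  obtain ⟨mu, hmu, hmu0⟩ : ∃ mu ∈ (mulForm lam).orthogonal (formValues k s t (r + 1)), mu ≠ 0 := by
    rw [← Submodule.ne_bot_iff]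
    intro hbot
    have h1 := LinearMap.BilinForm.finrank_orthogonal h.mulForm (formValues k s t (r + 1))
    have h2 : Module.finrank k (formValues k s t (r + 1)) ≤ r + 2 :=
      (Submodule.finrank_map_le _ _).trans (finrank_homogeneousSubmodule_two k (r + 1)).le
    rw [hbot, finrank_bot] at h1
    omega
  have hmuF : ∀ F : MvPolynomial (Fin 2) k, F.IsHomogeneous (r + 1) →
      lam (mu * MvPolynomial.aeval ![s, t] F) = 0 := by
    intro F hF
    rw [mul_comm]
    exact hmu _ ⟨F, hF, rfl⟩
  have hmuK : ∀ f ∈ formValues K ((1 : K) ⊗ₜ[k] s) ((1 : K) ⊗ₜ[k] t) (r + 1),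
      lamK ((1 ⊗ₜ mu) * f) = 0 := by
    rintro _ ⟨F, hF, rfl⟩
    change lamK ((1 ⊗ₜ mu) * MvPolynomial.aeval _ F) = 0
    rw [F.as_sum, map_sum, Finset.mul_sum, map_sum]
    refine Finset.sum_eq_zero fun m hm => ?_
    have hmd := hF (MvPolynomial.mem_support_iff.1 hm)
    have h1 : MvPolynomial.monomial m (F.coeff m) =
        F.coeff m • MvPolynomial.map (algebraMap k K) (MvPolynomial.monomial m 1) := by
      rw [MvPolynomial.map_monomial, map_one, MvPolynomial.smul_monomial, smul_eq_mul, mul_one]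
    rw [h1, map_smul, hcons, aeval_one_tmul, mul_smul_comm, map_smul,
      Algebra.TensorProduct.tmul_mul_tmul]
    change F.coeff m • functionalBaseChange K lam _ = 0
    rw [functionalBaseChange_tmul, hmuF _ (MvPolynomial.isHomogeneous_monomial _ ?_), zero_smul,
      smul_zero]
    rw [← hmd, Finsupp.degree_eq_weight_one]
    rfl
  have hmuK0 : (1 : K) ⊗ₜ[k] mu ≠ 0 := by
    have := (Module.Flat.linearIndependent_one_tmul (S := K)
      (LinearIndependent.of_subsingleton (R := k) (v := fun _ : Unit => mu) () hmu0)).ne_zero ()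
    exact this
  -- Multiplication by `mu` and substitution of `s`, `t` identify the forms of degree `r` with `W`.
  let Ψ : MvPolynomial.homogeneousSubmodule (Fin 2) k r →ₗ[k] A :=
    LinearMap.mulLeft k mu ∘ₗ (MvPolynomial.aeval ![s, t]).toLinearMap ∘ₗ
      (MvPolynomial.homogeneousSubmodule (Fin 2) k r).subtype
  have hΨ : ∀ F, Ψ F = mu * MvPolynomial.aeval ![s, t] (F : MvPolynomial (Fin 2) k) := fun _ => rfl
  have hΨinj : Function.Injective Ψ := by
    rw [injective_iff_map_eq_zero]
    intro F hF
    by_contra hF0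
    have hF' : (F : MvPolynomial (Fin 2) k).IsHomogeneous r := F.2
    have h1 : ((1 : K) ⊗ₜ[k] mu) * MvPolynomial.aeval ![(1 : K) ⊗ₜ[k] s, (1 : K) ⊗ₜ[k] t]
        (MvPolynomial.map (algebraMap k K) (F : MvPolynomial (Fin 2) k)) = 0 := by
      rw [hcons, aeval_one_tmul, Algebra.TensorProduct.tmul_mul_tmul, ← hΨ, hF,
        TensorProduct.tmul_zero]
    refine aeval_ne_zero_of_isHomogeneous hUGP hU2 hsU htU hstK (d := r) (by omega)
      (hF'.map _) (fun h0 => hF0 (Subtype.ext ?_))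
      (eq_zero_of_mul_eq_zero_of_orthogonal hUGP hU2 hsU htU hstK hK (d := r + 1)
        (by omega) hmuK0 hmuK h1)
    exact MvPolynomial.map_injective _ (algebraMap k K).injective (by rw [h0]; simp)
  have hΨle : LinearMap.range Ψ ≤ W := by
    rintro _ ⟨F, rfl⟩
    have hF : (F : MvPolynomial (Fin 2) k).IsHomogeneous r := F.2
    rw [← LinearMap.BilinForm.orthogonal_orthogonal h.mulForm (mulForm_isRefl lam) W]
    intro w hw
    obtain ⟨α, β, rfl⟩ := hspan w hw
    have h0 := hmuF (MvPolynomial.X 0 * (F : MvPolynomial (Fin 2) k)) (by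
      rw [add_comm]; exact (MvPolynomial.isHomogeneous_X k 0).mul hF)
    have h1 := hmuF (MvPolynomial.X 1 * (F : MvPolynomial (Fin 2) k)) (by
      rw [add_comm]; exact (MvPolynomial.isHomogeneous_X k 1).mul hF)
    rw [map_mul (MvPolynomial.aeval ![s, t]), MvPolynomial.aeval_X] at h0 h1
    simp only [Matrix.cons_val_zero, Matrix.cons_val_one] at h0 h1
    change lam ((α • s + β • t) * (mu * MvPolynomial.aeval ![s, t] (F : MvPolynomial _ k))) = 0
    have : (α • s + β • t) * (mu * MvPolynomial.aeval ![s, t] (F : MvPolynomial (Fin 2) k)) =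
        α • (mu * (s * MvPolynomial.aeval ![s, t] (F : MvPolynomial (Fin 2) k))) +
        β • (mu * (t * MvPolynomial.aeval ![s, t] (F : MvPolynomial (Fin 2) k))) := by
      simp only [Algebra.smul_def]
      ring
    rw [this, map_add, map_smul, map_smul, h0, h1]
    simp
  have hΨrange : LinearMap.range Ψ = W := by
    apply Submodule.eq_of_le_of_finrank_le hΨle
    rw [LinearMap.finrank_range_of_inj hΨinj, finrank_homogeneousSubmodule_two, hWdim]
  let e : W ≃ₗ[k] MvPolynomial.homogeneousSubmodule (Fin 2) k r :=
    (LinearEquiv.ofEq _ _ hΨrange.symm).trans (LinearEquiv.ofInjective Ψ hΨinj).symm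
  let l := (Module.Basis.span hinda).map e
  have hl : ∀ j, Ψ (l j) = a j := by
    intro j
    have h1 : Ψ (e (Module.Basis.span hinda j)) = (Module.Basis.span hinda j : A) := by
      have := (LinearEquiv.ofInjective Ψ hΨinj).apply_symm_apply
        (LinearEquiv.ofEq _ _ hΨrange.symm (Module.Basis.span hinda j))
      exact congrArg Subtype.val this
    rw [← Module.Basis.map_apply, Module.Basis.span_apply] at h1
    exact h1
  refine ⟨l, fun d F hF h0 => ?_⟩
  have h1 : a = fun j => mu * MvPolynomial.aeval ![s, t] (l j : MvPolynomial (Fin 2) k) :=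
    funext fun j => (hl j).symm
  rw [h1, aeval_smul_of_isHomogeneous mu _ hF,
    ← MvPolynomial.comp_aeval_apply (fun j => (l j : MvPolynomial (Fin 2) k)), h0, map_zero,
    mul_zero]

end BaseChange

/-! ### Self-injective rings -/

section SelfInjective

/-- In a self-injective local ring, the socle is contained in every nonzero principal ideal. -/
theorem dvd_of_injective {R : Type u} [CommRing R] [IsLocalRing R] [Module.Injective R R]
    {x y : R} (hx0 : x ≠ 0)
    (hy : ∀ a ∈ IsLocalRing.maximalIdeal R, a * y = 0) : x ∣ y := by
  have hker : LinearMap.ker (LinearMap.toSpanSingleton R R x) ≤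
      LinearMap.ker (LinearMap.toSpanSingleton R R y) := by
    intro a ha
    rw [LinearMap.mem_ker, LinearMap.toSpanSingleton_apply, smul_eq_mul] at ha ⊢
    refine hy a ((IsLocalRing.mem_maximalIdeal a).2 fun hu => hx0 ?_)
    exact (hu.mul_right_eq_zero).1 ha
  let f : (R ⧸ LinearMap.ker (LinearMap.toSpanSingleton R R x)) →ₗ[R] R :=
    (LinearMap.ker (LinearMap.toSpanSingleton R R x)).liftQ _ hker
  let i : (R ⧸ LinearMap.ker (LinearMap.toSpanSingleton R R x)) →ₗ[R] R :=
    (LinearMap.ker (LinearMap.toSpanSingleton R R x)).liftQ _ le_rfl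
  have hi : Function.Injective i := LinearMap.ker_eq_bot.1 (Submodule.ker_liftQ_eq_bot _ _ _ le_rfl)
  obtain ⟨g, hg⟩ := Module.Injective.out i hi f
  refine ⟨g 1, ?_⟩
  have h1 := hg (Submodule.Quotient.mk 1)
  have h2 : i (Submodule.Quotient.mk 1) = x • (1 : R) := by
    change LinearMap.toSpanSingleton R R x 1 = _
    simp
  have h3 : f (Submodule.Quotient.mk 1) = y := by
    change LinearMap.toSpanSingleton R R y 1 = _
    simp
  rw [h2, h3, map_smul, smul_eq_mul] at h1
  exact h1.symm

variable {k : Type*} [Field k]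

/-- Every nonzero ideal of a self-injective local algebra contains the whole socle, so a functional
that is nonzero at some socle element is nondegenerate. -/
theorem exists_isNondegenerate_of_injective {R : Type u} [CommRing R] [IsLocalRing R]
    [Algebra k R] [Module.Finite k R] [Module.Injective R R] :
    ∃ lam : R →ₗ[k] k, IsNondegenerate lam := by
  have : IsArtinianRing R := IsArtinianRing.of_finite k R
  have : Nontrivial R := inferInstance
  -- A minimal ideal inside a nonzero ideal is killed by the maximal ideal.
  have hsoc : ∀ I : Ideal R, I ≠ ⊥ → ∃ x ∈ I, x ≠ 0 ∧
      ∀ a ∈ IsLocalRing.maximalIdeal R, a * x = 0 := by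
    intro I hI
    obtain ⟨S, hS, hSI⟩ := exists_covBy_le_of_lt (bot_lt_iff_ne_bot.2 hI)
    obtain ⟨x, hxS, hx0⟩ := (Submodule.ne_bot_iff S).1 hS.lt.ne'
    refine ⟨x, hSI hxS, hx0, fun a ha => ?_⟩
    by_contra hax
    have hle : Ideal.span {a * x} = S := by
      refine ((bot_covBy_iff.1 hS).le_iff.1
        ((Ideal.span_singleton_le_iff_mem _).2 (S.mul_mem_left a hxS))).resolve_left ?_
      exact mt Ideal.span_singleton_eq_bot.1 hax
    obtain ⟨c, hc⟩ := Ideal.mem_span_singleton'.1 (hle ▸ hxS)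
    have hu : IsUnit (1 - c * a) := by
      by_contra hnu
      have := add_mem ((IsLocalRing.mem_maximalIdeal _).2 hnu) (Ideal.mul_mem_left _ c ha)
      rw [sub_add_cancel] at this
      exact (Ideal.ne_top_iff_one _).1 (IsLocalRing.maximalIdeal.isMaximal R).ne_top this
    exact hx0 ((hu.mul_right_eq_zero).1 (by linear_combination -hc))
  obtain ⟨x, -, hx0, hx⟩ := hsoc ⊤ top_ne_bot
  obtain ⟨lam, hlam⟩ : ∃ lam : R →ₗ[k] k, lam x ≠ 0 := by
    by_contra! hall
    exact hx0 ((Module.forall_dual_apply_eq_zero_iff k x).1 hall)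
  refine ⟨lam, fun a ha => ?_⟩
  by_contra ha0
  obtain ⟨y, hya, hy0, -⟩ := hsoc (Ideal.span {a}) (mt Ideal.span_singleton_eq_bot.1 ha0)
  obtain ⟨b, hb⟩ := dvd_of_injective hy0 hx
  obtain ⟨c, rfl⟩ := Ideal.mem_span_singleton'.1 hya
  refine hlam ?_
  rw [hb, show c * a * b = a * (c * b) by ring]
  exact ha _

/-- An Artinian algebra with self-injective local rings has a nondegenerate functional. -/
theorem exists_isNondegenerate {A : Type u} [CommRing A] [Algebra k A] [Module.Finite k A]
    (h : ∀ p : PrimeSpectrum A, Module.Injective (Localization.AtPrime p.asIdeal)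
      (Localization.AtPrime p.asIdeal)) :
    ∃ lam : A →ₗ[k] k, IsNondegenerate lam := by
  classical
  have : IsArtinianRing A := IsArtinianRing.of_finite k A
  have hbij := PrimeSpectrum.toPiLocalization_bijective (R := A)
  have : Fintype (PrimeSpectrum A) := Fintype.ofFinite _
  have hfin : ∀ p : PrimeSpectrum A, Module.Finite k (Localization.AtPrime p.asIdeal) := by
    intro p
    have hsurj : Function.Surjective (algebraMap A (Localization.AtPrime p.asIdeal)) := by
      intro y
      obtain ⟨a, ha⟩ := hbij.2 (Pi.single p y)
      refine ⟨a, ?_⟩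
      have := congrFun ha p
      rwa [Pi.single_eq_same] at this
    exact Module.Finite.of_surjective
      (IsScalarTower.toAlgHom k A (Localization.AtPrime p.asIdeal)).toLinearMap hsurj
  choose lam hlam using fun p : PrimeSpectrum A =>
    exists_isNondegenerate_of_injective (k := k) (R := Localization.AtPrime p.asIdeal)
  refine ⟨∑ p, lam p ∘ₗ (IsScalarTower.toAlgHom k A (Localization.AtPrime p.asIdeal)).toLinearMap,
    fun a ha => hbij.1 ?_⟩
  rw [map_zero]
  ext p : 1
  refine hlam p _ fun c => ?_
  obtain ⟨b, hb⟩ := hbij.2 (Pi.single p c)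
  have hb' : ∀ q, algebraMap A (Localization.AtPrime q.asIdeal) b =
    (Pi.single p c : PrimeSpectrum.PiLocalization A) q := fun q => congrFun hb q
  have h1 := ha b
  rw [LinearMap.sum_apply, Finset.sum_eq_single p] at h1
  · rw [LinearMap.comp_apply] at h1
    change lam p (algebraMap A _ (a * b)) = 0 at h1
    rw [map_mul, hb', Pi.single_eq_same] at h1
    exact h1
  · intro q _ hq
    rw [LinearMap.comp_apply]
    change lam q (algebraMap A _ (a * b)) = 0
    rw [map_mul, hb', Pi.single_eq_of_ne hq, mul_zero, map_zero]
  · intro hp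
    exact absurd (Finset.mem_univ p) hp

/-- A proper quotient of a principal ideal domain is self-injective. -/
theorem injective_of_surjective_of_isPrincipalIdealRing {D R : Type*} [CommRing D] [IsDomain D]
    [IsPrincipalIdealRing D] [CommRing R] (π : D →+* R) (hπ : Function.Surjective π)
    (hker : RingHom.ker π ≠ ⊥) : Module.Injective R R := by
  refine Module.Baer.injective fun I g => ?_
  obtain ⟨q, hq⟩ := IsPrincipalIdealRing.principal (RingHom.ker π)
  obtain ⟨d, hd⟩ := IsPrincipalIdealRing.principal (I.comap π)
  have hqmem : ∀ a, π a = 0 ↔ q ∣ a := fun a => by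
    rw [← RingHom.mem_ker, hq]
    exact Ideal.mem_span_singleton
  have hdmem : ∀ a, π a ∈ I ↔ d ∣ a := fun a => by
    rw [← Ideal.mem_comap, hd]
    exact Ideal.mem_span_singleton
  obtain ⟨e, he⟩ : d ∣ q := (hdmem q).1 (by rw [(hqmem q).2 dvd_rfl]; exact zero_mem I)
  have hq0 : q ≠ 0 := by
    rintro rfl
    exact hker (by rw [hq]; simp)
  have he0 : e ≠ 0 := by
    rintro rfl
    exact hq0 (by rw [he, mul_zero])
  let d' : I := ⟨π d, (hdmem d).2 dvd_rfl⟩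
  obtain ⟨b, hb⟩ := hπ (g d')
  have heb : π (e * b) = 0 := by
    rw [map_mul, hb, ← smul_eq_mul, ← map_smul]
    have : π e • d' = 0 := Subtype.ext (by
      change π e * π d = 0
      rw [← map_mul, mul_comm, ← he]
      exact (hqmem q).2 dvd_rfl)
    rw [this, map_zero]
  obtain ⟨c, hc⟩ : d ∣ b := by
    obtain ⟨c, hc⟩ := (hqmem _).1 heb
    refine ⟨c, mul_left_cancel₀ he0 ?_⟩
    rw [hc, he]
    ring
  refine ⟨LinearMap.mulRight R (π c), fun x hx => ?_⟩
  obtain ⟨a, rfl⟩ := hπ x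
  obtain ⟨a', rfl⟩ := (hdmem a).1 hx
  have hx' : (⟨π (d * a'), hx⟩ : I) = π a' • d' := Subtype.ext (by
    change π (d * a') = π a' * π d
    rw [map_mul, mul_comm])
  rw [hx', map_smul, ← hb, hc, LinearMap.mulRight_apply, map_mul, map_mul, smul_eq_mul]
  ring

end SelfInjective

/-! ### Descent of uniseriality -/

section Uniserial

/-- At the prime `p`, any two elements are comparable under divisibility up to elements outside
`p`; equivalently, the ideals of the localization at `p` form a chain. -/
def IsUniserialAt {A : Type*} [CommRing A] (p : Ideal A) : Prop :=
  ∀ a b : A, ∃ s ∉ p, b ∣ s * a ∨ a ∣ s * b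

theorem isUniserialAt_of_le_span_sup_sq {A : Type*} [CommRing A] [IsArtinianRing A] {m : Ideal A}
    [hm : m.IsMaximal] {t : A} (htm : t ∈ m) (ht : m ≤ Ideal.span {t} ⊔ m ^ 2) :
    IsUniserialAt m := by
  obtain ⟨n, hn⟩ : ∃ n, m ^ n ≤ m ^ (n + 1) := by
    obtain ⟨n, hn⟩ := IsArtinian.monotone_stabilizes
      (⟨fun n => OrderDual.toDual (m ^ n), fun i j hij => Ideal.pow_le_pow_right hij⟩ :
        ℕ →o (Ideal A)ᵒᵈ)
    exact ⟨n, (congrArg OrderDual.ofDual (hn (n + 1) n.le_succ)).le⟩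
  -- An element outside `m` that kills a high power of `m`.
  obtain ⟨v, hv, hvm⟩ : ∃ v ∉ m, ∀ a ∈ m ^ n, v * a = 0 := by
    obtain ⟨v, hv, hvm⟩ := Submodule.exists_sub_one_mem_and_smul_eq_zero_of_fg_of_le_smul m
      (m ^ n) (IsNoetherian.noetherian _) (by rwa [smul_eq_mul, ← pow_succ'])
    exact ⟨v, fun h => hm.ne_top ((Ideal.eq_top_iff_one m).2 (by simpa using sub_mem h hv)), hvm⟩
  have hle : ∀ i, m ≤ Ideal.span {t} ⊔ m ^ (i + 1) := by
    intro i
    induction i with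
    | zero => rw [zero_add, pow_one]; exact le_sup_right
    | succ i ih =>
      refine ih.trans (sup_le le_sup_left ?_)
      have h1 : m ^ (i + 1) ≤ m ^ i * (Ideal.span {t} ⊔ m ^ 2) := by
        rw [pow_succ]
        exact Ideal.mul_mono_right ht
      have h2 : m ^ i * m ^ 2 = m ^ (i + 1 + 1) := by rw [← pow_add]
      rw [Ideal.mul_sup, h2] at h1
      exact h1.trans (sup_le_sup_right Ideal.mul_le_right _)
  have hdiv : ∀ a ∈ m, ∃ b, v * a = t * b := by
    intro a ha
    obtain ⟨x, hx, y, hy, rfl⟩ := Submodule.mem_sup.1 (hle n ha)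
    obtain ⟨b, rfl⟩ := Ideal.mem_span_singleton'.1 hx
    exact ⟨v * b, by rw [mul_add, hvm y (Ideal.pow_le_pow_right n.le_succ hy)]; ring⟩
  -- Every element is a unit times a power of `t`, or zero, near `m`.
  have hpow : ∀ a : A, ∀ j, (∃ i, ∃ u ∉ m, ∃ s ∉ m, s * a = u * t ^ i) ∨
      ∃ s ∉ m, ∃ u, s * a = u * t ^ j := by
    intro a j
    induction j with
    | zero => exact Or.inr ⟨1, (Ideal.ne_top_iff_one m).1 hm.ne_top, a, by ring⟩
    | succ j ih =>
      rcases ih with h | ⟨s, hs, u, hsu⟩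
      · exact Or.inl h
      · by_cases hu : u ∈ m
        · obtain ⟨u', hu'⟩ := hdiv u hu
          exact Or.inr ⟨v * s, hm.isPrime.mul_notMem hv hs, u', by
            linear_combination v * hsu + t ^ j * hu'⟩
        · exact Or.inl ⟨j, u, hu, s, hs, hsu⟩
  have hpow' : ∀ a : A, (∃ i, ∃ u ∉ m, ∃ s ∉ m, s * a = u * t ^ i) ∨ ∃ s ∉ m, s * a = 0 := by
    intro a
    refine (hpow a n).imp_right ?_
    rintro ⟨s, hs, u, hsu⟩
    exact ⟨v * s, hm.isPrime.mul_notMem hv hs, by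
      linear_combination v * hsu + u * hvm _ (Ideal.pow_mem_pow htm n)⟩
  intro a b
  rcases hpow' a with ⟨i, u, hu, s, hs, hsa⟩ | ⟨s, hs, hsa⟩
  swap
  · exact ⟨s, hs, Or.inl (hsa ▸ dvd_zero b)⟩
  rcases hpow' b with ⟨j, w, hw, s', hs', hsb⟩ | ⟨s', hs', hsb⟩
  swap
  · exact ⟨s', hs', Or.inr (hsb ▸ dvd_zero a)⟩
  rcases le_total i j with hij | hij
  · obtain ⟨e, rfl⟩ := Nat.exists_eq_add_of_le hij
    exact ⟨u * s', hm.isPrime.mul_notMem hu hs', Or.inr ⟨w * t ^ e * s, by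
      linear_combination u * hsb - w * t ^ e * hsa⟩⟩
  · obtain ⟨e, rfl⟩ := Nat.exists_eq_add_of_le hij
    exact ⟨w * s, hm.isPrime.mul_notMem hw hs, Or.inl ⟨u * t ^ e * s', by
      linear_combination w * hsa - u * t ^ e * hsb⟩⟩

theorem equivFinsuppOfBasisLeft_mul {k K A ι : Type*} [Field k] [Field K] [Algebra k K]
    [CommRing A] [Algebra k A] [DecidableEq ι] (𝓑 : Module.Basis ι k K) (z : K ⊗[k] A) (a : A)
    (i : ι) :
    TensorProduct.equivFinsuppOfBasisLeft 𝓑 (z * (1 ⊗ₜ a)) i =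
      TensorProduct.equivFinsuppOfBasisLeft 𝓑 z i * a := by
  induction z using TensorProduct.induction_on with
  | zero => simp
  | tmul c b =>
    rw [Algebra.TensorProduct.tmul_mul_tmul, mul_one,
      TensorProduct.equivFinsuppOfBasisLeft_apply_tmul_apply,
      TensorProduct.equivFinsuppOfBasisLeft_apply_tmul_apply, smul_mul_assoc]
  | add x y hx hy => rw [add_mul, map_add, Finsupp.add_apply, hx, hy, map_add, Finsupp.add_apply,
      add_mul]

/-- Uniseriality descends along a field extension: compare coordinates with respect to a basis. -/
theorem IsUniserialAt.of_baseChange {k K A : Type*} [Field k] [Field K] [Algebra k K]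
    [CommRing A] [Algebra k A] {M : Ideal (K ⊗[k] A)} (h : IsUniserialAt M) :
    IsUniserialAt (M.comap (Algebra.TensorProduct.includeRight : A →ₐ[k] K ⊗[k] A)) := by
  classical
  let 𝓑 := Module.Basis.ofVectorSpace k K
  have key : ∀ (s z : K ⊗[k] A) (a b : A), s ∉ M → s * (1 ⊗ₜ a) = 1 ⊗ₜ b * z →
      ∃ s' ∉ M.comap (Algebra.TensorProduct.includeRight : A →ₐ[k] K ⊗[k] A), b ∣ s' * a := by
    intro s z a b hs hsz
    obtain ⟨i, hi⟩ : ∃ i, TensorProduct.equivFinsuppOfBasisLeft 𝓑 s i ∉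
        M.comap (Algebra.TensorProduct.includeRight : A →ₐ[k] K ⊗[k] A) := by
      by_contra! hall
      refine hs ?_
      rw [← (TensorProduct.equivFinsuppOfBasisLeft (N := A) 𝓑).symm_apply_apply s,
        TensorProduct.equivFinsuppOfBasisLeft_symm_apply]
      refine Ideal.sum_mem _ fun i _ => ?_
      have h1 : 𝓑 i ⊗ₜ[k] (TensorProduct.equivFinsuppOfBasisLeft 𝓑 s i) =
          (𝓑 i ⊗ₜ[k] 1) * ((1 : K) ⊗ₜ[k] (TensorProduct.equivFinsuppOfBasisLeft 𝓑 s i)) := by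
        rw [Algebra.TensorProduct.tmul_mul_tmul, mul_one, one_mul]
      change 𝓑 i ⊗ₜ[k] (TensorProduct.equivFinsuppOfBasisLeft 𝓑 s i) ∈ M
      rw [h1]
      exact Ideal.mul_mem_left _ _ (hall i)
    refine ⟨_, hi, TensorProduct.equivFinsuppOfBasisLeft 𝓑 z i, ?_⟩
    rw [← equivFinsuppOfBasisLeft_mul, hsz, mul_comm, equivFinsuppOfBasisLeft_mul, mul_comm]
  intro a b
  obtain ⟨s, hs, ⟨z, hz⟩ | ⟨z, hz⟩⟩ := h (1 ⊗ₜ a) (1 ⊗ₜ b)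
  · obtain ⟨s', hs', h'⟩ := key s z a b hs hz
    exact ⟨s', hs', Or.inl h'⟩
  · obtain ⟨s', hs', h'⟩ := key s z b a hs hz
    exact ⟨s', hs', Or.inr h'⟩

/-- The maximal ideal of a Noetherian localization at which the ring is uniserial is principal. -/
theorem IsUniserialAt.exists_maximalIdeal_eq_span {A R : Type*} [CommRing A] [CommRing R]
    [Algebra A R] {p : Ideal A} [p.IsPrime] [IsLocalization.AtPrime R p] [IsLocalRing R]
    [IsNoetherianRing R] (h : IsUniserialAt p) :
    ∃ t : R, IsLocalRing.maximalIdeal R = Ideal.span {t} := by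
  have hunit : ∀ s ∉ p, IsUnit (algebraMap A R s) := fun s hs =>
    IsLocalization.map_units R (⟨s, hs⟩ : p.primeCompl)
  have htotal : ∀ x y : R, x ∣ y ∨ y ∣ x := by
    intro x y
    obtain ⟨a, s, rfl⟩ := IsLocalization.exists_mk'_eq p.primeCompl x
    obtain ⟨b, s', rfl⟩ := IsLocalization.exists_mk'_eq p.primeCompl y
    have hx := IsLocalization.mk'_spec R a s
    have hy := IsLocalization.mk'_spec R b s'
    have hus := IsLocalization.map_units R s
    have hus' := IsLocalization.map_units R s'
    obtain ⟨w, hw, hd | hd⟩ := h a b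
    · right
      have h1 := map_dvd (algebraMap A R) hd
      rw [map_mul, (hunit w hw).dvd_mul_left, ← hx, hus.dvd_mul_right] at h1
      exact (Dvd.intro _ hy).trans h1
    · left
      have h1 := map_dvd (algebraMap A R) hd
      rw [map_mul, (hunit w hw).dvd_mul_left, ← hy, hus'.dvd_mul_right] at h1
      exact (Dvd.intro _ hx).trans h1
  have hbez : IsBezout R := IsBezout.iff_span_pair_isPrincipal.2 fun x y => by
    rcases htotal x y with hxy | hxy
    · exact ⟨x, by rw [Ideal.span_pair_eq_span_left_iff_dvd.2 hxy]⟩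
    · exact ⟨y, by rw [Ideal.span_pair_eq_span_right_iff_dvd.2 hxy]⟩
  obtain ⟨t, ht⟩ := IsBezout.isPrincipal_of_FG _
    (IsNoetherian.noetherian (IsLocalRing.maximalIdeal R))
  exact ⟨t, ht⟩

end Uniserial

/-! ### Coefficient fields -/

section CoefficientField

/-- In characteristic `p`, a square-zero extension of a field splits. A subring that contains all
`p`-th powers and meets the kernel trivially is a field; a maximal such subring `S` maps onto `L`,
for if `π y` is not in the image of `S`, then `X ^ p - y ^ p` is irreducible over `S`, and `S[y]`
is larger. -/
theorem exists_section_of_sq_zero {p : ℕ} (hp : p.Prime) {R L : Type*} [CommRing R] [CharP R p]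
    [Field L] [CharP L p] (π : R →+* L) (hπ : Function.Surjective π)
    (hsq : ∀ x y, π x = 0 → π y = 0 → x * y = 0) : ∃ σ : L →+* R, ∀ x, π (σ x) = x := by
  have : Fact p.Prime := ⟨hp⟩
  have hpow0 : ∀ x, π x = 0 → x ^ p = 0 := fun x hx => by
    rw [← Nat.sub_add_cancel hp.two_le, pow_add, pow_two, hsq x x hx hx, mul_zero]
  have hpow : ∀ x y, π x = π y → x ^ p = y ^ p := fun x y hxy => by
    rw [← sub_eq_zero, ← sub_pow_char]
    exact hpow0 _ (by rw [map_sub, hxy, sub_self])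
  let 𝒮 : Set (Subring R) := {S | (∀ x, x ^ p ∈ S) ∧ ∀ x ∈ S, π x = 0 → x = 0}
  have hF : (frobenius R p).range ∈ 𝒮 := by
    refine ⟨fun x => ⟨x, rfl⟩, ?_⟩
    rintro _ ⟨x, rfl⟩ hx
    rw [frobenius_def, map_pow] at hx
    exact hpow0 x (pow_eq_zero_iff hp.ne_zero |>.1 hx)
  obtain ⟨S, -, hS⟩ := zorn_le_nonempty₀ 𝒮 (fun c hc hchain T hT => by
    refine ⟨sSup c, ⟨fun x => ?_, fun x hx => ?_⟩, fun T hT => le_sSup hT⟩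
    · exact (le_sSup hT : T ≤ sSup c) ((hc hT).1 x)
    · obtain ⟨T', hT', hxT'⟩ := (Subring.mem_sSup_of_directedOn ⟨T, hT⟩ hchain.directedOn).1 hx
      exact (hc hT').2 x hxT') _ hF
  have hSp := hS.prop.1
  have hS0 := hS.prop.2
  have hfield : IsField S := by
    refine ⟨⟨0, 1, fun h01 => ?_⟩, mul_comm, fun {a} ha => ?_⟩
    · have := congrArg (fun s : S => π s) h01
      simp at this
    · have ha0 : π a ≠ 0 := fun h => ha (Subtype.ext (hS0 a a.2 h))
      obtain ⟨c, hc⟩ := hπ (π a)⁻¹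
      refine ⟨a ^ (p - 1) * ⟨c ^ p, hSp c⟩, Subtype.ext ?_⟩
      change (a : R) * ((a : R) ^ (p - 1) * c ^ p) = 1
      rw [← mul_assoc, ← pow_succ', Nat.sub_add_cancel hp.one_le, ← mul_pow,
        hpow _ 1 (by rw [map_mul, hc, mul_inv_cancel₀ ha0, map_one]), one_pow]
  let : Field S := hfield.toField
  let g : S →+* L := π.comp S.subtype
  have hg : Function.Surjective g := by
    intro x
    by_contra hx
    obtain ⟨y, rfl⟩ := hπ x
    let c : S := ⟨y ^ p, hSp y⟩
    let : Algebra S L := g.toAlgebra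
    have hirr : Irreducible (Polynomial.X ^ p - Polynomial.C c) := by
      refine X_pow_sub_C_irreducible_of_prime hp fun b hb => hx ⟨b, ?_⟩
      have hb' : (b : R) ^ p = y ^ p := congrArg Subtype.val hb
      have h1 : (π b - π y) ^ p = 0 := by
        rw [sub_pow_char, ← map_pow, ← map_pow, hb', sub_self]
      exact sub_eq_zero.1 (pow_eq_zero_iff hp.ne_zero |>.1 h1)
    have hroot : Polynomial.aeval (π y) (Polynomial.X ^ p - Polynomial.C c) = 0 := by
      rw [map_sub, map_pow, Polynomial.aeval_X, Polynomial.aeval_C]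
      change π y ^ p - π (y ^ p) = 0
      rw [map_pow, sub_self]
    have hdvd : ∀ q : Polynomial S, Polynomial.aeval (π y) q = 0 →
        Polynomial.eval₂ S.subtype y q = 0 := by
      intro q hq
      have hmin := minpoly.eq_of_irreducible_of_monic hirr hroot
        (Polynomial.monic_X_pow_sub_C c hp.ne_zero)
      obtain ⟨e, rfl⟩ : (Polynomial.X ^ p - Polynomial.C c) ∣ q := by
        rw [hmin]
        exact minpoly.dvd S (π y) hq
      rw [Polynomial.eval₂_mul, Polynomial.eval₂_sub, Polynomial.eval₂_pow, Polynomial.eval₂_X,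
        Polynomial.eval₂_C]
      change (y ^ p - y ^ p) * _ = 0
      rw [sub_self, zero_mul]
    let S' : Subring R := (Polynomial.eval₂RingHom S.subtype y).range
    have hSS' : S ≤ S' := fun s hs => ⟨Polynomial.C ⟨s, hs⟩, by simp⟩
    have hS' : S' ∈ 𝒮 := by
      refine ⟨fun x => hSS' (hSp x), ?_⟩
      rintro _ ⟨q, rfl⟩ hq
      refine hdvd q ?_
      rw [← hq, Polynomial.coe_eval₂RingHom, Polynomial.hom_eval₂]
      rfl
    have hyS' : y ∈ S' := ⟨Polynomial.X, by simp⟩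
    exact hx ⟨⟨y, hS.le_of_ge hS' hSS' hyS'⟩, rfl⟩
  have hbij : Function.Bijective g := ⟨g.injective, hg⟩
  refine ⟨S.subtype.comp (RingEquiv.ofBijective g hbij).symm.toRingHom, fun x => ?_⟩
  exact (RingEquiv.ofBijective g hbij).apply_symm_apply x

theorem formallySmooth_zmod {p : ℕ} [hp : Fact p.Prime] (L : Type*) [Field L]
    [Algebra (ZMod p) L] : Algebra.FormallySmooth (ZMod p) L := by
  have hL : CharP L p := charP_of_injective_algebraMap (algebraMap (ZMod p) L).injective p
  let f : MvPolynomial L (ZMod p) →ₐ[ZMod p] L := MvPolynomial.aeval id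
  have hf : Function.Surjective f := fun x => ⟨MvPolynomial.X x, MvPolynomial.aeval_X _ _⟩
  have hsurj : Function.Surjective f.kerSquareLift := fun x => by
    obtain ⟨q, hq⟩ := hf x
    exact ⟨Ideal.Quotient.mk _ q, hq⟩
  have : Nontrivial (MvPolynomial L (ZMod p) ⧸ RingHom.ker f.toRingHom ^ 2) :=
    f.kerSquareLift.toRingHom.domain_nontrivial
  have : CharP (MvPolynomial L (ZMod p) ⧸ RingHom.ker f.toRingHom ^ 2) p :=
    charP_of_injective_algebraMap (algebraMap (ZMod p) _).injective p
  obtain ⟨σ, hσ⟩ := exists_section_of_sq_zero hp.out f.kerSquareLift.toRingHom hsurj (by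
    intro x y hx hy
    have h1 : ∀ z, f.kerSquareLift.toRingHom z = 0 →
        z ∈ (RingHom.ker f.toRingHom).cotangentIdeal := fun z hz => by
      rw [← AlgHom.ker_kerSquareLift]
      exact hz
    have h2 := Ideal.mul_mem_mul (h1 x hx) (h1 y hy)
    rw [← pow_two, Ideal.cotangentIdeal_square] at h2
    exact h2)
  let g : L →ₐ[ZMod p] MvPolynomial L (ZMod p) ⧸ RingHom.ker f.toRingHom ^ 2 :=
    { σ with commutes' := fun c => RingHom.congr_fun (RingHom.ext_zmod (σ.comp (algebraMap _ _))
        (algebraMap _ _)) c }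
  exact Algebra.FormallySmooth.of_split f g (AlgHom.ext hσ)

theorem formallySmooth_rat (L : Type*) [Field L] [Algebra ℚ L] : Algebra.FormallySmooth ℚ L := by
  obtain ⟨s, hs⟩ := exists_isTranscendenceBasis ℚ L
  have halg : Algebra.IsAlgebraic (IntermediateField.adjoin ℚ (Set.range ((↑) : s → L))) L :=
    hs.isAlgebraic_field
  exact .of_algebraicIndependent_of_isSeparable hs.1

/-- A local ring with nilpotent maximal ideal that contains a field has a coefficient field. -/
theorem exists_coefficientField (k : Type*) [Field k] {R : Type*} [CommRing R] [IsLocalRing R]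
    [Algebra k R] (hnil : IsNilpotent (IsLocalRing.maximalIdeal R)) :
    ∃ σ : IsLocalRing.ResidueField R →+* R, ∀ x, IsLocalRing.residue R (σ x) = x := by
  rcases CharP.exists k with ⟨p, hp⟩
  rcases CharP.char_is_prime_or_zero k p with hpp | rfl
  · have : Fact p.Prime := ⟨hpp⟩
    let : Algebra (ZMod p) k := ZMod.algebra k p
    let : Algebra (ZMod p) R := ((algebraMap k R).comp (algebraMap (ZMod p) k)).toAlgebra
    have h := formallySmooth_zmod (p := p) (IsLocalRing.ResidueField R)
    obtain ⟨f, hf⟩ := Algebra.FormallySmooth.exists_lift (R := ZMod p)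
      (A := IsLocalRing.ResidueField R) (IsLocalRing.maximalIdeal R) hnil
      (AlgHom.id (ZMod p) (IsLocalRing.ResidueField R))
    exact ⟨f.toRingHom, fun x => AlgHom.congr_fun hf x⟩
  · have : CharZero k := CharP.charP_to_charZero k
    let : Algebra ℚ R := ((algebraMap k R).comp (algebraMap ℚ k)).toAlgebra
    have h := formallySmooth_rat (IsLocalRing.ResidueField R)
    obtain ⟨f, hf⟩ := Algebra.FormallySmooth.exists_lift (R := ℚ)
      (A := IsLocalRing.ResidueField R) (IsLocalRing.maximalIdeal R) hnil
      (AlgHom.id ℚ (IsLocalRing.ResidueField R))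
    exact ⟨f.toRingHom, fun x => AlgHom.congr_fun hf x⟩

/-- An Artinian local ring with principal maximal ideal that contains a field is `F[x] / (x ^ n)`,
with `F` the residue field. -/
theorem exists_ringEquiv_truncated_polynomial (k : Type*) [Field k] {R : Type*} [CommRing R]
    [IsLocalRing R] [IsArtinianRing R] [Algebra k R] {t : R}
    (ht : IsLocalRing.maximalIdeal R = Ideal.span {t}) :
    ∃ n : ℕ, Nonempty (R ≃+* Polynomial (IsLocalRing.ResidueField R) ⧸
      Ideal.span {(Polynomial.X : Polynomial (IsLocalRing.ResidueField R)) ^ n}) := by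
  classical
  have hnil : IsNilpotent (IsLocalRing.maximalIdeal R) := by
    rw [← IsLocalRing.jacobson_eq_maximalIdeal ⊥ bot_ne_top]
    exact IsArtinianRing.isNilpotent_jacobson_bot
  obtain ⟨σ, hσ⟩ := exists_coefficientField k hnil
  have htn : ∃ n, t ^ n = 0 := by
    obtain ⟨n, hn⟩ := hnil
    refine ⟨n, ?_⟩
    have : t ^ n ∈ IsLocalRing.maximalIdeal R ^ n :=
      Ideal.pow_mem_pow (ht ▸ Ideal.mem_span_singleton_self t) n
    rwa [hn] at this
  set n := Nat.find htn
  have hn : t ^ n = 0 := Nat.find_spec htn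
  let φ : Polynomial (IsLocalRing.ResidueField R) →+* R := Polynomial.eval₂RingHom σ t
  have hφX : φ Polynomial.X = t := Polynomial.eval₂_X _ _
  have hφC : ∀ c, φ (Polynomial.C c) = σ c := fun c => Polynomial.eval₂_C _ _
  have hstep : ∀ (j : ℕ) (x : R), ∃ q y, x = φ q + t ^ j * y := by
    intro j
    induction j with
    | zero => exact fun x => ⟨0, x, by simp⟩
    | succ j ih =>
      intro x
      obtain ⟨q, y, rfl⟩ := ih x
      have hy : y - σ (IsLocalRing.residue R y) ∈ IsLocalRing.maximalIdeal R := by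
        rw [← IsLocalRing.residue_eq_zero_iff, map_sub, hσ, sub_self]
      rw [ht, Ideal.mem_span_singleton'] at hy
      obtain ⟨z, hz⟩ := hy
      refine ⟨q + Polynomial.X ^ j * Polynomial.C (IsLocalRing.residue R y), z, ?_⟩
      rw [map_add, map_mul, map_pow, hφX, hφC]
      linear_combination -t ^ j * hz
  have hsurj : Function.Surjective φ := by
    intro x
    obtain ⟨q, y, hq⟩ := hstep n x
    exact ⟨q, by rw [hq, hn, zero_mul, add_zero]⟩
  have hker : RingHom.ker φ = Ideal.span {Polynomial.X ^ n} := by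
    apply le_antisymm
    · intro q hq
      rw [Ideal.mem_span_singleton]
      by_cases hq0 : q = 0
      · rw [hq0]; exact dvd_zero _
      obtain ⟨e, he, hne⟩ := Polynomial.exists_eq_pow_rootMultiplicity_mul_and_not_dvd q hq0 0
      rw [Polynomial.C_0, sub_zero] at he hne
      have hunit : IsUnit (φ e) := by
        rw [Polynomial.X_dvd_iff, Polynomial.coeff_zero_eq_eval_zero] at hne
        by_contra hnu
        have h1 := (IsLocalRing.residue_eq_zero_iff _).2 ((IsLocalRing.mem_maximalIdeal _).2 hnu)
        have h2 : IsLocalRing.residue R t = 0 :=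
          (IsLocalRing.residue_eq_zero_iff _).2 (ht ▸ Ideal.mem_span_singleton_self t)
        have h3 : (IsLocalRing.residue R).comp σ = RingHom.id _ := RingHom.ext hσ
        change IsLocalRing.residue R (Polynomial.eval₂ σ t e) = 0 at h1
        rw [Polynomial.hom_eval₂, h2, h3] at h1
        exact hne h1
      have h0 : φ q = 0 := hq
      rw [he, map_mul, map_pow, hφX, hunit.mul_left_eq_zero] at h0
      rw [he]
      exact Dvd.dvd.mul_right (pow_dvd_pow _ (Nat.find_min' htn h0)) _
    · rw [Ideal.span_singleton_le_iff_mem, RingHom.mem_ker, map_pow, hφX, hn]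
  exact ⟨n, ⟨((Ideal.quotEquivOfEq hker.symm).trans
    (RingHom.quotientKerEquivOfSurjective hsurj)).symm⟩⟩

end CoefficientField

/-! ### Subschemes of a rational normal curve are Gorenstein -/

section RationalNormalCurve

variable {k R : Type*} [Field k] [CommRing R] [Algebra k R]

/-- If the forms that vanish on the basis `l` of the binary forms of degree `r` also vanish at
`a`, then the linear map sending `l j` to `a j` respects products of forms. -/
theorem constr_mul_eq {r : ℕ}
    {l : Module.Basis (Fin (r + 1)) k (MvPolynomial.homogeneousSubmodule (Fin 2) k r)}
    {a : Fin (r + 1) → R}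
    (h : ∀ (d : ℕ) (F : MvPolynomial (Fin (r + 1)) k), F.IsHomogeneous d →
      MvPolynomial.aeval (fun j => (l j : MvPolynomial (Fin 2) k)) F = 0 →
      MvPolynomial.aeval a F = 0)
    {ι : Type*} {s s' : Finset ι} (hs : s.card = s'.card)
    {f : ι → MvPolynomial.homogeneousSubmodule (Fin 2) k r}
    (hf : ∏ i ∈ s, (f i : MvPolynomial (Fin 2) k) = ∏ i ∈ s', (f i : MvPolynomial (Fin 2) k)) :
    ∏ i ∈ s, l.constr k a (f i) = ∏ i ∈ s', l.constr k a (f i) := by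
  let L : ι → MvPolynomial (Fin (r + 1)) k := fun i =>
    ∑ j, MvPolynomial.C (l.repr (f i) j) * MvPolynomial.X j
  have hL : ∀ i, (L i).IsHomogeneous 1 := fun i => MvPolynomial.IsHomogeneous.sum _ _ _ fun j _ => by
    simpa using (MvPolynomial.isHomogeneous_C (Fin (r + 1)) (l.repr (f i) j)).mul
      (MvPolynomial.isHomogeneous_X k j)
  have hLl : ∀ i, MvPolynomial.aeval (fun j => (l j : MvPolynomial (Fin 2) k)) (L i) = f i := by
    intro i
    have h1 := congrArg Subtype.val (l.sum_repr (f i))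
    rw [Submodule.coe_sum] at h1
    rw [← h1, map_sum]
    simp only [map_mul, MvPolynomial.algHom_C, MvPolynomial.aeval_X, ← Algebra.smul_def,
      Submodule.coe_smul]
  have hLa : ∀ i, MvPolynomial.aeval a (L i) = l.constr k a (f i) := by
    intro i
    rw [Module.Basis.constr_apply_fintype, map_sum]
    simp only [map_mul, MvPolynomial.algHom_C, MvPolynomial.aeval_X, ← Algebra.smul_def,
      Module.Basis.equivFun_apply]
  have hprod : ∀ t : Finset ι, (∏ i ∈ t, L i).IsHomogeneous t.card := fun t => by
    have := MvPolynomial.IsHomogeneous.prod t L (fun _ => 1) fun i _ => hL i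
    simpa using this
  have h0 := h s.card (∏ i ∈ s, L i - ∏ i ∈ s', L i) ((hprod s).sub (hs ▸ hprod s')) (by
    rw [map_sub, map_prod, map_prod]
    simp only [hLl]
    rw [hf, sub_self])
  rw [map_sub, map_prod, map_prod, sub_eq_zero] at h0
  simpa only [hLa] using h0

/-- The monomial `X i ^ e * X j ^ e'`, with `e + e' = r`, as a form of degree `r`. -/
noncomputable def binaryMonomial (k : Type*) [Field k] (i j : Fin 2) {r e e' : ℕ}
    (he : e + e' = r) : MvPolynomial.homogeneousSubmodule (Fin 2) k r :=
  ⟨MvPolynomial.X i ^ e * MvPolynomial.X j ^ e', by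
    rw [MvPolynomial.mem_homogeneousSubmodule, ← he]
    exact (MvPolynomial.isHomogeneous_X_pow i e).mul (MvPolynomial.isHomogeneous_X_pow j e')⟩

theorem map_mem_of_binaryMonomial {M : Type*} [AddCommGroup M] [Module k M] {r : ℕ}
    (Θ : MvPolynomial.homogeneousSubmodule (Fin 2) k r →ₗ[k] M) (N : Submodule k M) {i j : Fin 2}
    (hij : i ≠ j) (h : ∀ (e e' : ℕ) (he : e + e' = r), Θ (binaryMonomial k i j he) ∈ N)
    (f : MvPolynomial.homogeneousSubmodule (Fin 2) k r) : Θ f ∈ N := by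
  obtain ⟨F, hF⟩ := f
  have huniv : (Finset.univ : Finset (Fin 2)) = {i, j} := by
    ext x
    fin_cases i <;> fin_cases j <;> fin_cases x <;> simp_all
  have hdeg : ∀ m ∈ F.support, m i + m j = r := by
    intro m hm
    have := hF (MvPolynomial.mem_support_iff.1 hm)
    rw [← this]
    change _ = Finsupp.weight (fun _ => 1) m
    rw [← Finsupp.degree_eq_weight_one, Finsupp.degree_eq_sum, huniv, Finset.sum_pair hij]
  have hsum : (⟨F, hF⟩ : MvPolynomial.homogeneousSubmodule (Fin 2) k r) =
      ∑ m ∈ F.support.attach, F.coeff m • binaryMonomial k i j (hdeg m m.2) := by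
    apply Subtype.ext
    rw [AddSubmonoidClass.coe_finsetSum]
    change F = _
    conv_lhs => rw [F.as_sum]
    rw [← Finset.sum_attach]
    refine Finset.sum_congr rfl fun m _ => ?_
    rw [MvPolynomial.monomial_eq, Finsupp.prod_fintype _ _ (fun _ => pow_zero _), huniv,
      Finset.prod_pair hij, ← MvPolynomial.smul_eq_C_mul]
    rfl
  rw [hsum, map_sum]
  exact Submodule.sum_mem _ fun m _ => by
    rw [map_smul]
    exact N.smul_mem _ (h _ _ _)

/-- A finite local algebra generated by the values `a j` of a basis of the binary forms of degree
`r` is generated by one element, the value of `Y / X` or of `X / Y`. -/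
theorem injective_of_rationalNormalCurve [IsLocalRing R] [Module.Finite k R] {r : ℕ}
    {l : Module.Basis (Fin (r + 1)) k (MvPolynomial.homogeneousSubmodule (Fin 2) k r)}
    {a : Fin (r + 1) → R}
    (h : ∀ (d : ℕ) (F : MvPolynomial (Fin (r + 1)) k), F.IsHomogeneous d →
      MvPolynomial.aeval (fun j => (l j : MvPolynomial (Fin 2) k)) F = 0 →
      MvPolynomial.aeval a F = 0)
    {i₀ : Fin (r + 1)} (ha : a i₀ = 1) (hgen : Algebra.adjoin k (Set.range a) = ⊤) :
    Module.Injective R R := by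
  set Θ := l.constr k a
  have hΘl : ∀ j, Θ (l j) = a j := fun j => l.constr_basis k a j
  have hmul : ∀ f g f' g' : MvPolynomial.homogeneousSubmodule (Fin 2) k r,
      (f : MvPolynomial (Fin 2) k) * g = f' * g' → Θ f * Θ g = Θ f' * Θ g' := by
    intro f g f' g' hfg
    have := constr_mul_eq h (s := {0, 1}) (s' := {2, 3}) (f := ![f, g, f', g']) (by simp)
      (by simpa [Finset.prod_pair] using hfg)
    rw [Finset.prod_pair (by decide), Finset.prod_pair (by decide)] at this
    exact this
  -- One of the two pure powers has an invertible value.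
  obtain ⟨i, j, hij, hunit⟩ : ∃ i j : Fin 2, i ≠ j ∧
      IsUnit (Θ (binaryMonomial k i j (Nat.add_zero r))) := by
    by_contra! hno
    have h0 : ∀ (e e' : ℕ) (he : e + e' = r),
        Θ (binaryMonomial k 0 1 he) ∈ (IsLocalRing.maximalIdeal R).restrictScalars k := by
      intro e e' he
      induction e' generalizing e with
      | zero =>
        obtain rfl : e = r := he
        exact hno 0 1 zero_ne_one
      | succ e' ih =>
        rcases Nat.eq_zero_or_pos e with rfl | hpos
        · have : binaryMonomial k 0 1 he = binaryMonomial k 1 0 (Nat.add_zero r) := by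
            apply Subtype.ext
            change MvPolynomial.X 0 ^ 0 * MvPolynomial.X 1 ^ (e' + 1) =
              MvPolynomial.X 1 ^ r * MvPolynomial.X 0 ^ 0
            rw [← he, zero_add]
            ring
          rw [this]
          exact hno 1 0 one_ne_zero
        · obtain ⟨e, rfl⟩ := Nat.exists_eq_add_of_le' hpos
          have h1 := hmul (binaryMonomial k 0 1 he) (binaryMonomial k 0 1 he)
            (binaryMonomial k 0 1 (show e + 2 + e' = r by omega))
            (binaryMonomial k 0 1 (show e + (e' + 2) = r by omega)) (by
              change (_ ^ (e + 1) * _ ^ (e' + 1)) * (_ ^ (e + 1) * _ ^ (e' + 1)) =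
                (_ ^ (e + 2) * _ ^ e') * (_ ^ e * _ ^ (e' + 2))
              ring)
          have h2 : Θ (binaryMonomial k 0 1 he) * Θ (binaryMonomial k 0 1 he) ∈
              IsLocalRing.maximalIdeal R := by
            rw [h1]
            exact Ideal.mul_mem_right _ _ (ih _ _)
          exact ((IsLocalRing.maximalIdeal.isMaximal R).isPrime.mem_or_mem h2).elim id id
    have h1 := map_mem_of_binaryMonomial Θ _ zero_ne_one h0 (l i₀)
    rw [hΘl, ha] at h1
    exact (Ideal.ne_top_iff_one _).1 (IsLocalRing.maximalIdeal.isMaximal R).ne_top h1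
  set c := Θ (binaryMonomial k i j (Nat.add_zero r)) with hc
  obtain ⟨u, hu⟩ : ∃ u : R, ∀ (e e' : ℕ) (he : e + e' = r),
      Θ (binaryMonomial k i j he) = u ^ e' * c := by
    rcases Nat.eq_zero_or_pos r with rfl | hr
    · refine ⟨0, fun e e' he => ?_⟩
      obtain ⟨rfl, rfl⟩ := Nat.add_eq_zero_iff.1 he
      rw [pow_zero, one_mul]
    · obtain ⟨c', hc'⟩ := hunit.exists_left_inv
      refine ⟨Θ (binaryMonomial k i j (Nat.sub_add_cancel hr)) * c', fun e e' he => ?_⟩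
      induction e' generalizing e with
      | zero =>
        obtain rfl : e = r := he
        rw [pow_zero, one_mul]
      | succ e' ih =>
        have h1 := hmul (binaryMonomial k i j he) (binaryMonomial k i j (Nat.add_zero r))
          (binaryMonomial k i j (show e + 1 + e' = r by omega))
          (binaryMonomial k i j (Nat.sub_add_cancel hr)) (by
            change (_ ^ e * _ ^ (e' + 1)) * (_ ^ r * _ ^ 0) =
              (_ ^ (e + 1) * _ ^ e') * (_ ^ (r - 1) * _ ^ 1)
            have : (MvPolynomial.X i : MvPolynomial (Fin 2) k) ^ r =
              MvPolynomial.X i ^ (r - 1) * MvPolynomial.X i := by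
                rw [← pow_succ, Nat.sub_add_cancel hr]
            rw [this]
            ring)
        rw [ih, ← hc] at h1
        linear_combination c' * h1 - Θ (binaryMonomial k i j he) * hc'
  -- All values of forms lie in `k[u] c`, so `R = k[u]`.
  let φ : Polynomial k →ₐ[k] R := Polynomial.aeval u
  have hval : ∀ f, ∃ q, Θ f = φ q * c := by
    intro f
    have := map_mem_of_binaryMonomial Θ
      ((LinearMap.range φ.toLinearMap).map (LinearMap.mulRight k c)) hij (fun e e' he => by
        refine ⟨u ^ e', ⟨Polynomial.X ^ e', ?_⟩, (hu e e' he).symm⟩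
        change φ (Polynomial.X ^ e') = _
        rw [map_pow, Polynomial.aeval_X]) f
    obtain ⟨_, ⟨q, rfl⟩, hq⟩ := this
    exact ⟨q, hq.symm⟩
  obtain ⟨q₀, hq₀⟩ := hval (l i₀)
  rw [hΘl, ha] at hq₀
  have hsub : ∃ q, φ q = c := by
    -- `c` is the inverse of `φ q₀`, and `φ q₀` is integral.
    have hmap : Function.Surjective
        (LinearMap.mulLeft k (⟨φ q₀, ⟨q₀, rfl⟩⟩ : φ.range)) := by
      refine LinearMap.injective_iff_surjective.1 fun x y hxy => Subtype.ext ?_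
      have h1 : φ q₀ * (x : R) = φ q₀ * (y : R) := congrArg Subtype.val hxy
      linear_combination c * h1 + ((x : R) - y) * hq₀
    obtain ⟨⟨_, q, rfl⟩, hq⟩ := hmap 1
    have h1 : φ q₀ * φ q = 1 := congrArg Subtype.val hq
    refine ⟨q, ?_⟩
    linear_combination c * h1 + φ q * hq₀
  have hsurj : Function.Surjective φ := by
    rw [← AlgHom.range_eq_top, eq_top_iff, ← hgen, Algebra.adjoin_le_iff]
    rintro _ ⟨j', rfl⟩
    obtain ⟨q, hq⟩ := hval (l j')
    obtain ⟨q', hq'⟩ := hsub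
    exact ⟨q * q', by
      change φ (q * q') = _
      rw [map_mul, hq', ← hq, hΘl]⟩
  refine injective_of_surjective_of_isPrincipalIdealRing φ.toRingHom hsurj fun hker => ?_
  have hinj : Function.Injective φ.toLinearMap := (RingHom.injective_iff_ker_eq_bot φ.toRingHom).2 hker
  have := Module.Finite.of_injective φ.toLinearMap hinj
  exact Polynomial.not_finite this

end RationalNormalCurve

/-! ### Complements of subspaces in general position -/

/-- An ideal of dimension complementary to that of `W` is a complement of `W`. -/
theorem InGeneralPosition.exists_isCompl {K A : Type*} [Field K] [CommRing A] [Algebra K A]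
    [Module.Finite K A] {W : Submodule K A} (hW : InGeneralPosition W)
    (hres : ∀ m : Ideal A, m.IsMaximal → Function.Surjective (algebraMap K (A ⧸ m))) :
    ∃ J : Ideal A, IsCompl W (J.restrictScalars K) := by
  obtain ⟨J, -, -, hJ⟩ := exists_ideal_between hres (bot_le : (⊥ : Ideal A) ≤ ⊤)
    (d := Module.finrank K A - Module.finrank K W)
    (by rw [Submodule.restrictScalars_bot, finrank_bot]; exact Nat.zero_le _)
    (by rw [Submodule.restrictScalars_top, finrank_top]; exact Nat.sub_le _ _)
  refine ⟨J, ?_⟩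
  have hle := Submodule.finrank_le W
  have hd := Submodule.finrank_sup_add_finrank_inf_eq W (J.restrictScalars K)
  rcases hW J with h | h
  · rw [h, finrank_bot] at hd
    exact ⟨disjoint_iff.2 h, codisjoint_iff.2 (Submodule.eq_top_of_finrank_eq (by omega))⟩
  · rw [h, finrank_top] at hd
    exact ⟨disjoint_iff.2 (Submodule.finrank_eq_zero.1 (by omega)), codisjoint_iff.2 h⟩

theorem InGeneralPosition.map {K A B : Type*} [Field K] [CommRing A] [Algebra K A] [CommRing B]
    [Algebra K B] {W : Submodule K A} (hW : InGeneralPosition W) (f : A →ₐ[K] B)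
    (hf : Function.Surjective f) : InGeneralPosition (W.map f.toLinearMap) := by
  intro J
  rcases hW (J.comap f) with h | h
  · left
    rw [eq_bot_iff]
    rintro _ ⟨⟨w, hw, rfl⟩, hJ⟩
    have : w ∈ W ⊓ (J.comap f).restrictScalars K := ⟨hw, hJ⟩
    rw [h, Submodule.mem_bot] at this
    rw [this]
    exact (Submodule.mem_bot K).2 (map_zero _)
  · right
    rw [eq_top_iff]
    rintro b -
    obtain ⟨a, rfl⟩ := hf b
    obtain ⟨w, hw, x, hx, rfl⟩ := Submodule.mem_sup.1 (h ▸ Submodule.mem_top : a ∈ _)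
    rw [map_add]
    exact Submodule.add_mem_sup ⟨w, hw, rfl⟩ hx

/-! ### Base change of projective space along a field extension -/

section DehomogenizedForms

variable {k : Type u} [Field k] {r : ℕ}

/-- The `k`-algebra structure of the ring of degree zero elements of `k[x₀, …, x_r][1 / s]`. -/
noncomputable def awayScalar (s : MvPolynomial (Fin (r + 1)) k) :
    k →+* HomogeneousLocalization.Away (forms k r) s :=
  (HomogeneousLocalization.fromZeroRingHom (forms k r) _).comp (algebraMap k (forms k r 0))

theorem val_awayScalar (s : MvPolynomial (Fin (r + 1)) k) (c : k) :
    (awayScalar s c).val =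
      algebraMap (MvPolynomial (Fin (r + 1)) k) (Localization.Away s) (MvPolynomial.C c) :=
  Localization.mk_one_eq_algebraMap _

theorem aeval_X_eq_zero_of_dehomogenization {d : ℕ} {F : MvPolynomial (Fin (r + 1)) k}
    (hF : F.IsHomogeneous d) (i : Fin (r + 1))
    (h : MvPolynomial.aeval (fun j =>
      (if j = i then 1 else MvPolynomial.X j : MvPolynomial (Fin (r + 1)) k)) F = 0) : F = 0 := by
  let Q := FractionRing (MvPolynomial (Fin (r + 1)) k)
  let ξ : Fin (r + 1) → Q := fun j =>
    algebraMap (MvPolynomial (Fin (r + 1)) k) Q (MvPolynomial.X j)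
  have hinj : Function.Injective (algebraMap (MvPolynomial (Fin (r + 1)) k) Q) :=
    IsFractionRing.injective _ _
  have hξ : ξ i ≠ 0 := fun h0 => MvPolynomial.X_ne_zero i (hinj (h0.trans (map_zero _).symm))
  -- Substituting `x_j / x_i` for `x_j` turns `F(x_i = 1)` into `F(x / x_i) = F / x_i ^ d`.
  have h1 : MvPolynomial.aeval (fun j => (ξ i)⁻¹ * ξ j) F = 0 := by
    have h2 := congrArg (MvPolynomial.aeval fun j => (ξ i)⁻¹ * ξ j) h
    rw [map_zero, ← AlgHom.comp_apply, MvPolynomial.comp_aeval] at h2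
    rw [← h2]
    congr 2
    funext j
    split_ifs with hj
    · rw [hj, map_one, inv_mul_cancel₀ hξ]
    · rw [MvPolynomial.aeval_X]
  rw [aeval_smul_of_isHomogeneous (ξ i)⁻¹ ξ hF] at h1
  have h3 : MvPolynomial.aeval ξ F = algebraMap _ Q F := by
    have := MvPolynomial.aeval_algebraMap_apply (R := k) Q
      (MvPolynomial.X : Fin (r + 1) → MvPolynomial (Fin (r + 1)) k) F
    rwa [MvPolynomial.aeval_X_left_apply] at this
  rw [h3] at h1
  refine hinj ((mul_eq_zero.1 h1).resolve_left (pow_ne_zero _ (inv_ne_zero hξ)) |>.trans ?_)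
  rw [map_zero]

/-- Setting `x_i = 1` in the quotients `F / x_i ^ d`. -/
noncomputable def dehomogenize {i : Fin (r + 1)} {s : MvPolynomial (Fin (r + 1)) k}
    (hs : s = MvPolynomial.X i) :
    HomogeneousLocalization.Away (forms k r) s →+* MvPolynomial (Fin (r + 1)) k :=
  (IsLocalization.Away.lift (S := Localization.Away s) s
    (g := (MvPolynomial.aeval (fun j =>
      (if j = i then 1 else MvPolynomial.X j : MvPolynomial (Fin (r + 1)) k))).toRingHom) (by
        rw [hs]
        simp)).comp (algebraMap _ _)

theorem dehomogenize_mk {i : Fin (r + 1)} {s : MvPolynomial (Fin (r + 1)) k}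
    (hs : s = MvPolynomial.X i) (hs1 : s ∈ forms k r 1) (n : ℕ)
    (F : MvPolynomial (Fin (r + 1)) k) (hF : F ∈ forms k r (n • 1)) :
    dehomogenize hs (HomogeneousLocalization.Away.mk (forms k r) hs1 n F hF) =
      MvPolynomial.aeval (fun j => if j = i then 1 else MvPolynomial.X j) F := by
  rw [dehomogenize, RingHom.comp_apply, HomogeneousLocalization.algebraMap_apply,
    HomogeneousLocalization.Away.val_mk, Localization.mk_eq_mk']
  refine (IsLocalization.lift_mk'_spec _ _ _ _).2 ?_
  subst hs
  simp

theorem dehomogenize_injective {i : Fin (r + 1)} {s : MvPolynomial (Fin (r + 1)) k}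
    (hs : s = MvPolynomial.X i) : Function.Injective (dehomogenize hs) := by
  rw [injective_iff_map_eq_zero]
  intro x hx
  have hs1 : s ∈ forms k r 1 := hs ▸ X_mem_forms i
  obtain ⟨n, F, hF, rfl⟩ := HomogeneousLocalization.Away.mk_surjective _ hs1 x
  rw [dehomogenize_mk] at hx
  have := aeval_X_eq_zero_of_dehomogenization hF i hx
  subst this
  apply HomogeneousLocalization.val_injective
  rw [HomogeneousLocalization.Away.val_mk, HomogeneousLocalization.val_zero]
  exact Localization.mk_zero _

theorem dehomogenize_awayScalar {i : Fin (r + 1)} {s : MvPolynomial (Fin (r + 1)) k}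
    (hs : s = MvPolynomial.X i) (c : k) : dehomogenize hs (awayScalar s c) = MvPolynomial.C c := by
  rw [dehomogenize, RingHom.comp_apply, HomogeneousLocalization.algebraMap_apply, val_awayScalar,
    IsLocalization.Away.lift_eq]
  exact MvPolynomial.algHom_C _ _

end DehomogenizedForms

section BaseChange

variable (k K : Type u) [Field k] [Field K] [Algebra k K] (r : ℕ)

theorem extendScalars_X (i : Fin (r + 1)) :
    extendScalars k K r (MvPolynomial.X i) = MvPolynomial.X i :=
  MvPolynomial.map_X _ _

theorem map_awayScalar (i : Fin (r + 1)) (c : k) :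
    HomogeneousLocalization.Away.map (extendScalars k K r) (MvPolynomial.X i)
      (awayScalar (MvPolynomial.X i) c) = awayScalar _ (algebraMap k K c) := by
  apply dehomogenize_injective (extendScalars_X k K r i)
  rw [dehomogenize_awayScalar]
  have h1 : awayScalar (MvPolynomial.X i) c =
      HomogeneousLocalization.Away.mk (forms k r) (X_mem_forms i) 0 (MvPolynomial.C c)
        (by simp) := by
    apply HomogeneousLocalization.val_injective
    rw [val_awayScalar, HomogeneousLocalization.Away.val_mk, ← Localization.mk_one_eq_algebraMap]
    congr 1
  rw [h1, HomogeneousLocalization.Away.map_mk, dehomogenize_mk]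
  change MvPolynomial.aeval _ (MvPolynomial.map (algebraMap k K) (MvPolynomial.C c)) = _
  rw [MvPolynomial.map_C]
  exact MvPolynomial.algHom_C _ _

theorem dehomogenize_map (i : Fin (r + 1))
    (x : HomogeneousLocalization.Away (forms k r) (MvPolynomial.X i)) :
    dehomogenize (extendScalars_X k K r i)
      (HomogeneousLocalization.Away.map (extendScalars k K r) (MvPolynomial.X i) x) =
      MvPolynomial.map (algebraMap k K) (dehomogenize rfl x) := by
  obtain ⟨n, F, hF, rfl⟩ := HomogeneousLocalization.Away.mk_surjective _ (X_mem_forms i) x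
  rw [HomogeneousLocalization.Away.map_mk, dehomogenize_mk, dehomogenize_mk]
  change MvPolynomial.aeval _ (MvPolynomial.map (algebraMap k K) F) = _
  clear hF
  induction F using MvPolynomial.induction_on with
  | C c => simp
  | add p q hp hq => rw [map_add, map_add, map_add, map_add, hp, hq]
  | mul_X p j hp =>
    rw [map_mul, map_mul, map_mul, map_mul, hp, MvPolynomial.map_X, MvPolynomial.aeval_X,
      MvPolynomial.aeval_X]
    split_ifs
    · rw [map_one]
    · rw [MvPolynomial.map_X]

/-- A criterion for a square of rings to be a pushout: `D` and `E` embed compatibly into polynomial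
rings over `k` and `K`, and `E` is spanned over `K` by the image of `D`. -/
theorem isPushout_of_injective {k K D E : Type u} [Field k] [Field K] [Algebra k K] [CommRing D]
    [CommRing E] {σ : Type*} {f : k →+* D} {f' : D →+* E} {g' : K →+* E}
    (hcomm : ∀ c, f' (f c) = g' (algebraMap k K c))
    {e : D →+* MvPolynomial σ k} {e' : E →+* MvPolynomial σ K}
    (he : Function.Injective e)
    (hef : ∀ c, e (f c) = MvPolynomial.C c) (heg : ∀ c, e' (g' c) = MvPolynomial.C c)
    (hee : ∀ x, e' (f' x) = MvPolynomial.map (algebraMap k K) (e x))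
    (hspan : ∀ y, y ∈ AddSubmonoid.closure {z | ∃ c x, z = g' c * f' x}) :
    IsPushout (CommRingCat.ofHom f) (CommRingCat.ofHom (algebraMap k K)) (CommRingCat.ofHom f')
      (CommRingCat.ofHom g') := by
  let : Algebra k D := f.toAlgebra
  let : Algebra K E := g'.toAlgebra
  let : Algebra D E := f'.toAlgebra
  let : Algebra k E := (g'.comp (algebraMap k K)).toAlgebra
  have : IsScalarTower k K E := IsScalarTower.of_algebraMap_eq' rfl
  have : IsScalarTower k D E := IsScalarTower.of_algebraMap_eq fun c => (hcomm c).symm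
  let ε : D →ₐ[k] MvPolynomial σ k := { e with commutes' := hef }
  let ψ : K ⊗[k] D →ₐ[K] E := Algebra.TensorProduct.lift (Algebra.ofId K E)
    (IsScalarTower.toAlgHom k D E) fun _ _ => Commute.all _ _
  have hψt : ∀ c x, ψ (c ⊗ₜ x) = g' c * f' x := fun c x => Algebra.TensorProduct.lift_tmul _ _ _ _ _
  have hψ : ∀ x, e' (ψ x) =
      MvPolynomial.algebraTensorAlgEquiv k K (LinearMap.lTensor K ε.toLinearMap x) := by
    intro x
    induction x using TensorProduct.induction_on with
    | zero => simp only [map_zero]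
    | add x y hx hy => simp only [map_add, hx, hy]
    | tmul c x =>
      rw [LinearMap.lTensor_tmul, MvPolynomial.algebraTensorAlgEquiv_tmul, hψt, map_mul, heg, hee,
        MvPolynomial.smul_eq_C_mul]
      rfl
  have hinj : Function.Injective ψ := by
    intro x y hxy
    have h1 := congrArg e' hxy
    rw [hψ, hψ] at h1
    exact Module.Flat.lTensor_preserves_injective_linearMap ε.toLinearMap
      he ((MvPolynomial.algebraTensorAlgEquiv k K).injective h1)
  have hsurj : Function.Surjective ψ := by
    intro y
    induction hspan y using AddSubmonoid.closure_induction with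
    | mem z hz =>
      obtain ⟨c, x, rfl⟩ := hz
      exact ⟨c ⊗ₜ x, hψt c x⟩
    | zero => exact ⟨0, map_zero ψ⟩
    | add z w _ _ hz hw =>
      obtain ⟨x, rfl⟩ := hz
      obtain ⟨y, rfl⟩ := hw
      exact ⟨x + y, map_add ψ x y⟩
  have : Algebra.IsPushout k K D E := by
    refine ⟨IsBaseChange.of_equiv (LinearEquiv.ofBijective ψ.toLinearMap ⟨hinj, hsurj⟩) fun x => ?_⟩
    change ψ (1 ⊗ₜ x) = _
    rw [hψt, map_one, one_mul]
    rfl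
  exact (CommRingCat.isPushout_of_isPushout k K D E).flip

/-- The degree zero part of `K[x₀, …, x_r][1 / x_i]` is the base change of that of
`k[x₀, …, x_r][1 / x_i]`. -/
theorem isPushout_away (i : Fin (r + 1)) :
    IsPushout (CommRingCat.ofHom (awayScalar (MvPolynomial.X i) :
        k →+* HomogeneousLocalization.Away (forms k r) (MvPolynomial.X i)))
      (CommRingCat.ofHom (algebraMap k K))
      (CommRingCat.ofHom
        (HomogeneousLocalization.Away.map (extendScalars k K r) (MvPolynomial.X i)))
      (CommRingCat.ofHom (awayScalar (extendScalars k K r (MvPolynomial.X i)))) := by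
  refine isPushout_of_injective (map_awayScalar k K r i) (dehomogenize_injective rfl)
    (dehomogenize_awayScalar rfl)
    (dehomogenize_awayScalar _) (dehomogenize_map k K r i) fun y => ?_
  obtain ⟨n, F, hF, rfl⟩ := HomogeneousLocalization.Away.mk_surjective _
    ((extendScalars_X k K r i).symm ▸ X_mem_forms i) y
  have hm : ∀ m ∈ F.support,
      (MvPolynomial.monomial m 1 : MvPolynomial (Fin (r + 1)) k) ∈ forms k r (n • 1) := by
    intro m hm
    refine MvPolynomial.isHomogeneous_monomial 1 ?_
    have := hF (MvPolynomial.mem_support_iff.1 hm)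
    rwa [Finsupp.degree_eq_weight_one]
  have hsum : HomogeneousLocalization.Away.mk (forms K r)
      ((extendScalars_X k K r i).symm ▸ X_mem_forms i) n F hF =
      ∑ m ∈ F.support.attach, awayScalar _ (F.coeff m) *
        HomogeneousLocalization.Away.map (extendScalars k K r) (MvPolynomial.X i)
        (HomogeneousLocalization.Away.mk (forms k r) (X_mem_forms i) n _ (hm m m.2)) := by
    apply dehomogenize_injective (extendScalars_X k K r i)
    rw [map_sum, dehomogenize_mk]
    conv_lhs => rw [F.as_sum, map_sum, ← Finset.sum_attach]
    refine Finset.sum_congr rfl fun m _ => ?_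
    rw [map_mul, HomogeneousLocalization.Away.map_mk, dehomogenize_mk, dehomogenize_awayScalar,
      ← MvPolynomial.smul_eq_C_mul, ← map_smul]
    congr 1
    change _ = _ • MvPolynomial.map (algebraMap k K) _
    rw [MvPolynomial.map_monomial, MvPolynomial.smul_monomial, map_one, smul_eq_mul, mul_one]
  rw [hsum]
  exact AddSubmonoid.sum_mem _ fun m _ => AddSubmonoid.subset_closure ⟨_, _, rfl⟩

end BaseChange

section BaseChange

theorem irrelevant_le_span_X (k : Type u) [Field k] (r : ℕ) :
    (HomogeneousIdeal.irrelevant (forms k r)).toIdeal ≤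
      Ideal.span (Set.range fun i : Fin (r + 1) => (MvPolynomial.X i : MvPolynomial _ k)) := by
  intro F hF
  have h0 : MvPolynomial.constantCoeff F = 0 := by
    rw [HomogeneousIdeal.mem_iff, HomogeneousIdeal.mem_irrelevant_iff] at hF
    have h3 : MvPolynomial.homogeneousComponent 0 F = 0 := by
      rw [← hF]
      exact (MvPolynomial.decomposition.decompose'_apply F 0).symm
    rw [MvPolynomial.homogeneousComponent_zero] at h3
    exact MvPolynomial.C_eq_zero.mp h3
  rw [MvPolynomial.as_sum F]
  refine Ideal.sum_mem _ fun m hm => ?_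
  obtain ⟨i, hi⟩ := Finsupp.ne_iff.mp (fun hm0 : m = 0 =>
    MvPolynomial.mem_support_iff.mp hm (hm0 ▸ h0))
  exact Ideal.mem_of_dvd _ (MvPolynomial.X_dvd_monomial.2 (Or.inr hi)) (Ideal.subset_span ⟨i, rfl⟩)

theorem iSup_chart (k : Type u) [Field k] (r : ℕ) :
    ⨆ i : Fin (r + 1), chart k i = ⊤ :=
  Proj.iSup_basicOpen_eq_top (forms k r) _ (irrelevant_le_span_X k r)

theorem awayι_str {k : Type u} [Field k] {r : ℕ} {s : MvPolynomial (Fin (r + 1)) k} {m : ℕ}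
    (hs : s ∈ forms k r m) (hm : 0 < m) :
    Proj.awayι (forms k r) s hs hm ≫ PSpace.str k r =
      Spec.map (CommRingCat.ofHom (awayScalar s)) := by
  rw [PSpace.str, Proj.awayι_toSpecZero_assoc, ← Spec.map_comp]
  rfl

variable (k K : Type u) [Field k] [Field K] [Algebra k K] (r : ℕ)

/-- `ℙ^r_K` is the base change of `ℙ^r_k`. -/
theorem isPullback_proj :
    IsPullback (PSpace.proj k K r) (PSpace.str K r) (PSpace.str k r)
      (Spec.map (CommRingCat.ofHom (algebraMap k K))) := by
  let 𝒰 : (PSpace k r).OpenCover := (Proj.affineOpenCoverOfIrrelevantLESpan (forms k r)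
    (fun i : Fin (r + 1) => (MvPolynomial.X i : MvPolynomial _ k)) (m := fun _ => 1)
    (fun i => X_mem_forms i) (fun _ => one_pos) (irrelevant_le_span_X k r)).openCover
  refine Scheme.isPullback_of_openCover _ _ _ _ 𝒰 fun (i : Fin (r + 1)) => ?_
  have hX : extendScalars k K r (MvPolynomial.X i) ∈ forms K r 1 :=
    (extendScalars k K r).2 (X_mem_forms i)
  have h1 : IsPullback (Spec.map (CommRingCat.ofHom
      (HomogeneousLocalization.Away.map (extendScalars k K r) (MvPolynomial.X i))))
      (Proj.awayι (forms K r) _ hX one_pos)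
      (Proj.awayι (forms k r) _ (X_mem_forms i) one_pos) (PSpace.proj k K r) := by
    refine IsOpenImmersion.isPullback _ _ _ _
      (Proj.awayι_comp_map _ (irrelevant_le_map k K r) one_pos _ (X_mem_forms i)) ?_
    rw [Proj.opensRange_awayι, Proj.opensRange_awayι]
    rfl
  have h2 := isPullback_SpecMap_of_isPushout _ _ _ _ (isPushout_away k K r i)
  let e := h1.flip.isoPullback
  refine h2.of_iso e (Iso.refl _) (Iso.refl _) (Iso.refl _) ?_ ?_ ?_ ?_
  · exact (Category.comp_id _).trans h1.flip.isoPullback_hom_snd.symm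
  · rw [Iso.refl_hom, Category.comp_id, ← awayι_str hX one_pos]
    have : e.hom ≫ Limits.pullback.fst _ _ = _ := h1.flip.isoPullback_hom_fst
    rw [← this, Category.assoc]
    rfl
  · exact (Category.comp_id _).trans
      ((awayι_str (X_mem_forms i) one_pos).symm.trans (Category.id_comp _).symm)
  · simp

/-- The base change of `T ⟶ ℙ^r_k` along `ℙ^r_K ⟶ ℙ^r_k` is its base change from `k` to `K`. -/
theorem isPullback_pullback_proj {T : Scheme.{u}} (g : T ⟶ PSpace k r) :
    IsPullback (Limits.pullback.fst g (PSpace.proj k K r))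
      (Limits.pullback.snd g (PSpace.proj k K r) ≫ PSpace.str K r) (g ≫ PSpace.str k r)
      (Spec.map (CommRingCat.ofHom (algebraMap k K))) :=
  (IsPullback.of_hasPullback g (PSpace.proj k K r)).paste_vert (isPullback_proj k K r)

end BaseChange

/-! ### Values of forms in the local rings -/

section Charts

variable {k : Type u} [Field k] {r : ℕ}

/-- In `k[x₀, …, x_r][1 / x_i]`, the quotient `F / x_i ^ d` is the value of `F` at the
quotients `x_j / x_i`. -/
theorem awayFrac_eq_eval₂ {d : ℕ} (i : Fin (r + 1)) (F : forms k r d) :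
    awayFrac d i F = MvPolynomial.eval₂ (awayScalar (MvPolynomial.X i))
      (fun j => awayFrac 1 i ⟨_, X_mem_forms j⟩) F.1 := by
  apply dehomogenize_injective rfl
  rw [← MvPolynomial.coe_eval₂Hom, ← RingHom.comp_apply, MvPolynomial.comp_eval₂Hom]
  refine (dehomogenize_mk rfl (X_mem_forms i) d F.1 _).trans ?_
  rw [MvPolynomial.aeval_def]
  congr 1
  · ext c
    exact congrArg _ (dehomogenize_awayScalar rfl c).symm
  · funext j
    refine Eq.symm ((dehomogenize_mk rfl (X_mem_forms i) 1 (MvPolynomial.X j) _).trans ?_)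
    rw [MvPolynomial.aeval_X]

theorem awayFrac_self (i : Fin (r + 1)) :
    awayFrac 1 i (⟨_, X_mem_forms i⟩ : forms k r 1) = 1 := by
  apply dehomogenize_injective rfl
  refine (dehomogenize_mk rfl (X_mem_forms i) 1 (MvPolynomial.X i) _).trans ?_
  rw [MvPolynomial.aeval_X, if_pos rfl, map_one]

theorem awayMap_awayFrac (i i' : Fin (r + 1)) (l : forms k r 1) :
    HomogeneousLocalization.awayMap (forms k r) (X_mem_forms i') rfl (awayFrac 1 i l) =
      HomogeneousLocalization.awayMap (forms k r) (X_mem_forms i)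
        (mul_comm (MvPolynomial.X i) (MvPolynomial.X i')) (awayFrac 1 i' l) *
      HomogeneousLocalization.awayMap (forms k r) (X_mem_forms i')
        rfl (awayFrac 1 i ⟨_, X_mem_forms i'⟩) := by
  apply HomogeneousLocalization.val_injective
  have h (j : Fin (r + 1)) (l : forms k r 1) : awayFrac 1 j l =
    HomogeneousLocalization.Away.mk (forms k r) (X_mem_forms j) 1 l (forms_mem_smul_one l) := rfl
  rw [h, h, h, HomogeneousLocalization.val_mul, HomogeneousLocalization.awayMap_mk,
    HomogeneousLocalization.awayMap_mk, HomogeneousLocalization.awayMap_mk,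
    HomogeneousLocalization.Away.val_mk, HomogeneousLocalization.Away.val_mk,
    HomogeneousLocalization.Away.val_mk, Localization.mk_mul, Localization.mk_eq_mk_iff,
    Localization.r_iff_exists]
  refine ⟨1, ?_⟩
  simp only [Submonoid.coe_mul, Submonoid.coe_one]
  ring

theorem exists_awayFrac (i : Fin (r + 1))
    (x : HomogeneousLocalization.Away (forms k r) (MvPolynomial.X i)) :
    ∃ (d : ℕ) (F : forms k r d), awayFrac d i F = x := by
  obtain ⟨n, F, hF, rfl⟩ := HomogeneousLocalization.Away.mk_surjective _ (X_mem_forms i) x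
  exact ⟨n, ⟨F, by rwa [smul_eq_mul, mul_one] at hF⟩, rfl⟩

/-- The ring homomorphism `k →+* Γ(T, ⊤)` given by a morphism `T ⟶ Spec k`. -/
noncomputable def structureHom {T : Scheme.{u}} (s : T ⟶ Spec (.of k)) : k →+* Γ(T, ⊤) :=
  ((Scheme.ΓSpecIso (.of k)).inv ≫ s.appTop).hom

theorem structureHom_comp {T Z : Scheme.{u}} (h : Z ⟶ T) (s : T ⟶ Spec (.of k)) (c : k) :
    structureHom (h ≫ s) c = h.appTop (structureHom s c) := by
  rw [structureHom, structureHom, Scheme.Hom.comp_appTop]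
  rfl

theorem awayToSection_awayScalar {s : MvPolynomial (Fin (r + 1)) k} (hs : s ∈ forms k r 1)
    (c : k) : Proj.awayToSection (forms k r) s (awayScalar s c) =
      (PSpace k r).presheaf.map (homOfLE le_top).op (structureHom (PSpace.str k r) c) := by
  have h1 : (Proj.basicOpen (forms k r) s).ι ≫ PSpace.str k r =
      Proj.basicOpenToSpec (forms k r) s ≫ Spec.map (CommRingCat.ofHom (awayScalar s)) := by
    rw [← awayι_str hs one_pos, Proj.awayι, ← Category.assoc, ← Category.assoc,
      ← Proj.basicOpenIsoSpec_hom _ _ hs one_pos, Iso.hom_inv_id, Category.id_comp]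
  have h2 : (PSpace.str k r).appTop ≫ (Proj.basicOpen (forms k r) s).ι.appTop =
      (Spec.map (CommRingCat.ofHom (awayScalar s))).appTop ≫
        (Proj.basicOpenToSpec (forms k r) s).appTop := by
    rw [← Scheme.Hom.comp_appTop, ← Scheme.Hom.comp_appTop, h1]
  have h4 : (Proj.basicOpenToSpec (forms k r) s).appTop = _ :=
    Proj.basicOpenToSpec_app_top (forms k r) s
  rw [h4, ← Category.assoc, ← Category.assoc, Iso.eq_comp_inv] at h2
  have h3 : (Scheme.ΓSpecIso (.of k)).inv ≫
      (Spec.map (CommRingCat.ofHom (awayScalar s))).appTop ≫ (Scheme.ΓSpecIso _).hom ≫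
        Proj.awayToSection (forms k r) s =
      CommRingCat.ofHom (awayScalar s) ≫ Proj.awayToSection (forms k r) s := by
    rw [← Scheme.ΓSpecIso_inv_naturality_assoc, Iso.inv_hom_id_assoc]
  have h5 : (Proj.basicOpen (forms k r) s).ι.appTop ≫ (Proj.basicOpen (forms k r) s).topIso.hom =
      (PSpace k r).presheaf.map (homOfLE le_top).op :=
    ((PSpace k r).presheaf.map_comp _ _).symm
  have h6 : CommRingCat.ofHom (awayScalar s) ≫ Proj.awayToSection (forms k r) s =
      (Scheme.ΓSpecIso (.of k)).inv ≫ (PSpace.str k r).appTop ≫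
        (PSpace k r).presheaf.map (homOfLE le_top).op := by
    rw [← h3, ← h5]
    simp only [Category.assoc] at h2 ⊢
    rw [h2]
  exact congrArg (fun f : CommRingCat.of k ⟶ Γ(PSpace k r, Proj.basicOpen (forms k r) s) =>
    f.hom c) h6

end Charts

section Stalks

variable {k : Type u} [Field k] {r : ℕ} {T : Scheme.{u}} (g : T ⟶ PSpace k r)

theorem germ_restrictForm_eq (p : T) (i : Fin (r + 1)) (hp : p ∈ g ⁻¹ᵁ chart k i) {d : ℕ}
    (F : forms k r d) :
    T.presheaf.germ (g ⁻¹ᵁ chart k i) p hp (restrictForm g d i F) =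
      g.stalkMap p ((PSpace k r).presheaf.germ (chart k i) (g p) hp (frac d i F)) := by
  exact (Scheme.Hom.germ_stalkMap_apply g (chart k i) p hp (frac d i F)).symm

/-- The value of a form in a local ring is obtained by substituting the values of the
coordinates. -/
theorem germ_restrictForm (p : T) (i : Fin (r + 1)) (hp : p ∈ g ⁻¹ᵁ chart k i) {d : ℕ}
    (F : forms k r d) :
    T.presheaf.germ (g ⁻¹ᵁ chart k i) p hp (restrictForm g d i F) =
      MvPolynomial.eval₂
        ((T.presheaf.germ ⊤ p trivial).hom.comp (structureHom (g ≫ PSpace.str k r)))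
        (fun j => linearFormsToStalk g p i hp ⟨_, X_mem_forms j⟩) F.1 := by
  let θ : HomogeneousLocalization.Away (forms k r) (MvPolynomial.X i) →+* T.presheaf.stalk p :=
    ((T.presheaf.germ (g ⁻¹ᵁ chart k i) p hp).hom.comp (g.app (chart k i)).hom).comp
      (Proj.awayToSection (forms k r) (MvPolynomial.X i)).hom
  change θ (awayFrac d i F) = _
  rw [awayFrac_eq_eval₂, ← MvPolynomial.coe_eval₂Hom, ← RingHom.comp_apply,
    MvPolynomial.comp_eval₂Hom]
  change MvPolynomial.eval₂ _ _ _ = _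
  congr 1
  ext c
  change T.presheaf.germ (g ⁻¹ᵁ chart k i) p hp (g.app (chart k i)
    (Proj.awayToSection (forms k r) (MvPolynomial.X i) (awayScalar (MvPolynomial.X i) c))) =
    T.presheaf.germ ⊤ p trivial (structureHom (g ≫ PSpace.str k r) c)
  rw [structureHom_comp]
  have h1 := Scheme.Hom.germ_stalkMap_apply g (chart k i) p hp
    ((PSpace k r).presheaf.map (homOfLE le_top).op (structureHom (PSpace.str k r) c))
  have h2 := Scheme.Hom.germ_stalkMap_apply g ⊤ p trivial (structureHom (PSpace.str k r) c)
  refine Eq.trans ?_ (h1.symm.trans (Eq.trans ?_ h2))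
  · exact congrArg (fun y => T.presheaf.germ (g ⁻¹ᵁ chart k i) p hp (g.app (chart k i) y))
      (awayToSection_awayScalar (X_mem_forms i) c)
  · exact congrArg _ (TopCat.Presheaf.germ_res_apply _ _ (g p) hp _)

theorem linearFormsToStalk_self (p : T) (i : Fin (r + 1)) (hp : p ∈ g ⁻¹ᵁ chart k i) :
    linearFormsToStalk g p i hp ⟨_, X_mem_forms i⟩ = 1 := by
  let θ : HomogeneousLocalization.Away (forms k r) (MvPolynomial.X i) →+* T.presheaf.stalk p :=
    ((T.presheaf.germ (g ⁻¹ᵁ chart k i) p hp).hom.comp (g.app (chart k i)).hom).comp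
      (Proj.awayToSection (forms k r) (MvPolynomial.X i)).hom
  change θ (awayFrac 1 i _) = 1
  rw [awayFrac_self, map_one]

theorem linearFormsToStalk_comp {Z : Scheme.{u}} (h : Z ⟶ T) (p : Z) (i : Fin (r + 1))
    (hp : p ∈ (h ≫ g) ⁻¹ᵁ chart k i) (l : forms k r 1) :
    linearFormsToStalk (h ≫ g) p i hp l = h.stalkMap p (linearFormsToStalk g (h p) i hp l) := by
  change (Z.presheaf.germ ((h ≫ g) ⁻¹ᵁ chart k i) p hp) (restrictForm (h ≫ g) 1 i l) =
    h.stalkMap p (T.presheaf.germ (g ⁻¹ᵁ chart k i) (h p) hp (restrictForm g 1 i l))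
  refine Eq.trans ?_ (Scheme.Hom.germ_stalkMap_apply h (g ⁻¹ᵁ chart k i) p hp _).symm
  have h1 : restrictForm (h ≫ g) 1 i l = h.app _ (restrictForm g 1 i l) :=
    congrArg (fun f => f.hom (frac 1 i l)) (Scheme.Hom.comp_app h g (chart k i))
  rw [h1]
  rfl

theorem germ_frac_mul (q : PSpace k r) (i i' : Fin (r + 1)) (hi : q ∈ chart k i)
    (hi' : q ∈ chart k i') (l : forms k r 1) :
    (PSpace k r).presheaf.germ (chart k i) q hi (frac 1 i l) =
      (PSpace k r).presheaf.germ (chart k i') q hi' (frac 1 i' l) *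
        (PSpace k r).presheaf.germ (chart k i) q hi (frac 1 i ⟨_, X_mem_forms i'⟩) := by
  have hq : q ∈ Proj.basicOpen (forms k r) (MvPolynomial.X i * MvPolynomial.X i') := by
    rw [Proj.basicOpen_mul]
    exact ⟨hi, hi'⟩
  have key : ∀ (j j' : Fin (r + 1)) (hj : q ∈ chart k j)
      (hx : (MvPolynomial.X i * MvPolynomial.X i' : MvPolynomial (Fin (r + 1)) k) =
        MvPolynomial.X j * MvPolynomial.X j') (x : forms k r 1),
      (PSpace k r).presheaf.germ (chart k j) q hj (frac 1 j x) =
        (PSpace k r).presheaf.germ _ q hq (Proj.awayToSection (forms k r) _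
          (HomogeneousLocalization.awayMap (forms k r) (X_mem_forms j') hx (awayFrac 1 j x))) := by
    intro j j' hj hx x
    have h1 := congrArg (fun f => f.hom (awayFrac 1 j x))
      (Proj.awayMap_awayToSection (forms k r) (X_mem_forms j') hx)
    refine Eq.trans ?_ (congrArg ((PSpace k r).presheaf.germ _ q hq) h1).symm
    exact (TopCat.Presheaf.germ_res_apply _ _ q hq _).symm
  rw [key i i' hi rfl, key i' i hi' (mul_comm _ _), key i i' hi rfl, awayMap_awayFrac]
  let θ : HomogeneousLocalization.Away (forms k r) (MvPolynomial.X i * MvPolynomial.X i') →+*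
      (PSpace k r).presheaf.stalk q := ((PSpace k r).presheaf.germ _ q hq).hom.comp
        (Proj.awayToSection (forms k r) _).hom
  exact map_mul θ _ _

/-- The values of the linear forms in two charts differ by an invertible factor. -/
theorem linearFormsToStalk_eq_mul (p : T) (i i' : Fin (r + 1)) (hi : p ∈ g ⁻¹ᵁ chart k i)
    (hi' : p ∈ g ⁻¹ᵁ chart k i') (l : forms k r 1) :
    linearFormsToStalk g p i hi l =
      linearFormsToStalk g p i hi ⟨_, X_mem_forms i'⟩ * linearFormsToStalk g p i' hi' l := by
  have h := fun (j : Fin (r + 1)) (hj : p ∈ g ⁻¹ᵁ chart k j) (x : forms k r 1) =>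
    germ_restrictForm_eq g p j hj x
  refine (h i hi l).trans ((congrArg (g.stalkMap p) (germ_frac_mul (g p) i i' hi hi' l)).trans ?_)
  refine (map_mul (g.stalkMap p).hom _ _).trans ((mul_comm _ _).trans ?_)
  exact congrArg₂ (· * ·) (h i hi _).symm (h i' hi' l).symm

theorem isUnit_linearFormsToStalk (p : T) (i i' : Fin (r + 1)) (hi : p ∈ g ⁻¹ᵁ chart k i)
    (hi' : p ∈ g ⁻¹ᵁ chart k i') : IsUnit (linearFormsToStalk g p i hi ⟨_, X_mem_forms i'⟩) := by
  refine IsUnit.of_mul_eq_one (linearFormsToStalk g p i' hi' ⟨_, X_mem_forms i⟩) ?_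
  rw [← linearFormsToStalk_eq_mul, linearFormsToStalk_self]

end Stalks

/-! ### Homogeneous coordinates on an affine zero-dimensional scheme -/

section Affine

variable {T : Scheme.{u}}

theorem exists_fromSpec_eq [IsAffine T] (p : T) :
    ∃ x : PrimeSpectrum Γ(T, ⊤), (isAffineOpen_top T).fromSpec x = p := by
  have h : p ∈ Set.range (isAffineOpen_top T).fromSpec := by
    rw [(isAffineOpen_top T).range_fromSpec]
    trivial
  exact h

theorem isLocalization_germ [IsAffine T] (x : PrimeSpectrum Γ(T, ⊤)) :
    let _ : Algebra Γ(T, ⊤) (T.presheaf.stalk ((isAffineOpen_top T).fromSpec x)) :=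
      (T.presheaf.germ ⊤ ((isAffineOpen_top T).fromSpec x) trivial).hom.toAlgebra
    IsLocalization.AtPrime (T.presheaf.stalk ((isAffineOpen_top T).fromSpec x)) x.asIdeal :=
  (isAffineOpen_top T).isLocalization_stalk' x trivial

/-- The ring of functions of an affine zero-dimensional scheme surjects onto the product of the
local rings. -/
theorem exists_germ_eq [IsAffine T] [IsArtinianRing Γ(T, ⊤)] (t : ∀ p : T, T.presheaf.stalk p) :
    ∃ a : Γ(T, ⊤), ∀ p : T, T.presheaf.germ ⊤ p trivial a = t p := by
  have key : ∀ x : PrimeSpectrum Γ(T, ⊤), ∃ z : Localization x.asIdeal.primeCompl,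
      ∀ a : Γ(T, ⊤), algebraMap _ _ a = z →
        T.presheaf.germ ⊤ ((isAffineOpen_top T).fromSpec x) trivial a =
          t ((isAffineOpen_top T).fromSpec x) := by
    intro x
    let : Algebra Γ(T, ⊤) (T.presheaf.stalk ((isAffineOpen_top T).fromSpec x)) :=
      (T.presheaf.germ ⊤ ((isAffineOpen_top T).fromSpec x) trivial).hom.toAlgebra
    have : IsLocalization.AtPrime (T.presheaf.stalk ((isAffineOpen_top T).fromSpec x)) x.asIdeal :=
      isLocalization_germ x
    let e : Localization x.asIdeal.primeCompl ≃ₐ[Γ(T, ⊤)]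
        T.presheaf.stalk ((isAffineOpen_top T).fromSpec x) :=
      IsLocalization.algEquiv x.asIdeal.primeCompl _ _
    refine ⟨e.symm (t _), fun a ha => ?_⟩
    rw [AlgEquiv.eq_symm_apply, AlgEquiv.commutes] at ha
    exact ha
  choose z hz using key
  obtain ⟨a, ha⟩ := PrimeSpectrum.toPiLocalization_bijective.2 z
  refine ⟨a, fun p => ?_⟩
  obtain ⟨x, rfl⟩ := exists_fromSpec_eq p
  exact hz x a (congrFun ha x)

theorem germ_surjective [IsAffine T] [IsArtinianRing Γ(T, ⊤)] (p : T) :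
    Function.Surjective (T.presheaf.germ ⊤ p trivial) := by
  classical
  intro y
  obtain ⟨a, ha⟩ := exists_germ_eq (fun q => if h : q = p then h ▸ y else 0 :
    ∀ q : T, T.presheaf.stalk q)
  refine ⟨a, (ha p).trans ?_⟩
  rw [dif_pos rfl]

theorem eq_zero_of_germ {U : T.Opens} {x : Γ(T, U)}
    (h : ∀ (p : T) (hp : p ∈ U), T.presheaf.germ U p hp x = 0) : x = 0 :=
  TopCat.Presheaf.section_ext T.sheaf U x 0 fun p hp =>
    (h p hp).trans (map_zero (T.presheaf.germ U p hp).hom).symm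

end Affine

variable {k : Type u} [Field k] {r : ℕ} {T : Scheme.{u}}

theorem exists_mem_chart (g : T ⟶ PSpace k r) (p : T) : ∃ i, p ∈ g ⁻¹ᵁ chart k i := by
  have : g p ∈ ⨆ i : Fin (r + 1), chart k i := by
    rw [iSup_chart]
    trivial
  obtain ⟨i, hi⟩ := TopologicalSpace.Opens.mem_iSup.1 this
  exact ⟨i, hi⟩

/-- The functions `a j` are homogeneous coordinates of the morphism `g`: at each point they are,
up to a common invertible factor, the values `x_j / x_i` of the coordinates. -/
def IsCoordinates (g : T ⟶ PSpace k r) (a : Fin (r + 1) → Γ(T, ⊤)) : Prop :=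
  ∀ (p : T) (i : Fin (r + 1)) (hp : p ∈ g ⁻¹ᵁ chart k i), ∃ v : (T.presheaf.stalk p)ˣ,
    ∀ j, T.presheaf.germ ⊤ p trivial (a j) = v * linearFormsToStalk g p i hp ⟨_, X_mem_forms j⟩

/-- A line bundle on an affine zero-dimensional scheme is trivial, so that homogeneous coordinates
exist. -/
theorem exists_isCoordinates [IsAffine T] [IsArtinianRing Γ(T, ⊤)] (g : T ⟶ PSpace k r) :
    ∃ a, IsCoordinates g a := by
  choose c hc using exists_mem_chart g
  choose a ha using fun j : Fin (r + 1) =>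
    exists_germ_eq fun p => linearFormsToStalk g p (c p) (hc p) ⟨_, X_mem_forms j⟩
  refine ⟨a, fun p i hp => ⟨(isUnit_linearFormsToStalk g p (c p) i (hc p) hp).unit, fun j => ?_⟩⟩
  rw [ha]
  exact linearFormsToStalk_eq_mul g p (c p) i (hc p) hp _

variable {g : T ⟶ PSpace k r} {a : Fin (r + 1) → Γ(T, ⊤)}

theorem IsCoordinates.comp (ha : IsCoordinates g a) {Z : Scheme.{u}} (h : Z ⟶ T) :
    IsCoordinates (h ≫ g) fun j => h.appTop (a j) := by
  intro p i hp
  obtain ⟨v, hv⟩ := ha (h p) i hp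
  refine ⟨Units.map (h.stalkMap p).hom.toMonoidHom v, fun j => ?_⟩
  refine (Scheme.Hom.germ_stalkMap_apply h ⊤ p trivial (a j)).symm.trans ?_
  refine (congrArg (h.stalkMap p) (hv j)).trans ((map_mul (h.stalkMap p).hom _ _).trans ?_)
  exact congrArg _ (linearFormsToStalk_comp g h p i hp _).symm

theorem IsCoordinates.germ_eval₂ (ha : IsCoordinates g a) (p : T) (i : Fin (r + 1))
    (hp : p ∈ g ⁻¹ᵁ chart k i) :
    ∃ v : (T.presheaf.stalk p)ˣ, ∀ (d : ℕ) (F : forms k r d),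
      T.presheaf.germ ⊤ p trivial
        (MvPolynomial.eval₂ (structureHom (g ≫ PSpace.str k r)) a F.1) =
      v ^ d * T.presheaf.germ (g ⁻¹ᵁ chart k i) p hp (restrictForm g d i F) := by
  obtain ⟨v, hv⟩ := ha p i hp
  refine ⟨v, fun d F => ?_⟩
  let γ := (T.presheaf.germ ⊤ p trivial).hom
  let : Algebra k (T.presheaf.stalk p) :=
    (γ.comp (structureHom (g ≫ PSpace.str k r))).toAlgebra
  have h1 : γ (MvPolynomial.eval₂ (structureHom (g ≫ PSpace.str k r)) a F.1) =
      MvPolynomial.aeval (fun j => γ (a j)) F.1 := by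
    rw [← MvPolynomial.coe_eval₂Hom, ← RingHom.comp_apply, MvPolynomial.comp_eval₂Hom]
    rfl
  have h2 : (fun j => γ (a j)) = fun j => (v : T.presheaf.stalk p) *
      linearFormsToStalk g p i hp ⟨_, X_mem_forms j⟩ := funext hv
  refine h1.trans ?_
  rw [h2, aeval_smul_of_isHomogeneous _ _ F.2, germ_restrictForm]
  rfl

/-- A form vanishes on `T` if and only if its value at homogeneous coordinates is zero. -/
theorem IsCoordinates.vanishes_iff (ha : IsCoordinates g a) {d : ℕ} (F : forms k r d) :
    Vanishes g F ↔ MvPolynomial.eval₂ (structureHom (g ≫ PSpace.str k r)) a F.1 = 0 := by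
  constructor
  · intro h
    refine eq_zero_of_germ fun p _ => ?_
    obtain ⟨i, hp⟩ := exists_mem_chart g p
    obtain ⟨v, hv⟩ := ha.germ_eval₂ p i hp
    rw [hv, h i]
    exact (congrArg _ (map_zero (T.presheaf.germ (g ⁻¹ᵁ chart k i) p hp).hom)).trans (mul_zero _)
  · intro h i
    refine eq_zero_of_germ fun p hp => ?_
    obtain ⟨v, hv⟩ := ha.germ_eval₂ p i hp
    have := hv d F
    rw [h, ← Units.val_pow_eq_pow_val] at this
    exact (Units.mul_right_eq_zero _).1
      (this.symm.trans (map_zero (T.presheaf.germ ⊤ p trivial).hom))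

theorem IsCoordinates.span_eq_top [IsAffine T] (ha : IsCoordinates g a) :
    Ideal.span (Set.range a) = ⊤ := by
  by_contra hne
  obtain ⟨m, hm, hle⟩ := Ideal.exists_le_maximal _ hne
  let x : PrimeSpectrum Γ(T, ⊤) := ⟨m, hm.isPrime⟩
  let : Algebra Γ(T, ⊤) (T.presheaf.stalk ((isAffineOpen_top T).fromSpec x)) :=
    (T.presheaf.germ ⊤ ((isAffineOpen_top T).fromSpec x) trivial).hom.toAlgebra
  have : IsLocalization.AtPrime (T.presheaf.stalk ((isAffineOpen_top T).fromSpec x)) x.asIdeal :=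
    isLocalization_germ x
  obtain ⟨i, hp⟩ := exists_mem_chart g ((isAffineOpen_top T).fromSpec x)
  obtain ⟨v, hv⟩ := ha _ i hp
  have h1 := hv i
  rw [linearFormsToStalk_self, mul_one] at h1
  have h2 : IsUnit (algebraMap Γ(T, ⊤)
    (T.presheaf.stalk ((isAffineOpen_top T).fromSpec x)) (a i)) := ⟨v, h1.symm⟩
  have h3 := (IsLocalization.AtPrime.isUnit_to_map_iff _ x.asIdeal (a i)).1 h2
  exact h3 (hle (Ideal.subset_span ⟨i, rfl⟩))

/-! ### Base change of homogeneous coordinates -/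

section BaseChange

variable {k K : Type u} [Field k] [Field K] [Algebra k K] {r : ℕ}

theorem germ_mk_X {s : MvPolynomial (Fin (r + 1)) k} {i : Fin (r + 1)}
    (hs : s = MvPolynomial.X i) (hs1 : s ∈ forms k r 1) {q : PSpace k r}
    (hq : q ∈ Proj.basicOpen (forms k r) s) (hq' : q ∈ chart k i)
    {t : MvPolynomial (Fin (r + 1)) k} {j : Fin (r + 1)} (ht : t = MvPolynomial.X j)
    (ht1 : t ∈ forms k r (1 • 1)) :
    (PSpace k r).presheaf.germ (Proj.basicOpen (forms k r) s) q hq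
      (Proj.awayToSection (forms k r) s (HomogeneousLocalization.Away.mk (forms k r) hs1 1 t ht1)) =
    (PSpace k r).presheaf.germ (chart k i) q hq' (frac 1 i ⟨_, X_mem_forms j⟩) := by
  subst hs ht
  rfl

theorem linearFormsToStalk_proj {q : PSpace K r} {i : Fin (r + 1)}
    (hq : q ∈ PSpace.proj k K r ⁻¹ᵁ chart k i) (hq' : q ∈ chart K i) (j : Fin (r + 1)) :
    linearFormsToStalk (PSpace.proj k K r) q i hq ⟨_, X_mem_forms j⟩ =
      (PSpace K r).presheaf.germ (chart K i) q hq' (frac 1 i ⟨_, X_mem_forms j⟩) := by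
  have h1 : (PSpace.proj k K r).appLE (chart k i)
      (Proj.basicOpen (forms K r) (extendScalars k K r (MvPolynomial.X i))) le_rfl
        (frac 1 i ⟨_, X_mem_forms j⟩) =
      Proj.awayToSection (forms K r) _ (HomogeneousLocalization.Away.map (extendScalars k K r)
        (MvPolynomial.X i) (awayFrac 1 i ⟨_, X_mem_forms j⟩)) :=
    congrArg (fun f : CommRingCat.of (HomogeneousLocalization.Away (forms k r) (MvPolynomial.X i)) ⟶
        Γ(PSpace K r, Proj.basicOpen (forms K r) (extendScalars k K r (MvPolynomial.X i))) =>
        f.hom (awayFrac 1 i (⟨_, X_mem_forms j⟩ : forms k r 1)))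
      (Proj.awayToSection_comp_appLE (extendScalars k K r) (irrelevant_le_map k K r)
        (X_mem_forms (k := k) i))
  have h2 : (PSpace.proj k K r).appLE (chart k i)
      (Proj.basicOpen (forms K r) (extendScalars k K r (MvPolynomial.X i))) le_rfl =
      (PSpace.proj k K r).app (chart k i) := Scheme.Hom.appLE_eq_app _
  rw [h2] at h1
  have h3 : HomogeneousLocalization.Away.map (extendScalars k K r) (MvPolynomial.X i)
      (awayFrac 1 i (⟨_, X_mem_forms j⟩ : forms k r 1)) =
      HomogeneousLocalization.Away.mk (forms K r) ((extendScalars k K r).2 (X_mem_forms i)) 1 _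
        ((extendScalars k K r).2 (forms_mem_smul_one ⟨_, X_mem_forms j⟩)) :=
    HomogeneousLocalization.Away.map_mk _ _ (X_mem_forms i) _ _ _
  rw [h3] at h1
  exact (congrArg ((PSpace K r).presheaf.germ (PSpace.proj k K r ⁻¹ᵁ chart k i) q hq) h1).trans
    (germ_mk_X (extendScalars_X k K r i) _ hq hq' (extendScalars_X k K r j) _)

variable {T : Scheme.{u}} {g : T ⟶ PSpace K r}

theorem linearFormsToStalk_comp_proj {p : T} {i : Fin (r + 1)}
    (hp : p ∈ (g ≫ PSpace.proj k K r) ⁻¹ᵁ chart k i) (hp' : p ∈ g ⁻¹ᵁ chart K i)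
    (j : Fin (r + 1)) :
    linearFormsToStalk (g ≫ PSpace.proj k K r) p i hp ⟨_, X_mem_forms j⟩ =
      linearFormsToStalk g p i hp' ⟨_, X_mem_forms j⟩ := by
  rw [linearFormsToStalk_comp]
  refine (congrArg (g.stalkMap p) (linearFormsToStalk_proj hp hp' j)).trans ?_
  exact (germ_restrictForm_eq g p i hp' _).symm

theorem preimage_chart (i : Fin (r + 1)) : PSpace.proj k K r ⁻¹ᵁ chart k i = chart K i := by
  rw [chart, PSpace.proj, Proj.map_preimage_basicOpen, extendScalars_X]
  rfl

theorem IsCoordinates.of_comp_proj {a : Fin (r + 1) → Γ(T, ⊤)}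
    (ha : IsCoordinates (g ≫ PSpace.proj k K r) a) : IsCoordinates g a := by
  intro p i hp
  have hp' : p ∈ (g ≫ PSpace.proj k K r) ⁻¹ᵁ chart k i := by
    rw [Scheme.Hom.comp_preimage, preimage_chart]
    exact hp
  obtain ⟨v, hv⟩ := ha p i hp'
  refine ⟨v, fun j => ?_⟩
  rw [← linearFormsToStalk_comp_proj hp' hp]
  exact hv j

end BaseChange

/-! ### Linearly general position of a subscheme and of its space of linear forms -/

section Position

variable {k : Type u} [Field k] {r : ℕ} {T : Scheme.{u}}

theorem degree_eq_finrank_of_ringEquiv {B : Type u} [CommRing B] [Algebra k B]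
    {s : T ⟶ Spec (.of k)} (e : Γ(T, ⊤) ≃+* B) (he : ∀ c, e (structureHom s c) = algebraMap k B c) :
    degree s = Module.finrank k B := by
  let : Algebra k Γ(T, ⊤) := (structureHom s).toAlgebra
  exact (AlgEquiv.ofRingEquiv (f := e) he).toLinearEquiv.finrank_eq

theorem finrank_forms_one (k : Type u) [Field k] (r : ℕ) :
    Module.finrank k (forms k r 1) = r + 1 := by
  rw [forms, MvPolynomial.homogeneousSubmodule_one_eq_span_X,
    finrank_span_eq_card (MvPolynomial.linearIndependent_X _ _), Fintype.card_fin]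

theorem finite_forms_one (k : Type u) [Field k] (r : ℕ) : Module.Finite k (forms k r 1) :=
  Module.finite_of_finrank_pos (by rw [finrank_forms_one]; exact Nat.succ_pos r)

/-- The evaluation of linear forms at a family of elements of an algebra. -/
noncomputable def evalLinearForms {A : Type*} [CommRing A] [Algebra k A] (a : Fin (r + 1) → A) :
    forms k r 1 →ₗ[k] A :=
  (MvPolynomial.aeval a).toLinearMap ∘ₗ (forms k r 1).subtype

theorem range_evalLinearForms {A : Type*} [CommRing A] [Algebra k A] (a : Fin (r + 1) → A) :
    LinearMap.range (evalLinearForms (k := k) a) = Submodule.span k (Set.range a) := by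
  rw [evalLinearForms, LinearMap.range_comp, Submodule.range_subtype, forms,
    MvPolynomial.homogeneousSubmodule_one_eq_span_X, Submodule.map_span, ← Set.range_comp]
  congr 2
  funext j
  exact MvPolynomial.aeval_X a j

/-- The closed subscheme of an affine scheme defined by an ideal. -/
noncomputable def quotientι [IsAffine T] (I : Ideal Γ(T, ⊤)) :
    Spec (.of (Γ(T, ⊤) ⧸ I)) ⟶ T :=
  Spec.map (CommRingCat.ofHom (Ideal.Quotient.mk I)) ≫ T.isoSpec.inv

instance [IsAffine T] (I : Ideal Γ(T, ⊤)) : IsClosedImmersion (quotientι I) :=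
  inferInstanceAs (IsClosedImmersion
    (Spec.map (CommRingCat.ofHom (Ideal.Quotient.mk I)) ≫ T.isoSpec.inv))

theorem quotientι_appTop [IsAffine T] (I : Ideal Γ(T, ⊤)) (x : Γ(T, ⊤)) :
    (Scheme.ΓSpecIso (.of (Γ(T, ⊤) ⧸ I))).hom ((quotientι I).appTop x) = Ideal.Quotient.mk I x := by
  have h : (quotientι I).appTop ≫ (Scheme.ΓSpecIso (.of (Γ(T, ⊤) ⧸ I))).hom =
      CommRingCat.ofHom (Ideal.Quotient.mk I) := by
    have h1 : T.isoSpec.inv.appTop ≫ (Scheme.ΓSpecIso Γ(T, ⊤)).hom = 𝟙 _ := by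
      have h2 : T.isoSpec.hom.appTop = (Scheme.ΓSpecIso Γ(T, ⊤)).hom := T.toSpecΓ_appTop
      rw [← h2, ← Scheme.Hom.comp_appTop, Iso.hom_inv_id]
      rfl
    rw [quotientι, Scheme.Hom.comp_appTop, Category.assoc, Scheme.ΓSpecIso_naturality]
    exact (reassoc_of% h1) _
  exact congrArg (fun f : Γ(T, ⊤) ⟶ CommRingCat.of (Γ(T, ⊤) ⧸ I) => f.hom x) h

variable [Algebra k Γ(T, ⊤)] {g : T ⟶ PSpace k r} {a : Fin (r + 1) → Γ(T, ⊤)}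

theorem IsCoordinates.vanishes_iff_aeval (ha : IsCoordinates g a)
    (halg : algebraMap k Γ(T, ⊤) = structureHom (g ≫ PSpace.str k r)) {d : ℕ} (F : forms k r d) :
    Vanishes g F ↔ MvPolynomial.aeval a F.1 = 0 := by
  rw [ha.vanishes_iff, MvPolynomial.aeval_def, halg]

theorem degree_quotientι [IsAffine T] {s : T ⟶ Spec (.of k)}
    (halg : algebraMap k Γ(T, ⊤) = structureHom s) (I : Ideal Γ(T, ⊤)) :
    degree (quotientι I ≫ s) = Module.finrank k (Γ(T, ⊤) ⧸ I) := by
  refine degree_eq_finrank_of_ringEquiv (T := Spec (.of (Γ(T, ⊤) ⧸ I)))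
    (Scheme.ΓSpecIso (.of (Γ(T, ⊤) ⧸ I))).commRingCatIsoToRingEquiv fun c => ?_
  rw [structureHom_comp, ← halg]
  exact quotientι_appTop I _

theorem vanishes_quotientι [IsAffine T] (ha : IsCoordinates g a)
    (halg : algebraMap k Γ(T, ⊤) = structureHom (g ≫ PSpace.str k r)) {I : Ideal Γ(T, ⊤)}
    {l : forms k r 1} (hl : evalLinearForms a l ∈ I) : Vanishes (quotientι I ≫ g) l := by
  rw [(ha.comp (quotientι I)).vanishes_iff]
  have h1 : MvPolynomial.eval₂ (structureHom ((quotientι I ≫ g) ≫ PSpace.str k r))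
      (fun j => (quotientι I).appTop (a j)) l.1 = (quotientι I).appTop (MvPolynomial.aeval a l.1) := by
    refine Eq.symm ((MvPolynomial.map_aeval a (quotientι I).appTop.hom l.1).trans ?_)
    rw [MvPolynomial.coe_eval₂Hom, halg]
    congr 1
  have h2 : Function.Injective (Scheme.ΓSpecIso (.of (Γ(T, ⊤) ⧸ I))).hom.hom :=
    (Scheme.ΓSpecIso (.of (Γ(T, ⊤) ⧸ I))).commRingCatIsoToRingEquiv.injective
  apply h2
  rw [h1, map_zero]
  exact (quotientι_appTop I _).trans (Ideal.Quotient.eq_zero_iff_mem.2 hl)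

/-- The rank of the evaluation of linear forms modulo an ideal, if `T` is in linearly general
position. -/
theorem LinearlyGeneralPosition.finrank_quotient_le [IsAffine T] (hg : LinearlyGeneralPosition g)
    (ha : IsCoordinates g a) (halg : algebraMap k Γ(T, ⊤) = structureHom (g ≫ PSpace.str k r))
    (I : Ideal Γ(T, ⊤)) {U : Submodule k (forms k r 1)} (hU0 : U ≠ ⊥)
    (hU : ∀ l, l ∈ U ↔ evalLinearForms a l ∈ I) :
    Module.finrank k (Γ(T, ⊤) ⧸ I) + Module.finrank k U ≤ r + 1 := by
  have := finite_forms_one k r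
  have hle := U.finrank_le
  rw [finrank_forms_one] at hle
  have hpos : 0 < Module.finrank k U := Nat.pos_of_ne_zero fun h => hU0 (Submodule.finrank_eq_zero.1 h)
  rcases hle.eq_or_lt with heq | hlt
  · -- If all linear forms vanish, the subscheme is empty.
    have hUtop : U = ⊤ := Submodule.eq_top_of_finrank_eq (by rw [heq, finrank_forms_one])
    have hI : I = ⊤ := by
      rw [eq_top_iff, ← ha.span_eq_top, Ideal.span_le]
      rintro _ ⟨j, rfl⟩
      have h1 := (hU ⟨_, X_mem_forms j⟩).1 (hUtop ▸ Submodule.mem_top)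
      have h2 : evalLinearForms a (⟨_, X_mem_forms j⟩ : forms k r 1) = a j :=
        MvPolynomial.aeval_X a j
      rwa [h2] at h1
    have : Subsingleton (Γ(T, ⊤) ⧸ I) := Ideal.Quotient.subsingleton_iff.2 hI
    rw [Module.finrank_zero_of_subsingleton, heq, zero_add]
  · have h1 := hg (r - Module.finrank k U) (by omega) U (by omega) _ (quotientι I)
      fun l hl => vanishes_quotientι ha halg ((hU l).1 hl)
    rw [degree_quotientι halg] at h1
    omega

/-- An ideal `I` defines a closed subscheme. If some linear forms vanish on it, it lies on the linear
subspace that they define, and the bound on its degree says that evaluation modulo `I` is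
surjective. -/
theorem LinearlyGeneralPosition.inGeneralPosition [IsAffine T] [Module.Finite k Γ(T, ⊤)]
    (hg : LinearlyGeneralPosition g) (ha : IsCoordinates g a)
    (halg : algebraMap k Γ(T, ⊤) = structureHom (g ≫ PSpace.str k r)) :
    InGeneralPosition (Submodule.span k (Set.range a)) := by
  intro I
  have := finite_forms_one k r
  let ψ : forms k r 1 →ₗ[k] Γ(T, ⊤) ⧸ I := (Ideal.Quotient.mkₐ k I).toLinearMap ∘ₗ evalLinearForms a
  have hψ : ∀ l, l ∈ LinearMap.ker ψ ↔ evalLinearForms a l ∈ I := fun l =>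
    Ideal.Quotient.eq_zero_iff_mem
  rw [← range_evalLinearForms]
  rcases eq_or_ne (LinearMap.ker ψ) ⊥ with h0 | h0
  · left
    rw [eq_bot_iff]
    rintro _ ⟨⟨l, rfl⟩, hl⟩
    have h1 := (hψ l).2 hl
    rw [h0, Submodule.mem_bot] at h1
    rw [h1, map_zero]
    exact zero_mem _
  · right
    have h1 := hg.finrank_quotient_le ha halg I h0 hψ
    have h2 := LinearMap.finrank_range_add_finrank_ker ψ
    rw [finrank_forms_one] at h2
    have h3 : LinearMap.range ψ = ⊤ := by
      refine Submodule.eq_top_of_finrank_eq (le_antisymm (Submodule.finrank_le _) ?_)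
      omega
    rw [eq_top_iff]
    rintro x -
    obtain ⟨l, hl⟩ : Ideal.Quotient.mk I x ∈ LinearMap.range ψ := h3 ▸ Submodule.mem_top
    refine Submodule.mem_sup.2 ⟨_, ⟨l, rfl⟩, x - evalLinearForms a l, ?_, by ring⟩
    exact Ideal.Quotient.eq.1 hl.symm

/-- A subscheme of degree at least `r + 1` in linearly general position lies in no hyperplane. -/
theorem LinearlyGeneralPosition.linearIndependent [IsAffine T] [Module.Finite k Γ(T, ⊤)]
    (hg : LinearlyGeneralPosition g) (ha : IsCoordinates g a)
    (halg : algebraMap k Γ(T, ⊤) = structureHom (g ≫ PSpace.str k r))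
    (hr : r + 1 ≤ Module.finrank k Γ(T, ⊤)) : LinearIndependent k a := by
  have := finite_forms_one k r
  have hker : LinearMap.ker (evalLinearForms (k := k) a) = ⊥ := by
    by_contra h0
    have h1 := hg.finrank_quotient_le ha halg ⊥ h0 fun l => by
      rw [LinearMap.mem_ker, Ideal.mem_bot]
    have h2 : Module.finrank k (Γ(T, ⊤) ⧸ (⊥ : Ideal Γ(T, ⊤))) = Module.finrank k Γ(T, ⊤) :=
      (AlgEquiv.quotientBot k Γ(T, ⊤)).toLinearEquiv.finrank_eq
    have h3 : 0 < Module.finrank k (LinearMap.ker (evalLinearForms (k := k) a)) :=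
      Nat.pos_of_ne_zero fun h => h0 (Submodule.finrank_eq_zero.1 h)
    omega
  rw [linearIndependent_iff_card_eq_finrank_span, Set.finrank, ← range_evalLinearForms,
    LinearMap.finrank_range_of_inj (LinearMap.ker_eq_bot.1 hker), finrank_forms_one,
    Fintype.card_fin]

end Position

/-! ### Functions on the base change -/

section BaseChange

variable {k K : Type u} [Field k] [Field K] [Algebra k K] {r : ℕ} {T : Scheme.{u}}
  (g : T ⟶ PSpace k r)

theorem isAffine_pullback_proj [IsAffine T] :
    IsAffine (Limits.pullback g (PSpace.proj k K r)) :=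
  IsAffine.of_isPullback (isPullback_pullback_proj k K r g)

theorem isPushout_structureHom [IsAffine T] :
    IsPushout (CommRingCat.ofHom (algebraMap k K))
      (CommRingCat.ofHom (structureHom (g ≫ PSpace.str k r)))
      (CommRingCat.ofHom (structureHom
        (Limits.pullback.snd g (PSpace.proj k K r) ≫ PSpace.str K r)))
      (Limits.pullback.fst g (PSpace.proj k K r)).appTop := by
  have h := (isPushout_appTop_of_isPullback (isPullback_pullback_proj k K r g)).flip
  refine h.of_iso (Scheme.ΓSpecIso (.of k)) (Scheme.ΓSpecIso (.of K)) (Iso.refl _) (Iso.refl _)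
    ?_ ?_ ?_ ?_
  · exact Scheme.ΓSpecIso_naturality _
  · rw [Iso.refl_hom, Category.comp_id]
    exact (Iso.hom_inv_id_assoc (Scheme.ΓSpecIso (.of k)) _).symm
  · rw [Iso.refl_hom, Category.comp_id]
    exact (Iso.hom_inv_id_assoc (Scheme.ΓSpecIso (.of K)) _).symm
  · rw [Iso.refl_hom, Iso.refl_hom, Category.comp_id, Category.id_comp]

variable [Algebra k Γ(T, ⊤)] [Algebra K Γ(Limits.pullback g (PSpace.proj k K r), ⊤)]

/-- The functions on the base change to `K` of an affine `k`-scheme are `K ⊗ Γ(T, ⊤)`. -/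
theorem exists_tensor_algEquiv [IsAffine T]
    (halg : algebraMap k Γ(T, ⊤) = structureHom (g ≫ PSpace.str k r))
    (halg' : algebraMap K Γ(Limits.pullback g (PSpace.proj k K r), ⊤) =
      structureHom (Limits.pullback.snd g (PSpace.proj k K r) ≫ PSpace.str K r)) :
    ∃ e : K ⊗[k] Γ(T, ⊤) ≃ₐ[K] Γ(Limits.pullback g (PSpace.proj k K r), ⊤),
      ∀ x, e (1 ⊗ₜ x) = (Limits.pullback.fst g (PSpace.proj k K r)).appTop x := by
  have h := isPushout_structureHom (K := K) g
  rw [← halg, ← halg'] at h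
  let A := Γ(T, ⊤)
  let B := Γ(Limits.pullback g (PSpace.proj k K r), ⊤)
  let : Algebra A B := (Limits.pullback.fst g (PSpace.proj k K r)).appTop.hom.toAlgebra
  let : Algebra k B := ((algebraMap K B).comp (algebraMap k K)).toAlgebra
  have : IsScalarTower k K B := IsScalarTower.of_algebraMap_eq' rfl
  have : IsScalarTower k A B := IsScalarTower.of_algebraMap_eq fun c =>
    congrArg (fun f : CommRingCat.of k ⟶ B => f.hom c) h.w
  have : Algebra.IsPushout k K A B := CommRingCat.isPushout_iff_isPushout.1 h
  refine ⟨Algebra.IsPushout.equiv k K A B, fun x => ?_⟩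
  refine (Algebra.IsPushout.equiv_tmul k K A B 1 x).trans ?_
  rw [map_one, one_mul]
  rfl

end BaseChange

theorem IsCoordinates.pullback {k K : Type u} [Field k] [Field K] [Algebra k K] {r : ℕ}
    {T : Scheme.{u}} {g : T ⟶ PSpace k r} {a : Fin (r + 1) → Γ(T, ⊤)} (ha : IsCoordinates g a) :
    IsCoordinates (Limits.pullback.snd g (PSpace.proj k K r))
      fun j => (Limits.pullback.fst g (PSpace.proj k K r)).appTop (a j) := by
  refine IsCoordinates.of_comp_proj (k := k) ?_
  rw [← Limits.pullback.condition]
  exact ha.comp _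

/-! ### Descent of general position -/

section Descent

variable {k A : Type*} [Field k] [CommRing A] [Algebra k A] (K : Type*) [Field K] [Algebra k K]

theorem InGeneralPosition.of_baseChange {ι : Type*} {a : ι → A}
    (h : InGeneralPosition (Submodule.span K (Set.range fun i => (1 : K) ⊗ₜ[k] a i))) :
    InGeneralPosition (Submodule.span k (Set.range a)) := by
  have hW : ∀ w ∈ Submodule.span k (Set.range a),
      (1 : K) ⊗ₜ[k] w ∈ Submodule.span K (Set.range fun i => (1 : K) ⊗ₜ[k] a i) := by
    intro w hw
    induction hw using Submodule.span_induction with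
    | mem x hx =>
      obtain ⟨i, rfl⟩ := hx
      exact Submodule.subset_span ⟨i, rfl⟩
    | zero => rw [TensorProduct.tmul_zero]; exact zero_mem _
    | add x y _ _ hx hy => rw [TensorProduct.tmul_add]; exact add_mem hx hy
    | smul c x _ hx =>
      rw [← TensorProduct.smul_tmul, ← algebraMap_smul K c (1 : K), ← TensorProduct.smul_tmul']
      exact Submodule.smul_mem _ _ hx
  intro I
  let Ī : Ideal (K ⊗[k] A) := I.map (Algebra.TensorProduct.includeRight : A →ₐ[k] K ⊗[k] A)
  rcases h Ī with h0 | h0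
  · left
    rw [eq_bot_iff]
    rintro w ⟨hw, hI⟩
    have h1 : (1 : K) ⊗ₜ[k] w ∈ (⊥ : Submodule K (K ⊗[k] A)) := by
      rw [← h0]
      exact ⟨hW w hw, Ideal.mem_map_of_mem Algebra.TensorProduct.includeRight hI⟩
    have hinj : Function.Injective (Algebra.TensorProduct.includeRight : A →ₐ[k] K ⊗[k] A) :=
      Algebra.TensorProduct.includeRight_injective (algebraMap k K).injective
    exact (Submodule.mem_bot k).2 (hinj (((Submodule.mem_bot K).1 h1).trans (map_zero _).symm))
  · right
    by_contra hne
    -- A functional that vanishes on `W ⊔ I` but is not zero.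
    obtain ⟨lam, hlam0, hlam⟩ := Submodule.exists_le_ker_of_lt_top _ (lt_top_iff_ne_top.2 hne)
    refine hlam0 (LinearMap.ext fun x => ?_)
    have hker : Submodule.span K (Set.range fun i => (1 : K) ⊗ₜ[k] a i) ⊔ Ī.restrictScalars K ≤
        LinearMap.ker (functionalBaseChange K lam) := by
      refine sup_le (Submodule.span_le.2 ?_) fun z hz => ?_
      · rintro _ ⟨i, rfl⟩
        have : lam (a i) = 0 := hlam (Submodule.mem_sup_left (Submodule.subset_span ⟨i, rfl⟩))
        rw [SetLike.mem_coe, LinearMap.mem_ker, functionalBaseChange_tmul, this, zero_smul]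
      · suffices ∀ t : K ⊗[k] A, functionalBaseChange K lam (t * z) = 0 by
          simpa using this 1
        replace hz : z ∈ Ī := hz
        induction hz using Submodule.span_induction with
        | mem x hx =>
          obtain ⟨y, hy, rfl⟩ := hx
          intro t
          induction t using TensorProduct.induction_on with
          | zero => rw [zero_mul, map_zero]
          | add t t' ht ht' => rw [add_mul, map_add, ht, ht', add_zero]
          | tmul c b =>
            have h1 : lam (b * y) = 0 := hlam (Submodule.mem_sup_right (I.mul_mem_left b hy))
            change functionalBaseChange K lam (c ⊗ₜ b * 1 ⊗ₜ y) = 0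
            rw [Algebra.TensorProduct.tmul_mul_tmul, functionalBaseChange_tmul, h1, zero_smul]
        | zero => intro t; rw [mul_zero, map_zero]
        | add x y _ _ hx hy => intro t; rw [mul_add, map_add, hx, hy, add_zero]
        | smul s x _ hx => intro t; rw [smul_eq_mul, ← mul_assoc]; exact hx _
    have h1 : (1 : K) ⊗ₜ[k] x ∈ LinearMap.ker (functionalBaseChange K lam) :=
      hker (h0 ▸ Submodule.mem_top)
    rw [LinearMap.mem_ker, functionalBaseChange_tmul, Algebra.smul_def, mul_one] at h1
    exact (algebraMap k K).injective (h1.trans (map_zero _).symm)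

end Descent

/-! ### Local rings of a subscheme of projective space -/

section Local

variable {k : Type u} [Field k] {r : ℕ} {T : Scheme.{u}} {g : T ⟶ PSpace k r}

/-- The values of the linear forms at `p` are, up to an invertible factor, the image of a subspace in
general position, which is itself in general position and so has an ideal as a complement. -/
theorem isUnramifiedAt_of_inGeneralPosition [IsAffine T] [Algebra k Γ(T, ⊤)]
    [Module.Finite k Γ(T, ⊤)] {a : Fin (r + 1) → Γ(T, ⊤)} (ha : IsCoordinates g a)
    (hGP : InGeneralPosition (Submodule.span k (Set.range a))) (p : T)
    (hres : ∀ m : Ideal (T.presheaf.stalk p), m.IsMaximal → Function.Surjective fun c : k =>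
      Ideal.Quotient.mk m (T.presheaf.germ ⊤ p trivial (algebraMap k Γ(T, ⊤) c)))
    (halg : algebraMap k Γ(T, ⊤) = structureHom (g ≫ PSpace.str k r)) :
    IsUnramifiedAt g p := by
  have : IsArtinianRing Γ(T, ⊤) := IsArtinianRing.of_finite k _
  let γ := (T.presheaf.germ ⊤ p trivial).hom
  let : Algebra k (T.presheaf.stalk p) := (γ.comp (algebraMap k Γ(T, ⊤))).toAlgebra
  let f : Γ(T, ⊤) →ₐ[k] T.presheaf.stalk p := { γ with commutes' := fun _ => rfl }
  have hf : Function.Surjective f := germ_surjective p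
  have : Module.Finite k (T.presheaf.stalk p) := Module.Finite.of_surjective f.toLinearMap hf
  obtain ⟨J, hJ⟩ := (hGP.map f hf).exists_isCompl hres
  intro i hp
  obtain ⟨v, hv⟩ := ha.germ_eval₂ p i hp
  have hW : ∀ l : forms k r 1, f (evalLinearForms a l) = v * linearFormsToStalk g p i hp l := by
    intro l
    have h1 := hv 1 l
    rw [pow_one, ← halg] at h1
    exact h1
  rw [← range_evalLinearForms] at hJ
  refine ⟨J, disjoint_iff.2 (eq_bot_iff.2 ?_), codisjoint_iff.2 (eq_top_iff.2 ?_)⟩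
  · rintro _ ⟨⟨l, rfl⟩, hl⟩
    have h1 : v * linearFormsToStalk g p i hp l ∈
        ((LinearMap.range (evalLinearForms (k := k) a)).map f.toLinearMap) ⊓ J.restrictScalars k :=
      ⟨⟨_, ⟨l, rfl⟩, hW l⟩, J.mul_mem_left _ hl⟩
    rw [hJ.disjoint.eq_bot, Submodule.mem_bot] at h1
    exact (Units.mul_right_eq_zero v).1 h1
  · intro y _
    have h1 : (v : T.presheaf.stalk p) * y ∈
        ((LinearMap.range (evalLinearForms (k := k) a)).map f.toLinearMap) ⊔ J.restrictScalars k := by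
      rw [hJ.codisjoint.eq_top]
      trivial
    obtain ⟨_, ⟨_, ⟨l, rfl⟩, rfl⟩, z, hz, hy⟩ := Submodule.mem_sup.1 h1
    refine AddSubgroup.mem_sup.2 ⟨_, ⟨l, rfl⟩, v⁻¹ * z, J.mul_mem_left _ hz, ?_⟩
    apply v.isUnit.mul_left_cancel
    rw [← hy, mul_add, Units.mul_inv_cancel_left]
    exact congrArg (· + z) (hW l).symm

/-- The local rings of a finite closed subscheme of projective space are generated by the
quotients `x_j / x_i` of coordinates. -/
theorem adjoin_linearFormsToStalk [IsAffine T] [IsArtinianRing Γ(T, ⊤)] [IsClosedImmersion g]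
    (p : T) (i : Fin (r + 1)) (hp : p ∈ g ⁻¹ᵁ chart k i) [Algebra k (T.presheaf.stalk p)]
    (halg : algebraMap k (T.presheaf.stalk p) =
      (T.presheaf.germ ⊤ p trivial).hom.comp (structureHom (g ≫ PSpace.str k r))) :
    Algebra.adjoin k (Set.range fun j => linearFormsToStalk g p i hp ⟨_, X_mem_forms j⟩) = ⊤ := by
  rw [eq_top_iff]
  rintro y -
  obtain ⟨b, rfl⟩ := germ_surjective p y
  have hsurj : Function.Surjective (g.app (chart k i)) :=
    Scheme.Hom.app_surjective g _
      (Proj.isAffineOpen_basicOpen (forms k r) _ (X_mem_forms i) one_pos)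
  obtain ⟨c, hc⟩ := hsurj (T.presheaf.map (homOfLE le_top).op b)
  obtain ⟨x, rfl⟩ := (Proj.basicOpenIsoAway (forms k r) _ (X_mem_forms i)
    one_pos).commRingCatIsoToRingEquiv.surjective c
  obtain ⟨d, F, rfl⟩ := exists_awayFrac i x
  have h1 : T.presheaf.germ (g ⁻¹ᵁ chart k i) p hp (restrictForm g d i F) =
      T.presheaf.germ ⊤ p trivial b :=
    (congrArg (T.presheaf.germ (g ⁻¹ᵁ chart k i) p hp) hc).trans
      (TopCat.Presheaf.germ_res_apply _ _ p hp _)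
  rw [← h1, germ_restrictForm, ← halg, ← MvPolynomial.aeval_def,
    Algebra.adjoin_range_eq_range_aeval]
  exact ⟨_, rfl⟩

theorem isGorensteinScheme_of_liesOnRationalNormalCurve [IsAffine T] [Algebra k Γ(T, ⊤)]
    [Module.Finite k Γ(T, ⊤)] [IsClosedImmersion g]
    (halg : algebraMap k Γ(T, ⊤) = structureHom (g ≫ PSpace.str k r))
    (h : LiesOnRationalNormalCurve g) : IsGorensteinScheme T := by
  intro p
  have : IsArtinianRing Γ(T, ⊤) := IsArtinianRing.of_finite k _
  obtain ⟨l, hl⟩ := h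
  obtain ⟨i, hp⟩ := exists_mem_chart g p
  let γ := (T.presheaf.germ ⊤ p trivial).hom
  let : Algebra k (T.presheaf.stalk p) := (γ.comp (structureHom (g ≫ PSpace.str k r))).toAlgebra
  let f : Γ(T, ⊤) →ₐ[k] T.presheaf.stalk p := { γ with commutes' := fun c => by rw [halg]; rfl }
  have : Module.Finite k (T.presheaf.stalk p) :=
    Module.Finite.of_surjective f.toLinearMap (germ_surjective p)
  refine injective_of_rationalNormalCurve (l := l) (i₀ := i)
    (a := fun j => linearFormsToStalk g p i hp ⟨_, X_mem_forms j⟩) (fun d F hF hlF => ?_)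
    (linearFormsToStalk_self g p i hp) (adjoin_linearFormsToStalk p i hp rfl)
  have h1 := germ_restrictForm g p i hp (⟨F, hF⟩ : forms k r d)
  rw [hl d ⟨F, hF⟩ hlF i] at h1
  exact h1.symm.trans (map_zero (T.presheaf.germ (g ⁻¹ᵁ chart k i) p hp).hom)

theorem IsGorensteinScheme.injective_localization [IsAffine T] (h : IsGorensteinScheme T)
    (x : PrimeSpectrum Γ(T, ⊤)) : Module.Injective (Localization.AtPrime x.asIdeal)
      (Localization.AtPrime x.asIdeal) := by
  let : Algebra Γ(T, ⊤) (T.presheaf.stalk ((isAffineOpen_top T).fromSpec x)) :=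
    (T.presheaf.germ ⊤ ((isAffineOpen_top T).fromSpec x) trivial).hom.toAlgebra
  have : IsLocalization.AtPrime (T.presheaf.stalk ((isAffineOpen_top T).fromSpec x)) x.asIdeal :=
    isLocalization_germ x
  let e : T.presheaf.stalk ((isAffineOpen_top T).fromSpec x) ≃+* Localization.AtPrime x.asIdeal :=
    (IsLocalization.algEquiv x.asIdeal.primeCompl _ (Localization.AtPrime x.asIdeal)).toRingEquiv
  have := h ((isAffineOpen_top T).fromSpec x)
  exact Module.Injective.of_ringEquiv e e.toSemilinearEquiv

end Local

/-! ### Finite schemes geometrically in linearly general position -/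

section Curvilinear

variable {k K A : Type*} [Field k] [Field K] [Algebra k K] [CommRing A] [Algebra k A]
  [Module.Finite k A]

/-- The local rings of a Gorenstein scheme of degree at least `r + 3` in general position in
`ℙ^r`, where `r ≥ 1`, are uniserial. -/
theorem isUniserialAt_of_inGeneralPosition [IsAlgClosed K] {r : ℕ} (hr : 1 ≤ r) {lam : A →ₗ[k] k}
    (h : IsNondegenerate lam) (hA : r + 3 ≤ Module.finrank k A) {a : Fin (r + 1) → A}
    (hind : LinearIndependent K fun j => (1 : K) ⊗ₜ[k] a j)
    (hGP : InGeneralPosition (Submodule.span K (Set.range fun j => (1 : K) ⊗ₜ[k] a j)))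
    (p : Ideal A) [hp : p.IsPrime] : IsUniserialAt p := by
  have : IsArtinianRing A := IsArtinianRing.of_finite k A
  have : IsArtinianRing (K ⊗[k] A) := IsArtinianRing.of_finite K _
  have hdim :
      Module.finrank K (Submodule.span K (Set.range fun j => (1 : K) ⊗ₜ[k] a j)) = r + 1 := by
    rw [finrank_span_eq_card hind, Fintype.card_fin]
  have hK := h.baseChange K
  -- The prime `p` is the contraction of a prime of `K ⊗ A`.
  obtain ⟨M, hM⟩ : ∃ M : PrimeSpectrum (K ⊗[k] A), PrimeSpectrum.comap
      (Algebra.TensorProduct.includeRight : A →ₐ[k] K ⊗[k] A).toRingHom M = ⟨p, hp⟩ := by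
    obtain ⟨M, hM⟩ := PrimeSpectrum.comap_surjective_of_faithfullyFlat (B := A ⊗[k] K) ⟨p, hp⟩
    refine ⟨PrimeSpectrum.comap (Algebra.TensorProduct.comm k K A).toAlgHom.toRingHom M, ?_⟩
    rw [← PrimeSpectrum.comap_comp_apply, ← hM]
    congr 1
  have hMmax : M.asIdeal.IsMaximal := inferInstance
  obtain ⟨t, ht, hle⟩ := exists_le_span_sup_sq_of_principal hK (N := r + 2) (by omega)
    (by rw [Module.finrank_baseChange]; omega)
    (fun J hJ => hGP.exists_eq_span_singleton hK (by rw [hJ, hdim])) M.asIdeal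
  have h1 := (isUniserialAt_of_le_span_sup_sq ht hle).of_baseChange
  have h2 : M.asIdeal.comap (Algebra.TensorProduct.includeRight : A →ₐ[k] K ⊗[k] A) = p :=
    congrArg PrimeSpectrum.asIdeal hM
  rwa [h2] at h1

end Curvilinear

section Finite

variable {k : Type u} [Field k] {r : ℕ} {T : Scheme.{u}} {g : T ⟶ PSpace k r}

theorem finite_structureHom {s : T ⟶ Spec (.of k)} [IsFinite s] [Algebra k Γ(T, ⊤)]
    (halg : algebraMap k Γ(T, ⊤) = structureHom s) : Module.Finite k Γ(T, ⊤) := by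
  rw [← RingHom.finite_algebraMap, halg]
  exact s.finite_appTop.comp (RingHom.Finite.of_surjective _
    (Scheme.ΓSpecIso (.of k)).symm.commRingCatIsoToRingEquiv.surjective)

variable [IsAffine T] [Algebra k Γ(T, ⊤)] [Module.Finite k Γ(T, ⊤)]

/-- Over the algebraic closure, the span of the homogeneous coordinates of a scheme geometrically in
linearly general position is in general position. -/
theorem GeometricallyLGP.inGeneralPosition (hg : GeometricallyLGP g)
    (halg : algebraMap k Γ(T, ⊤) = structureHom (g ≫ PSpace.str k r))
    {a : Fin (r + 1) → Γ(T, ⊤)} (ha : IsCoordinates g a) :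
    InGeneralPosition (Submodule.span (AlgebraicClosure k)
      (Set.range fun j => (1 : AlgebraicClosure k) ⊗ₜ[k] a j)) ∧
    (r + 1 ≤ Module.finrank k Γ(T, ⊤) →
      LinearIndependent (AlgebraicClosure k) fun j => (1 : AlgebraicClosure k) ⊗ₜ[k] a j) := by
  have := isAffine_pullback_proj (K := AlgebraicClosure k) g
  let : Algebra (AlgebraicClosure k)
      Γ(Limits.pullback g (PSpace.proj k (AlgebraicClosure k) r), ⊤) :=
    (structureHom (geomFiber g ≫ PSpace.str (AlgebraicClosure k) r)).toAlgebra
  obtain ⟨e, he⟩ := exists_tensor_algEquiv (K := AlgebraicClosure k) g halg rfl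
  have := Module.Finite.equiv e.toLinearEquiv
  have ha' := ha.pullback (K := AlgebraicClosure k)
  constructor
  · have h1 := (LinearlyGeneralPosition.inGeneralPosition hg ha' rfl).map e.symm.toAlgHom
      e.symm.surjective
    rw [Submodule.map_span, ← Set.range_comp] at h1
    convert h1 using 4 with j
    exact ((e.symm_apply_eq).2 (he _).symm).symm
  · intro hr
    have h1 := LinearlyGeneralPosition.linearIndependent hg ha' rfl (by
      rwa [← e.toLinearEquiv.finrank_eq, Module.finrank_baseChange])
    simp only [← he] at h1
    exact h1.of_comp e.toLinearMap

theorem GeometricallyLGP.isUnramifiedAt_geomFiber (hg : GeometricallyLGP g)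
    (halg : algebraMap k Γ(T, ⊤) = structureHom (g ≫ PSpace.str k r))
    (p : ↥(Limits.pullback g (PSpace.proj k (AlgebraicClosure k) r))) :
    IsUnramifiedAt (geomFiber g) p := by
  have : IsArtinianRing Γ(T, ⊤) := IsArtinianRing.of_finite k _
  have := isAffine_pullback_proj (K := AlgebraicClosure k) g
  let : Algebra (AlgebraicClosure k)
      Γ(Limits.pullback g (PSpace.proj k (AlgebraicClosure k) r), ⊤) :=
    (structureHom (geomFiber g ≫ PSpace.str (AlgebraicClosure k) r)).toAlgebra
  obtain ⟨e, he⟩ := exists_tensor_algEquiv (K := AlgebraicClosure k) g halg rfl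
  have := Module.Finite.equiv e.toLinearEquiv
  obtain ⟨a, ha⟩ := exists_isCoordinates g
  have ha' := ha.pullback (K := AlgebraicClosure k)
  refine isUnramifiedAt_of_inGeneralPosition ha'
    (LinearlyGeneralPosition.inGeneralPosition hg ha' rfl) p (fun m hm => ?_) rfl
  let : Algebra (AlgebraicClosure k)
      ((Limits.pullback g (PSpace.proj k (AlgebraicClosure k) r)).presheaf.stalk p) :=
    (((Limits.pullback g (PSpace.proj k (AlgebraicClosure k) r)).presheaf.germ ⊤ p
      trivial).hom.comp (algebraMap _ _)).toAlgebra
  have : IsArtinianRing Γ(Limits.pullback g (PSpace.proj k (AlgebraicClosure k) r), ⊤) :=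
    IsArtinianRing.of_finite (AlgebraicClosure k) _
  let φ : Γ(Limits.pullback g (PSpace.proj k (AlgebraicClosure k) r), ⊤) →ₐ[AlgebraicClosure k]
      (Limits.pullback g (PSpace.proj k (AlgebraicClosure k) r)).presheaf.stalk p :=
    { ((Limits.pullback g (PSpace.proj k (AlgebraicClosure k) r)).presheaf.germ ⊤ p
        trivial).hom with commutes' := fun _ => rfl }
  have := Module.Finite.of_surjective φ.toLinearMap (germ_surjective p)
  exact surjective_algebraMap_quotient m hm

theorem GeometricallyLGP.isUnramifiedAt (hg : GeometricallyLGP g)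
    (halg : algebraMap k Γ(T, ⊤) = structureHom (g ≫ PSpace.str k r)) {p : T}
    (hp : IsRationalPoint (g ≫ PSpace.str k r) p) : IsUnramifiedAt g p := by
  have : IsArtinianRing Γ(T, ⊤) := IsArtinianRing.of_finite k _
  obtain ⟨a, ha⟩ := exists_isCoordinates g
  refine isUnramifiedAt_of_inGeneralPosition ha
    (InGeneralPosition.of_baseChange _ (hg.inGeneralPosition halg ha).1) p (fun m hm => ?_) halg
  obtain rfl := IsLocalRing.eq_maximalIdeal hm
  rw [halg]
  exact hp

theorem GeometricallyLGP.isCurvilinear [IsClosedImmersion g] (hg : GeometricallyLGP g)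
    (halg : algebraMap k Γ(T, ⊤) = structureHom (g ≫ PSpace.str k r))
    (hdeg : r + 3 ≤ Module.finrank k Γ(T, ⊤)) (hT : IsGorensteinScheme T) : IsCurvilinear k T := by
  have : IsArtinianRing Γ(T, ⊤) := IsArtinianRing.of_finite k _
  intro p
  let : Algebra k (T.presheaf.stalk p) := ((T.presheaf.germ ⊤ p trivial).hom.comp
    (structureHom (g ≫ PSpace.str k r))).toAlgebra
  have : IsArtinianRing (T.presheaf.stalk p) :=
    (germ_surjective p).isArtinianRing (f := (T.presheaf.germ ⊤ p trivial).hom)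
  obtain ⟨t, ht⟩ : ∃ t, IsLocalRing.maximalIdeal (T.presheaf.stalk p) = Ideal.span {t} := by
    rcases Nat.eq_zero_or_pos r with rfl | hr
    · -- The local rings of a subscheme of `ℙ^0` are equal to `k`.
      obtain ⟨i, hp⟩ := exists_mem_chart g p
      have h1 := adjoin_linearFormsToStalk (g := g) p i hp rfl
      have h2 : (Set.range fun j => linearFormsToStalk g p i hp ⟨_, X_mem_forms j⟩) = {1} := by
        refine Set.eq_singleton_iff_unique_mem.2 ⟨⟨i, linearFormsToStalk_self g p i hp⟩, ?_⟩
        rintro _ ⟨j, rfl⟩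
        obtain rfl : j = i := Fin.ext (by omega)
        exact linearFormsToStalk_self g p j hp
      refine ⟨0, ?_⟩
      rw [Ideal.span_singleton_eq_bot.2 rfl, eq_bot_iff]
      intro x hx
      have h3 : x ∈ Algebra.adjoin k {(1 : T.presheaf.stalk p)} := by
        rw [← h2, h1]
        trivial
      rw [Algebra.adjoin_singleton_one] at h3
      obtain ⟨c, rfl⟩ := Algebra.mem_bot.1 h3
      by_contra hc
      refine hx (IsUnit.map _ (isUnit_iff_ne_zero.2 fun hc0 => hc ?_))
      rw [hc0, map_zero]
      exact zero_mem _
    · obtain ⟨a, ha⟩ := exists_isCoordinates g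
      have h1 := hg.inGeneralPosition halg ha
      obtain ⟨lam, hlam⟩ := exists_isNondegenerate (k := k) hT.injective_localization
      obtain ⟨x, rfl⟩ := exists_fromSpec_eq p
      let : Algebra Γ(T, ⊤) (T.presheaf.stalk ((isAffineOpen_top T).fromSpec x)) :=
        (T.presheaf.germ ⊤ ((isAffineOpen_top T).fromSpec x) trivial).hom.toAlgebra
      have : IsLocalization.AtPrime (T.presheaf.stalk ((isAffineOpen_top T).fromSpec x))
        x.asIdeal := isLocalization_germ x
      exact (isUniserialAt_of_inGeneralPosition hr hlam hdeg (h1.2 (by omega)) h1.1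
        x.asIdeal).exists_maximalIdeal_eq_span
  obtain ⟨n, hn⟩ := exists_ringEquiv_truncated_polynomial k ht
  exact ⟨IsLocalRing.ResidueField (T.presheaf.stalk p), inferInstance, inferInstance, n, hn⟩

theorem GeometricallyLGP.liesOnRationalNormalCurve (hg : GeometricallyLGP g)
    (halg : algebraMap k Γ(T, ⊤) = structureHom (g ≫ PSpace.str k r))
    (hdeg : Module.finrank k Γ(T, ⊤) = r + 3) (hT : IsGorensteinScheme T) :
    LiesOnRationalNormalCurve g := by
  have : IsArtinianRing Γ(T, ⊤) := IsArtinianRing.of_finite k _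
  obtain ⟨a, ha⟩ := exists_isCoordinates g
  have h1 := hg.inGeneralPosition halg ha
  obtain ⟨lam, hlam⟩ := exists_isNondegenerate (k := k) hT.injective_localization
  obtain ⟨l, hl⟩ := exists_basis_binary_forms (AlgebraicClosure k) hlam hdeg
    (h1.2 (by omega)) h1.1
  exact ⟨l, fun d F hF => (ha.vanishes_iff_aeval halg F).2 (hl d F.1 F.2 hF)⟩

end Finite

end FiniteInProj

theorem theorem4p1 {k : Type u} [Field k] (r : ℕ) {Γ : Scheme.{u}} (ι : Γ ⟶ PSpace k r)
    [IsClosedImmersion ι] [IsFinite (ι ≫ PSpace.str k r)] (hΓ : GeometricallyLGP ι) :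
    (degree (ι ≫ PSpace.str k r) = r + 3 →
      (LiesOnRationalNormalCurve ι ↔ IsGorensteinScheme Γ)) ∧
    (r + 3 ≤ degree (ι ≫ PSpace.str k r) → IsGorensteinScheme Γ →
      IsCurvilinear k Γ ∧
      (∀ p, IsUnramifiedAt (geomFiber ι) p) ∧
      (∀ p, IsRationalPoint (ι ≫ PSpace.str k r) p → IsUnramifiedAt ι p)) := by
  have : IsAffine Γ := isAffine_of_isAffineHom (ι ≫ PSpace.str k r)
  let : Algebra k (Γ.presheaf.obj (.op ⊤)) := (structureHom (ι ≫ PSpace.str k r)).toAlgebra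
  have := finite_structureHom (s := ι ≫ PSpace.str k r) rfl
  exact ⟨fun hdeg => ⟨isGorensteinScheme_of_liesOnRationalNormalCurve rfl,
    hΓ.liesOnRationalNormalCurve rfl hdeg⟩, fun hdeg hGor => ⟨hΓ.isCurvilinear rfl hdeg hGor,
    hΓ.isUnramifiedAt_geomFiber rfl, fun _ hp => hΓ.isUnramifiedAt rfl hp⟩⟩
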